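/- **Setting.** Logarithms are natural. A memoryless channel is given by a transition density $P_{\mathrm{out}}(y|u)\ge 0$, $u,y\in\mathbb R$, jointly measurable, with $\int P_{\mathrm{out}}(y|u)\,\nu(dy)=1$ for every $u$, where $\nu$ is a $\sigma$-finite measure on $\mathbb R$. Its capacity is $\mathcal C=I(Y;Z)$ with $Z\sim\mathcal N(0,1)$, $Y\sim P_{\mathrm{out}}(\cdot|Z)$, assumed finite. For $0<\sigma\le 1$ let $$g_{\mathrm{out}}(p,y,\sigma)=\frac1\sigma\left(\frac{\int z\,P_{\mathrm{out}}(y|z)e^{-(z-p)^2/(2\sigma)}dz}{\int P_{\mathrm{out}}(y|z)e^{-(z-p)^2/(2\sigma)}dz}-p\right),\qquad f_{\mathrm{out}}(\sigma)=-\mathbb E\,\partial_p g_{\mathrm{out}}(P,Y,\sigma),$$ where $(P,Z_0)$ is centred jointly Gaussian with $\mathbb E Z_0^2=1$, $\mathbb E P^2=\mathbb E PZ_0=1-\sigma$, and $Y\sim P_{\mathrm{out}}(\cdot|Z_0)$. For $\Gamma,\omega\in\mathbb N$, $\rho\in(0,1)$ and $r,c\in[\Gamma]=\{1,\dots,\Gamma\}$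 let $\gamma_r=\#\{c\in[\Gamma]:|r-c|\le\omega\}$ and let $W_{rc}=(1-\rho)\Gamma/\gamma_r$ if $|r-c|\le\omega$, $W_{rc}=\rho\,\Gamma/(\Gamma-\gamma_r)$ otherwise. Let $\mathcal I=\{1,\dots,4\omega\}\cup\{\Gamma-4\omega+1,\dots,\Gamma\}$. For a rate $R>0$ and $M\in\mathbb N$ the state evolution is $\psi_c^t=0$ for $c\in\mathcal I$, $t\ge0$, and, for $c\in[\Gamma]\setminus\mathcal I$, $\psi_c^0=1$ and $$\sigma_r^t=\frac1\Gamma\sum_{c=1}^{\Gamma}W_{rc}\psi_c^t,\quad \tau_c^t=\frac{R}{\ln M}\Big[\frac1\Gamma\sum_{r=1}^{\Gamma}W_{rc}f_{\mathrm{out}}(\sigma_r^t)\Big]^{-1},\quad \psi_c^{t+1}=1-\varepsilon(\tau_c^t),$$ $$\varepsilon(\tau)=\mathbb E\left[\frac{e^{U_1/\sqrt\tau}}{e^{U_1/\sqrt\tau}+e^{-1/\tau}\sum_{j=2}^M e^{U_j/\sqrt\tau}}\right],\qquad U_1,\dots,U_M\ \text{i.i.d. } \mathcal N(0,1).$$ **Lemma.**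 There is a universal constant $k>0$ such that the following holds. Let $0<R<\mathcal C$, $\Delta=\mathcal C-R$, $\delta\in(0,\min\{\frac{\Delta}{2R},\frac12\})$, and $0<\rho<h(\Delta)/2$, where $h=h(\Delta)\in(0,1]$ is the solution of $\int_0^h f_{\mathrm{out}}(x)\,dx=\frac32\Delta$. Put $$f_{M,\delta}=\frac{M^{-k\delta^2}}{\delta\sqrt{\log M}} .$$ 1. If $R<\frac{1-\rho}{2+\delta}f_{\mathrm{out}}(1)$, then for all $M$ large enough (depending on the channel, $R,\delta,\rho$ only) and all $\Gamma,\omega$: $\psi_c^1\le f_{M,\delta}$ for all $c\in[\Gamma]$. 2. If $\frac{1-\rho}{2+\delta}f_{\mathrm{out}}(1)\le R$, let $g=g(\omega)$ be the largest $k'\in\mathbb N$, $k'\le 2\omega+1$, with $$\int_0^{\min\{1,\,2\rho+\frac{k'(1-\rho)}{2\omega+1}\}}f_{\mathrm{out}}(x)\,dx-\frac{k'}{2\omega+1}(1-\rho)f_{\mathrm{out}}(1)<\frac32\Delta .$$ Then $g\ge1$ for all sufficiently large $\omega$ (how large does not depend on $M$). Moreover, for all $M$ large enough (depending on the channel, $R,\delta,\rho$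 only), all $\Gamma$ and all $\omega$ with $g\ge1$, all $t\ge1$ and all $1\le c\le\min\{4\omega+tg,\lceil\Gamma/2\rceil\}$: $$\psi_c^t=\psi_{\Gamma-c+1}^t\le f_{M,\delta}.$$ -/

import Mathlib

open MeasureTheory ProbabilityTheory

/-- A memoryless channel with real input and real output, given by its transition density
`P_out(y | u) = dens u y` with respect to a σ-finite reference measure on the output alphabet
(Lebesgue measure for channels with a density, a counting measure for discrete outputs). -/
structure MemorylessChannel where
  ref : Measure ℝ
  sigmaFinite_ref : SigmaFinite ref
  dens : ℝ → ℝ → ℝ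
  measurable_dens : Measurable (Function.uncurry dens)
  dens_nonneg : ∀ u y, 0 ≤ dens u y
  lintegral_dens : ∀ u, ∫⁻ y, ENNReal.ofReal (dens u y) ∂ref = 1

namespace MemorylessChannel

attribute [instance] MemorylessChannel.sigmaFinite_ref

variable (P : MemorylessChannel)

/-- The Markov kernel `u ↦ P_out(dy | u)`. -/
noncomputable def kernel : Kernel ℝ ℝ :=
  Kernel.withDensity (Kernel.const ℝ P.ref) (fun u y => ENNReal.ofReal (P.dens u y))

/-- The joint law of `(Z, Y)` with `Z ∼ N(0,1)` and `Y ∼ P_out(· | Z)`. -/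
noncomputable def jointLaw : Measure (ℝ × ℝ) :=
  (gaussianReal 0 1).compProd P.kernel

/-- The mutual information `I(Y; Z)` in nats: the Kullback-Leibler divergence of the joint law
from the product of its marginals. -/
noncomputable def mutualInfo : ENNReal :=
  InformationTheory.klDiv P.jointLaw (P.jointLaw.fst.prod P.jointLaw.snd)

/-- The capacity `C = I(Y; Z)` as a real number. An infinite mutual information gets the
value `0`, so that `0 < R < C` forces it to be finite. -/
noncomputable def capacity : ℝ := P.mutualInfo.toReal

/-- The posterior mean of `z` under the density proportional to
`P_out(y | z) exp(-(z - p)² / (2σ))`. -/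
noncomputable def posteriorMean (p y σ : ℝ) : ℝ :=
  (∫ z, z * (P.dens z y * Real.exp (-(z - p) ^ 2 / (2 * σ)))) /
    (∫ z, P.dens z y * Real.exp (-(z - p) ^ 2 / (2 * σ)))

/-- The scalar output estimator `g_out(p, y, σ)`. -/
noncomputable def gOut (p y σ : ℝ) : ℝ := (P.posteriorMean p y σ - p) / σ

/-- `f_out(σ) = -E ∂_p g_out(P, Y, σ)`, where `P = √(1-σ) ξ`, `Z₀ = P + √σ z` with `ξ`, `z`
independent standard Gaussians (so `E Z₀² = 1`, `E P² = E P Z₀ = 1 - σ`) and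
`Y ∼ P_out(· | Z₀)`. Meaningful for `0 < σ ≤ 1`. -/
noncomputable def fOut (σ : ℝ) : ℝ :=
  -∫ w : ℝ × ℝ, (∫ y, deriv (fun p => P.gOut p y σ) (√(1 - σ) * w.1)
      ∂(P.kernel (√(1 - σ) * w.1 + √σ * w.2)))
    ∂((gaussianReal 0 1).prod (gaussianReal 0 1))

end MemorylessChannel

namespace SCSPARC

/-- `γ_r`, the number of columns `c ∈ {1, …, Γ}` with `|r - c| ≤ ω`. -/
def bandCount (Γ ω r : ℕ) : ℕ :=
  ((Finset.Icc 1 Γ).filter (fun c : ℕ => |(r : ℤ) - (c : ℤ)| ≤ (ω : ℤ))).card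

/-- The base matrix `W`, with row and column indices in `{1, …, Γ}`. -/
noncomputable def baseMatrix (Γ ω : ℕ) (ρ : ℝ) (r c : ℕ) : ℝ :=
  if |(r : ℤ) - (c : ℤ)| ≤ (ω : ℤ) then (1 - ρ) * ((Γ : ℝ) / (bandCount Γ ω r : ℝ))
  else ρ * ((Γ : ℝ) / ((Γ : ℝ) - (bandCount Γ ω r : ℝ)))

/-- The seed `{1, …, 4ω} ∪ {Γ - 4ω + 1, …, Γ}`. -/
def IsSeed (Γ ω c : ℕ) : Prop := c ≤ 4 * ω ∨ Γ < c + 4 * ω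

/-- `ε(τ) = E [e^{U₁/√τ} / (e^{U₁/√τ} + e^{-1/τ} ∑_{j=2}^M e^{U_j/√τ})]` for independent
standard Gaussians `U₁, …, U_M`; here `u.1` is `U₁` and `u.2` is `(U₂, …, U_M)`. -/
noncomputable def sectionEps (M : ℕ) (τ : ℝ) : ℝ :=
  ∫ u : ℝ × (Fin (M - 1) → ℝ),
    Real.exp (u.1 / √τ) /
      (Real.exp (u.1 / √τ) + Real.exp (-1 / τ) * ∑ j, Real.exp (u.2 j / √τ))
    ∂((gaussianReal 0 1).prod (Measure.pi fun _ => gaussianReal 0 1))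

/-- `σ_r = (1/Γ) ∑_c W_{rc} ψ_c`. -/
noncomputable def seSigma (Γ ω : ℕ) (ρ : ℝ) (ψ : ℕ → ℝ) (r : ℕ) : ℝ :=
  1 / (Γ : ℝ) * ∑ c ∈ Finset.Icc 1 Γ, baseMatrix Γ ω ρ r c * ψ c

/-- `φ_r = f_out(σ_r)⁻¹`. -/
noncomputable def sePhi (P : MemorylessChannel) (Γ ω : ℕ) (ρ : ℝ) (ψ : ℕ → ℝ) (r : ℕ) : ℝ :=
  (P.fOut (seSigma Γ ω ρ ψ r))⁻¹

/-- `τ_c = (R / ln M) [(1/Γ) ∑_r W_{rc} / φ_r]⁻¹`. -/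
noncomputable def seTau (P : MemorylessChannel) (R : ℝ) (M Γ ω : ℕ) (ρ : ℝ) (ψ : ℕ → ℝ)
    (c : ℕ) : ℝ :=
  R / Real.log M *
    (1 / (Γ : ℝ) * ∑ r ∈ Finset.Icc 1 Γ, baseMatrix Γ ω ρ r c / sePhi P Γ ω ρ ψ r)⁻¹

open Classical in
/-- The state evolution error `ψ_c^t` (arguments `t`, then `c`). -/
noncomputable def sePsi (P : MemorylessChannel) (R : ℝ) (M Γ ω : ℕ) (ρ : ℝ) : ℕ → ℕ → ℝ
  | 0 => fun c => if IsSeed Γ ω c then 0 else 1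
  | t + 1 => fun c =>
      if IsSeed Γ ω c then 0
      else 1 - sectionEps M (seTau P R M Γ ω ρ (sePsi P R M Γ ω ρ t) c)

/-- `g`, the largest natural number `k ≤ 2ω + 1` with
`∫_0^{2ρ + k(1-ρ)/(2ω+1)} f_out(x) dx - k/(2ω+1) (1-ρ) f_out(1) < (3/2) (C - R)`.
As `f_out` lives on `[0, 1]`, the interval of integration is cut off at `1`. -/
noncomputable def waveSpeed (P : MemorylessChannel) (R ρ : ℝ) (ω : ℕ) : ℕ :=
  sSup {k : ℕ | k ≤ 2 * ω + 1 ∧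
    (∫ x in (0 : ℝ)..(min 1 (2 * ρ + (k : ℝ) * (1 - ρ) / (2 * (ω : ℝ) + 1))), P.fOut x)
      - (k : ℝ) / (2 * (ω : ℝ) + 1) * (1 - ρ) * P.fOut 1 < 3 / 2 * (P.capacity - R)}

/-- The error level `M^{-kδ²} / (δ √(log M))`. -/
noncomputable def errLevel (k : ℝ) (M : ℕ) (δ : ℝ) : ℝ :=
  (M : ℝ) ^ (-(k * δ ^ 2)) / (δ * √(Real.log M))

end SCSPARC

/-! Two independent facts carry the theorem: a wave argument for the state evolution, and three
properties of `f_out` (nonnegative, antitone on `(0,1]`, integral over `(0,1)` at least `2C`).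

The wave. A Chernoff bound on `U₁` and a first-moment bound on the competing terms make `1 - ε(τ)`
polynomially small in `M` once `1/τ ≥ (2+δ) log M` (`one_sub_sectionEps_le_rpow`), that is, once the
column average of `f_out(σ_r)` is at least `(2+δ)R`. Suppose the error is at most `ρ` up to column
`4ω + tg`. For an unseeded column at most `g` further on, the successive rows of its band see at
most `g, g+1, …` undecoded columns. Put `s = (1-ρ)/(2ω+1)` and `x = min 1 (2ρ + gs)`. As `f_out` is
antitone, the column average dominates an upper Riemann sum of `f_out` over `[x,1]` plus `g` copies
of `s f_out(1)` (`integral_add_le_sum`). By the choice of `g` this exceeds `∫₀¹ f_out - 3Δ/2 ≥ 2C -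
3Δ/2 = 2R + Δ/2 > (2+δ)R`, so the front advances by `g` in each iteration (`sePsi_le_of_waveSpeed`).

The function `f_out`. Smooth the likelihood `P_out(y|·)` by `N(p,v)`. Then `f_out(v)` is the Fisher
information in `p` of the result, averaged over `p ∼ N(0,1-v)` (`fOut_eq`). It is therefore
nonnegative, and further smoothing decreases it by Cauchy-Schwarz (`fisher_antitone`). For the area
bound, consider the entropy of the smoothed likelihood ratio: it vanishes at `v = 1`, and its lower
limit as `v → 0` bounds the mutual information by Fatou's lemma. Between levels `v₂` and `v₁ + v₂`
the Gaussian logarithmic Sobolev inequality at variance `v₁` bounds the entropy difference by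
`(v₁/2) f_out(v₂)`. Summing over fine partitions gives `C ≤ ½ ∫₀¹ f_out` (`two_mul_capacity_le`).
Only this inequality is needed, so the entropy is never differentiated in `v`. The logarithmic
Sobolev inequality itself is proved by monotone transport (`lintegral_klFun_le_fisher`). -/

namespace SCSPARC

/-! ### The section error -/

lemma integral_exp_mul_gaussianReal (t : ℝ) :
    ∫ x, Real.exp (t * x) ∂(gaussianReal 0 1) = Real.exp (t ^ 2 / 2) := by
  have := congrFun (mgf_id_gaussianReal (μ := 0) (v := 1)) t
  simpa [mgf] using this

/-- The law of `(U₁, (U₂, …, U_M))`. -/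
noncomputable abbrev sectionLaw (M : ℕ) : Measure (ℝ × (Fin (M - 1) → ℝ)) :=
  (gaussianReal 0 1).prod (Measure.pi fun _ => gaussianReal 0 1)

/-- The integrand of `sectionEps`. -/
noncomputable def softmaxWeight (M : ℕ) (τ : ℝ) (u : ℝ × (Fin (M - 1) → ℝ)) : ℝ :=
  Real.exp (u.1 / √τ) /
      (Real.exp (u.1 / √τ) + Real.exp (-1 / τ) * ∑ j, Real.exp (u.2 j / √τ))

lemma sectionEps_eq (M : ℕ) (τ : ℝ) :
    sectionEps M τ = ∫ u, softmaxWeight M τ u ∂(sectionLaw M) := rfl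

lemma measurable_softmaxWeight (M : ℕ) (τ : ℝ) : Measurable (softmaxWeight M τ) := by
  unfold softmaxWeight
  fun_prop

lemma softmaxWeight_nonneg (M : ℕ) (τ : ℝ) (u : ℝ × (Fin (M - 1) → ℝ)) :
    0 ≤ softmaxWeight M τ u := by
  unfold softmaxWeight; positivity

lemma softmaxWeight_le_one (M : ℕ) (τ : ℝ) (u : ℝ × (Fin (M - 1) → ℝ)) :
    softmaxWeight M τ u ≤ 1 := by
  unfold softmaxWeight
  rw [div_le_one (by positivity)]
  have : 0 ≤ Real.exp (-1 / τ) * ∑ j, Real.exp (u.2 j / √τ) := by positivity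
  linarith

lemma softmaxWeight_lt_one {M : ℕ} (hM : 2 ≤ M) (τ : ℝ) (u : ℝ × (Fin (M - 1) → ℝ)) :
    softmaxWeight M τ u < 1 := by
  unfold softmaxWeight
  rw [div_lt_one (by positivity)]
  have : Nonempty (Fin (M - 1)) := ⟨⟨0, by omega⟩⟩
  have : 0 < Real.exp (-1 / τ) * ∑ j, Real.exp (u.2 j / √τ) :=
    mul_pos (Real.exp_pos _) (Finset.sum_pos (fun _ _ => Real.exp_pos _) Finset.univ_nonempty)
  linarith

lemma integrable_softmaxWeight (M : ℕ) (τ : ℝ) :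
    Integrable (softmaxWeight M τ) (sectionLaw M) := by
  refine Integrable.of_bound (measurable_softmaxWeight M τ).aestronglyMeasurable 1
    (Filter.Eventually.of_forall fun u => ?_)
  rw [Real.norm_eq_abs, abs_of_nonneg (softmaxWeight_nonneg M τ u)]
  exact softmaxWeight_le_one M τ u

lemma sectionEps_nonneg (M : ℕ) (τ : ℝ) : 0 ≤ sectionEps M τ := by
  rw [sectionEps_eq]
  exact integral_nonneg (softmaxWeight_nonneg M τ)

lemma one_sub_sectionEps (M : ℕ) (τ : ℝ) :
    1 - sectionEps M τ = ∫ u, (1 - softmaxWeight M τ u) ∂(sectionLaw M) := by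
  rw [integral_sub (integrable_const _) (integrable_softmaxWeight M τ), sectionEps_eq]
  simp

/-- Strictness matters: it keeps every `σ_r` away from `0`, where `f_out` is not controlled. A
competing term must be present, whence `M ≥ 2`. -/
lemma one_sub_sectionEps_pos {M : ℕ} (hM : 2 ≤ M) (τ : ℝ) : 0 < 1 - sectionEps M τ := by
  rw [one_sub_sectionEps, integral_pos_iff_support_of_nonneg
    (fun u => sub_nonneg.2 (softmaxWeight_le_one M τ u))
    ((integrable_const _).sub (integrable_softmaxWeight M τ))]
  have : (Function.support fun u => 1 - softmaxWeight M τ u) = Set.univ := by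
    ext u
    simpa using (sub_pos.2 (softmaxWeight_lt_one hM τ u)).ne'
  rw [this]
  simp

/-- Splitting according to `U₁ > -s/√τ` or not. -/
lemma one_sub_softmaxWeight_le (M : ℕ) {τ s : ℝ} (hτ : 0 < τ) (hs : 0 ≤ s)
    (u : ℝ × (Fin (M - 1) → ℝ)) :
    1 - softmaxWeight M τ u ≤
      Real.exp (-(s ^ 2 / τ)) * Real.exp (-(s / √τ) * u.1) +
        Real.exp (-(1 - s) / τ) * ∑ j, Real.exp (1 / √τ * u.2 j) := by
  have hq : 0 < √τ := Real.sqrt_pos.2 hτ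
  have hqq : √τ * √τ = τ := Real.mul_self_sqrt hτ.le
  have hS : 0 ≤ ∑ j, Real.exp (1 / √τ * u.2 j) := by positivity
  -- On the lower tail of `U₁` the Chernoff factor alone is at least 1. Off it, the competing sum
  -- divided by the numerator is already at most the second term.
  rcases le_or_gt u.1 (-(s / √τ)) with h | h
  · have h1 : 1 ≤ Real.exp (-(s ^ 2 / τ)) * Real.exp (-(s / √τ) * u.1) := by
      rw [← Real.exp_add]
      apply Real.one_le_exp
      have : s ^ 2 / τ = (s / √τ) * (s / √τ) := by
        rw [div_mul_div_comm, hqq]; ring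
      rw [this]
      nlinarith [div_nonneg hs hq.le]
    have h2 := softmaxWeight_nonneg M τ u
    have : 0 ≤ Real.exp (-(1 - s) / τ) * ∑ j, Real.exp (1 / √τ * u.2 j) := by positivity
    linarith
  · have h1 : 0 ≤ Real.exp (-(s ^ 2 / τ)) * Real.exp (-(s / √τ) * u.1) := by positivity
    suffices h2 : 1 - softmaxWeight M τ u ≤
        Real.exp (-(1 - s) / τ) * ∑ j, Real.exp (1 / √τ * u.2 j) by linarith
    have e1 : ∀ j, u.2 j / √τ = 1 / √τ * u.2 j := fun j => by ring
    unfold softmaxWeight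
    simp only [e1]
    set S := ∑ j, Real.exp (1 / √τ * u.2 j)
    have hA := Real.exp_pos (u.1 / √τ)
    have hB : 0 ≤ Real.exp (-1 / τ) * S := by positivity
    rw [one_sub_div (by positivity), add_sub_cancel_left, div_le_iff₀ (by positivity)]
    have h3 : Real.exp (-1 / τ) ≤ Real.exp (-(1 - s) / τ) * Real.exp (u.1 / √τ) := by
      rw [← Real.exp_add, Real.exp_le_exp]
      have : -(s / τ) < u.1 / √τ := by
        have := (div_lt_div_iff_of_pos_right hq).2 h
        rwa [← neg_div', div_div, hqq] at this
      have e : -(1 - s) / τ = -1 / τ + s / τ := by ring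
      rw [e]; linarith
    calc Real.exp (-1 / τ) * S ≤ (Real.exp (-(1 - s) / τ) * Real.exp (u.1 / √τ)) * S := by gcongr
      _ ≤ (Real.exp (-(1 - s) / τ) * Real.exp (u.1 / √τ)) * S
          + Real.exp (-(1 - s) / τ) * S * (Real.exp (-1 / τ) * S) := by
          have : 0 ≤ Real.exp (-(1 - s) / τ) * S * (Real.exp (-1 / τ) * S) := by positivity
          linarith
      _ = _ := by ring

/-- The Gaussian moments cost factors `exp(s²/(2τ))` and `exp(1/(2τ))`. The second one turns the
rate `1 - s` into `1/2 - s` and thereby places the threshold at `1/τ = 2 log M`. -/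
lemma one_sub_sectionEps_le (M : ℕ) {τ s : ℝ} (hτ : 0 < τ) (hs : 0 ≤ s) :
    1 - sectionEps M τ ≤
      Real.exp (-(s ^ 2 / (2 * τ))) + M * Real.exp (-(1 / 2 - s) / τ) := by
  have hq : 0 < √τ := Real.sqrt_pos.2 hτ
  have hqq : √τ ^ 2 = τ := Real.sq_sqrt hτ.le
  have i1 : Integrable (fun u : ℝ × (Fin (M - 1) → ℝ) => Real.exp (-(s / √τ) * u.1))
      (sectionLaw M) := (integrable_exp_mul_gaussianReal _).comp_fst _
  have hp : ∀ j : Fin (M - 1), MeasurePreserving (fun u : ℝ × (Fin (M - 1) → ℝ) => u.2 j)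
      (sectionLaw M) (gaussianReal 0 1) := fun j =>
    (measurePreserving_eval (fun _ : Fin (M - 1) => gaussianReal 0 1) j).comp
      measurePreserving_snd
  have i2 : ∀ j : Fin (M - 1), Integrable
      (fun u : ℝ × (Fin (M - 1) → ℝ) => Real.exp (1 / √τ * u.2 j)) (sectionLaw M) := fun j =>
    (hp j).integrable_comp_of_integrable (g := fun x => Real.exp (1 / √τ * x))
      (integrable_exp_mul_gaussianReal _)
  have v1 : ∫ u : ℝ × (Fin (M - 1) → ℝ), Real.exp (-(s / √τ) * u.1) ∂(sectionLaw M)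
      = Real.exp (s ^ 2 / τ / 2) := by
    have := integral_fun_fst (μ := gaussianReal 0 1)
      (ν := Measure.pi fun _ : Fin (M - 1) => gaussianReal 0 1)
      (fun x => Real.exp (-(s / √τ) * x))
    rw [this, integral_exp_mul_gaussianReal]
    simp [div_pow, hqq]
  have v2 : ∀ j : Fin (M - 1), ∫ u : ℝ × (Fin (M - 1) → ℝ), Real.exp (1 / √τ * u.2 j)
      ∂(sectionLaw M) = Real.exp (1 / τ / 2) := by
    intro j
    have h := (hp j).map_eq
    have := integral_map (μ := sectionLaw M) (hp j).measurable.aemeasurable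
      (f := fun x => Real.exp (1 / √τ * x)) (by fun_prop)
    rw [h, integral_exp_mul_gaussianReal] at this
    rw [← this]
    simp [hqq]
  rw [one_sub_sectionEps]
  refine (integral_mono ((integrable_const _).sub (integrable_softmaxWeight M τ))
    ((i1.const_mul _).add ((integrable_finsetSum _ fun j _ => i2 j).const_mul _))
    (one_sub_softmaxWeight_le M hτ hs)).trans ?_
  simp only [Pi.add_apply]
  rw [integral_add (i1.const_mul _) ((integrable_finsetSum _ fun j _ => i2 j).const_mul _),
    integral_const_mul, integral_const_mul, integral_finsetSum _ fun j _ => i2 j, v1]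
  simp only [v2]
  rw [← Real.exp_add, Finset.sum_const, Finset.card_univ, Fintype.card_fin, nsmul_eq_mul,
    mul_left_comm, ← Real.exp_add]
  have e1 : -(s ^ 2 / τ) + s ^ 2 / τ / 2 = -(s ^ 2 / (2 * τ)) := by field_simp; ring
  have e2 : -(1 - s) / τ + 1 / τ / 2 = -(1 / 2 - s) / τ := by field_simp; ring
  rw [e1, e2]
  gcongr
  omega

/-- Above the threshold `1/τ = 2 log M`, the section error is polynomially small in `M`. -/
lemma one_sub_sectionEps_le_rpow {M : ℕ} (hM : 2 ≤ M) {τ δ : ℝ} (hτ : 0 < τ) (hδ : 0 < δ)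
    (hδ' : δ < 1 / 2) (h : τ ≤ 1 / ((2 + δ) * Real.log M)) :
    1 - sectionEps M τ ≤ 2 * (M : ℝ) ^ (-(δ ^ 2 / 100)) := by
  have hM1 : (1 : ℝ) < M := by exact_mod_cast hM
  have hl : 0 < Real.log M := Real.log_pos hM1
  have hM0 : (0 : ℝ) < M := by linarith
  have hν : (2 + δ) * Real.log M ≤ 1 / τ := by
    rw [le_div_iff₀ hτ]
    rw [le_div_iff₀ (by positivity)] at h
    linarith
  -- With `s = δ/10` the first exponent is at least `(δ²/100) log M`. The second power of `M` is `1
  -- - (1/2 - δ/10)(2+δ) = -3δ/10 + δ²/10`, below `-δ²/100` for `δ < 1/2`.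
  have hb := one_sub_sectionEps_le M hτ (s := δ / 10) (by positivity)
  have h1 : Real.exp (-((δ / 10) ^ 2 / (2 * τ))) ≤ (M : ℝ) ^ (-(δ ^ 2 / 100)) := by
    rw [Real.rpow_def_of_pos hM0, Real.exp_le_exp]
    have e : (δ / 10) ^ 2 / (2 * τ) = δ ^ 2 / 200 * (1 / τ) := by field_simp; ring
    rw [e]
    have : δ ^ 2 / 200 * (2 * Real.log M) ≤ δ ^ 2 / 200 * (1 / τ) := by
      gcongr; nlinarith
    nlinarith
  have h2 : M * Real.exp (-(1 / 2 - δ / 10) / τ) ≤ (M : ℝ) ^ (-(δ ^ 2 / 100)) := by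
    rw [Real.rpow_def_of_pos hM0]
    nth_rw 1 [← Real.exp_log hM0]
    rw [← Real.exp_add, Real.exp_le_exp]
    have e : -(1 / 2 - δ / 10) / τ = -((1 / 2 - δ / 10) * (1 / τ)) := by ring
    rw [e]
    have h3 : (1 / 2 - δ / 10) * ((2 + δ) * Real.log M) ≤ (1 / 2 - δ / 10) * (1 / τ) := by
      gcongr; linarith
    have h4 : 1 - (1 / 2 - δ / 10) * (2 + δ) ≤ -(δ ^ 2 / 100) := by nlinarith
    nlinarith
  linarith

-- Half of the exponent `δ²/100` is given up to absorb the factor `2δ√(log M)`, which is where `k =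
-- 1/200` comes from.
open Filter Topology in
lemma eventually_two_mul_rpow_le_errLevel {δ : ℝ} (hδ : 0 < δ) :
    ∀ᶠ M : ℕ in atTop, 2 * (M : ℝ) ^ (-(δ ^ 2 / 100)) ≤ errLevel (1 / 200) M δ := by
  have h1 : (fun x : ℝ => Real.log x) =o[atTop] fun x : ℝ => x ^ (δ ^ 2 / 100) :=
    isLittleO_log_rpow_atTop (by positivity)
  have h2 := (h1.bound (c := 1 / (4 * δ ^ 2)) (by positivity)).natCast_atTop
  filter_upwards [h2, eventually_ge_atTop 2] with M hM hM2
  have hM1 : (1 : ℝ) < M := by exact_mod_cast hM2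
  have hl : 0 < Real.log M := Real.log_pos hM1
  have hM0 : (0 : ℝ) < M := by linarith
  rw [Real.norm_of_nonneg hl.le, Real.norm_of_nonneg (by positivity)] at hM
  unfold errLevel
  rw [le_div_iff₀ (by positivity)]
  have e1 : (M : ℝ) ^ (-(δ ^ 2 / 100)) = (M : ℝ) ^ (-(1 / 200 * δ ^ 2)) *
      (M : ℝ) ^ (-(1 / 200 * δ ^ 2)) := by
    rw [← Real.rpow_add hM0]; congr 1; ring
  rw [e1]
  set a := (M : ℝ) ^ (-(1 / 200 * δ ^ 2)) with ha
  have ha0 : 0 < a := by positivity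
  have hb : (M : ℝ) ^ (δ ^ 2 / 100) = (a⁻¹) ^ 2 := by
    rw [ha, ← Real.rpow_neg hM0.le, sq (_ ^ (_ : ℝ)), ← Real.rpow_add hM0]
    congr 1; ring
  rw [hb] at hM
  have hs : √(Real.log M) ≤ a⁻¹ / (2 * δ) := by
    apply Real.sqrt_le_iff.2 ⟨by positivity, hM.trans (le_of_eq ?_)⟩
    field_simp; ring
  calc 2 * (a * a) * (δ * √(Real.log M)) ≤ 2 * (a * a) * (δ * (a⁻¹ / (2 * δ))) := by gcongr
    _ = a := by field_simp

open Filter Topology in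
lemma tendsto_errLevel {δ : ℝ} (hδ : 0 < δ) :
    Tendsto (fun M : ℕ => errLevel (1 / 200) M δ) atTop (𝓝 0) := by
  unfold errLevel
  have h1 : Tendsto (fun M : ℕ => (M : ℝ) ^ (-(1 / 200 * δ ^ 2))) atTop (𝓝 0) :=
    (tendsto_rpow_neg_atTop (by positivity)).comp tendsto_natCast_atTop_atTop
  have h2 : Tendsto (fun M : ℕ => δ * √(Real.log M)) atTop atTop :=
    (Real.tendsto_sqrt_atTop.comp
      (Real.tendsto_log_atTop.comp tendsto_natCast_atTop_atTop)).const_mul_atTop hδ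
  exact h1.div_atTop h2

lemma errLevel_nonneg (k : ℝ) (M : ℕ) {δ : ℝ} (hδ : 0 < δ) : 0 ≤ errLevel k M δ := by
  unfold errLevel; positivity

end SCSPARC


namespace SCSPARC

/-! ### The base matrix -/

/-- The band `{c ∈ {1, …, Γ} : |r - c| ≤ ω}`. -/
def band (Γ ω r : ℕ) : Finset ℕ :=
  (Finset.Icc 1 Γ).filter (fun c : ℕ => |(r : ℤ) - (c : ℤ)| ≤ (ω : ℤ))

lemma bandCount_eq (Γ ω r : ℕ) : bandCount Γ ω r = (band Γ ω r).card := rfl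

lemma mem_band {Γ ω r c : ℕ} : c ∈ band Γ ω r ↔ (1 ≤ c ∧ c ≤ Γ) ∧ c ≤ r + ω ∧ r ≤ c + ω := by
  simp only [band, Finset.mem_filter, Finset.mem_Icc, abs_le]
  omega

lemma bandCount_le (Γ ω r : ℕ) : bandCount Γ ω r ≤ Γ := by
  rw [bandCount_eq]
  exact (Finset.card_filter_le _ _).trans (by simp)

lemma bandCount_lt {Γ ω r c : ℕ} (hc : c ∈ Finset.Icc 1 Γ)
    (h : ¬ |(r : ℤ) - (c : ℤ)| ≤ (ω : ℤ)) : bandCount Γ ω r < Γ := by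
  have : (band Γ ω r).card < (Finset.Icc 1 Γ).card := by
    apply Finset.card_lt_card
    refine (Finset.ssubset_iff_of_subset (Finset.filter_subset _ _)).2 ⟨c, hc, ?_⟩
    simp only [Finset.mem_filter, not_and]
    exact fun _ => h
  simpa [bandCount_eq] using this

lemma bandCount_pos {Γ ω r : ℕ} (h : 1 ≤ r) (h' : r ≤ Γ) : 0 < bandCount Γ ω r := by
  rw [bandCount_eq, Finset.card_pos]
  exact ⟨r, mem_band.2 (by omega)⟩

lemma baseMatrix_nonneg (Γ ω : ℕ) {ρ : ℝ} (h0 : 0 < ρ) (h1 : ρ < 1) (r c : ℕ) :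
    0 ≤ baseMatrix Γ ω ρ r c := by
  unfold baseMatrix
  have h : (bandCount Γ ω r : ℝ) ≤ Γ := by exact_mod_cast bandCount_le Γ ω r
  split_ifs
  · have : 0 ≤ 1 - ρ := by linarith
    positivity
  · exact mul_nonneg h0.le (div_nonneg (by positivity) (by linarith))

lemma baseMatrix_pos {Γ ω : ℕ} {ρ : ℝ} (h0 : 0 < ρ) (h1 : ρ < 1) {r c : ℕ}
    (hr : r ∈ Finset.Icc 1 Γ) (hc : c ∈ Finset.Icc 1 Γ) : 0 < baseMatrix Γ ω ρ r c := by
  unfold baseMatrix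
  have hr' := Finset.mem_Icc.1 hr
  have hΓ : (0 : ℝ) < Γ := by exact_mod_cast (by omega : 0 < Γ)
  split_ifs with h
  · have : (0 : ℝ) < bandCount Γ ω r := by exact_mod_cast bandCount_pos hr'.1 hr'.2
    have : 0 < 1 - ρ := by linarith
    positivity
  · have : (bandCount Γ ω r : ℝ) < Γ := by exact_mod_cast bandCount_lt hc h
    exact mul_pos h0 (div_pos hΓ (by linarith))

lemma sum_baseMatrix_off_band {Γ ω : ℕ} {ρ : ℝ} (h0 : 0 < ρ) {r : ℕ}
    (hr : r ∈ Finset.Icc 1 Γ) :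
    1 / (Γ : ℝ) * ∑ c ∈ (Finset.Icc 1 Γ).filter (fun c : ℕ => ¬ |(r : ℤ) - (c : ℤ)| ≤ (ω : ℤ)),
      baseMatrix Γ ω ρ r c ≤ ρ := by
  have hr' := Finset.mem_Icc.1 hr
  have hΓ : (0 : ℝ) < Γ := by exact_mod_cast (by omega : 0 < Γ)
  have hcard : (((Finset.Icc 1 Γ).filter
      (fun c : ℕ => ¬ |(r : ℤ) - (c : ℤ)| ≤ (ω : ℤ))).card : ℝ) = Γ - bandCount Γ ω r := by
    have := Finset.card_filter_add_card_filter_not (s := Finset.Icc 1 Γ)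
      (fun c : ℕ => |(r : ℤ) - (c : ℤ)| ≤ (ω : ℤ))
    rw [Nat.card_Icc, Nat.add_sub_cancel] at this
    rw [eq_sub_iff_add_eq, add_comm, bandCount]
    exact_mod_cast this
  rw [Finset.sum_congr rfl (g := fun _ => ρ * ((Γ : ℝ) / ((Γ : ℝ) - (bandCount Γ ω r : ℝ))))
    (fun c hc => by rw [baseMatrix, if_neg (Finset.mem_filter.1 hc).2]),
    Finset.sum_const, nsmul_eq_mul, hcard]
  -- If the band fills the whole row there is no column off the band and the sum is `0`. This is why
  -- `≤ ρ` is stated and not equality.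
  rcases eq_or_ne ((Γ : ℝ) - bandCount Γ ω r) 0 with h | h
  · rw [h]; simp [h0.le]
  · field_simp
    rfl

lemma sum_baseMatrix_band {Γ ω : ℕ} {ρ : ℝ} {r : ℕ}
    (hr : r ∈ Finset.Icc 1 Γ) (p : ℕ → Prop) [DecidablePred p] :
    1 / (Γ : ℝ) * ∑ c ∈ (band Γ ω r).filter p, baseMatrix Γ ω ρ r c =
      (1 - ρ) * ((band Γ ω r).filter p).card / bandCount Γ ω r := by
  have hr' := Finset.mem_Icc.1 hr
  have hΓ : (0 : ℝ) < Γ := by exact_mod_cast (by omega : 0 < Γ)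
  have : (0 : ℝ) < bandCount Γ ω r := by exact_mod_cast bandCount_pos hr'.1 hr'.2
  rw [Finset.sum_congr rfl (g := fun _ => (1 - ρ) * ((Γ : ℝ) / (bandCount Γ ω r : ℝ)))
    (fun c hc => by
      rw [baseMatrix, if_pos (Finset.mem_filter.1 (Finset.mem_filter.1 hc).1).2]),
    Finset.sum_const, nsmul_eq_mul]
  field_simp

lemma sum_baseMatrix_le_one {Γ ω : ℕ} {ρ : ℝ} (h0 : 0 < ρ) {r : ℕ}
    (hr : r ∈ Finset.Icc 1 Γ) :
    1 / (Γ : ℝ) * ∑ c ∈ Finset.Icc 1 Γ, baseMatrix Γ ω ρ r c ≤ 1 := by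
  have hr' := Finset.mem_Icc.1 hr
  have : (0 : ℝ) < bandCount Γ ω r := by exact_mod_cast bandCount_pos hr'.1 hr'.2
  have hb := sum_baseMatrix_band (ρ := ρ) hr (ω := ω) (fun _ => True)
  have ho := sum_baseMatrix_off_band h0 hr (ω := ω)
  rw [Finset.filter_true, ← bandCount_eq, mul_div_assoc, div_self this.ne', mul_one] at hb
  rw [← Finset.sum_filter_add_sum_filter_not _ (fun c : ℕ => |(r : ℤ) - (c : ℤ)| ≤ (ω : ℤ)),
    mul_add]
  unfold band at hb
  linarith

/-- Every row within `ω` of an unseeded column is of this kind, because the seed has width `4ω` at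
both ends. -/
lemma bandCount_of_interior {Γ ω r : ℕ} (h1 : ω + 1 ≤ r) (h2 : r + ω ≤ Γ) :
    bandCount Γ ω r = 2 * ω + 1 := by
  rw [bandCount_eq]
  have : band Γ ω r = Finset.Icc (r - ω) (r + ω) := by
    ext c; rw [mem_band, Finset.mem_Icc]; omega
  rw [this, Nat.card_Icc]; omega

/-! ### Reflection symmetry -/

lemma sum_Icc_reflect (Γ : ℕ) (F : ℕ → ℝ) :
    ∑ c ∈ Finset.Icc 1 Γ, F (Γ + 1 - c) = ∑ c ∈ Finset.Icc 1 Γ, F c :=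
  Finset.sum_nbij' (fun c => Γ + 1 - c) (fun c => Γ + 1 - c)
    (fun c hc => by simp only [Finset.mem_Icc] at *; omega)
    (fun c hc => by simp only [Finset.mem_Icc] at *; omega)
    (fun c hc => by simp only [Finset.mem_Icc] at hc; omega)
    (fun c hc => by simp only [Finset.mem_Icc] at hc; omega) (fun c hc => rfl)

lemma bandCount_reflect {Γ ω r : ℕ} (hr : r ≤ Γ) :
    bandCount Γ ω (Γ + 1 - r) = bandCount Γ ω r := by
  rw [bandCount_eq, bandCount_eq]
  refine Finset.card_nbij' (fun c => Γ + 1 - c) (fun c => Γ + 1 - c) ?_ ?_ ?_ ?_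
  all_goals
    intro c hc
    simp only [Finset.mem_coe, mem_band] at hc ⊢
    omega

lemma baseMatrix_reflect {Γ ω : ℕ} (ρ : ℝ) {r c : ℕ} (hr : r ≤ Γ) (hc : c ≤ Γ) :
    baseMatrix Γ ω ρ (Γ + 1 - r) (Γ + 1 - c) = baseMatrix Γ ω ρ r c := by
  unfold baseMatrix
  rw [bandCount_reflect hr]
  have : |((Γ + 1 - r : ℕ) : ℤ) - ((Γ + 1 - c : ℕ) : ℤ)| = |(r : ℤ) - (c : ℤ)| := by
    rw [← abs_neg]
    congr 1
    omega
  rw [this]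

lemma seSigma_reflect {Γ ω : ℕ} (ρ : ℝ) {ψ : ℕ → ℝ}
    (hψ : ∀ c ∈ Finset.Icc 1 Γ, ψ (Γ + 1 - c) = ψ c) {r : ℕ} (hr : r ≤ Γ) :
    seSigma Γ ω ρ ψ (Γ + 1 - r) = seSigma Γ ω ρ ψ r := by
  unfold seSigma
  rw [← sum_Icc_reflect Γ (fun c => baseMatrix Γ ω ρ (Γ + 1 - r) c * ψ c)]
  congr 1
  refine Finset.sum_congr rfl fun c hc => ?_
  rw [hψ c hc, baseMatrix_reflect ρ hr (Finset.mem_Icc.1 hc).2]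

lemma seTau_reflect (P : MemorylessChannel) (R : ℝ) (M : ℕ) {Γ ω : ℕ} (ρ : ℝ) {ψ : ℕ → ℝ}
    (hψ : ∀ c ∈ Finset.Icc 1 Γ, ψ (Γ + 1 - c) = ψ c) {c : ℕ} (hc : c ≤ Γ) :
    seTau P R M Γ ω ρ ψ (Γ + 1 - c) = seTau P R M Γ ω ρ ψ c := by
  unfold seTau sePhi
  rw [← sum_Icc_reflect Γ
    (fun r => baseMatrix Γ ω ρ r (Γ + 1 - c) / (P.fOut (seSigma Γ ω ρ ψ r))⁻¹)]
  congr 3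
  refine Finset.sum_congr rfl fun r hr => ?_
  have hr' := (Finset.mem_Icc.1 hr).2
  rw [baseMatrix_reflect ρ hr' hc, seSigma_reflect ρ hψ hr']

lemma isSeed_reflect {Γ ω c : ℕ} (hc : c ∈ Finset.Icc 1 Γ) :
    IsSeed Γ ω (Γ + 1 - c) ↔ IsSeed Γ ω c := by
  have := Finset.mem_Icc.1 hc
  unfold IsSeed
  omega

/-- The base matrix and the seed are both invariant under `c ↦ Γ + 1 - c`, and each update inherits
the symmetry. -/
lemma sePsi_reflect (P : MemorylessChannel) (R : ℝ) (M : ℕ) {Γ ω : ℕ} (ρ : ℝ) (t : ℕ) :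
    ∀ c ∈ Finset.Icc 1 Γ, sePsi P R M Γ ω ρ t (Γ + 1 - c) = sePsi P R M Γ ω ρ t c := by
  induction t with
  | zero => intro c hc; classical exact if_congr (isSeed_reflect hc) rfl rfl
  | succ t ih =>
    intro c hc
    simp only [sePsi]
    rw [seTau_reflect P R M ρ ih (Finset.mem_Icc.1 hc).2]
    classical exact if_congr (isSeed_reflect hc) rfl rfl

/-! ### Bounds along the state evolution -/

lemma sePsi_of_isSeed (P : MemorylessChannel) (R : ℝ) (M : ℕ) {Γ ω : ℕ} (ρ : ℝ) (t : ℕ) {c : ℕ}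
    (h : IsSeed Γ ω c) : sePsi P R M Γ ω ρ t c = 0 := by
  cases t <;> simp [sePsi, h]

lemma sePsi_nonneg (P : MemorylessChannel) (R : ℝ) {M : ℕ} (hM : 2 ≤ M) (Γ ω : ℕ) (ρ : ℝ)
    (t c : ℕ) : 0 ≤ sePsi P R M Γ ω ρ t c := by
  cases t with
  | zero => simp only [sePsi]; split_ifs <;> norm_num
  | succ t =>
    simp only [sePsi]; split_ifs
    · exact le_rfl
    · exact (one_sub_sectionEps_pos hM _).le

lemma sePsi_le_one (P : MemorylessChannel) (R : ℝ) (M Γ ω : ℕ) (ρ : ℝ) (t c : ℕ) :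
    sePsi P R M Γ ω ρ t c ≤ 1 := by
  cases t with
  | zero => simp only [sePsi]; split_ifs <;> norm_num
  | succ t =>
    simp only [sePsi]; split_ifs
    · norm_num
    · linarith [sectionEps_nonneg M (seTau P R M Γ ω ρ (sePsi P R M Γ ω ρ t) c)]

lemma sePsi_pos (P : MemorylessChannel) (R : ℝ) {M : ℕ} (hM : 2 ≤ M) {Γ ω : ℕ} (ρ : ℝ)
    (t : ℕ) {c : ℕ} (h : ¬ IsSeed Γ ω c) : 0 < sePsi P R M Γ ω ρ t c := by
  cases t with
  | zero => simp [sePsi, h]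
  | succ t => simpa [sePsi, h] using one_sub_sectionEps_pos hM _

/-- All entries of `W` are positive because `0 < ρ < 1`, so a single column with `ψ > 0` makes every
row average positive. The upper bound is that of the row sums. -/
lemma seSigma_mem {Γ ω : ℕ} {ρ : ℝ} (h0 : 0 < ρ) (h1 : ρ < 1) {ψ : ℕ → ℝ} (hψ0 : ∀ c, 0 ≤ ψ c)
    (hψ1 : ∀ c, ψ c ≤ 1) {c : ℕ} (hc : c ∈ Finset.Icc 1 Γ) (hψc : 0 < ψ c) {r : ℕ}
    (hr : r ∈ Finset.Icc 1 Γ) : seSigma Γ ω ρ ψ r ∈ Set.Ioc 0 1 := by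
  have hr' := Finset.mem_Icc.1 hr
  have hΓ : (0 : ℝ) < Γ := by exact_mod_cast (by omega : 0 < Γ)
  constructor
  · refine mul_pos (by positivity) (Finset.sum_pos' (fun i _ =>
      mul_nonneg (baseMatrix_nonneg Γ ω h0 h1 r i) (hψ0 i)) ⟨c, hc, ?_⟩)
    exact mul_pos (baseMatrix_pos h0 h1 hr hc) hψc
  · refine le_trans ?_ (sum_baseMatrix_le_one h0 hr (ω := ω))
    unfold seSigma
    gcongr with i hi
    exact mul_le_of_le_one_right (baseMatrix_nonneg Γ ω h0 h1 r i) (hψ1 i)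

/-- If `ψ` is at most `e` on the first `m` columns, the row average is controlled by the number
of remaining columns in the band. -/
lemma seSigma_le {Γ ω : ℕ} {ρ : ℝ} (h0 : 0 < ρ) (h1 : ρ < 1) {ψ : ℕ → ℝ}
    (hψ1 : ∀ c, ψ c ≤ 1) {e : ℝ} (he : 0 ≤ e) {m : ℕ}
    (hm : ∀ c ∈ Finset.Icc 1 Γ, c ≤ m → ψ c ≤ e) {r j : ℕ} (hr1 : ω + 1 ≤ r) (hr2 : r + ω ≤ Γ)
    (hj : r + ω ≤ m + j) :
    seSigma Γ ω ρ ψ r ≤ e + ρ + (1 - ρ) * (min (2 * ω + 1) j : ℕ) / (2 * ω + 1) := by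
  have hr : r ∈ Finset.Icc 1 Γ := Finset.mem_Icc.2 (by omega)
  have hΓ : (0 : ℝ) < Γ := by exact_mod_cast (by omega : 0 < Γ)
  have hbc := bandCount_of_interior hr1 hr2
  have hW := baseMatrix_nonneg Γ ω h0 h1 r
  -- Three sources: the error `e` on decoded columns, the total weight `ρ` off the band, and the
  -- band columns beyond `m`, where only `ψ ≤ 1` is known.
  have key : ∀ c ∈ Finset.Icc 1 Γ, baseMatrix Γ ω ρ r c * ψ c ≤ baseMatrix Γ ω ρ r c * e +
      ((if ¬ |(r : ℤ) - (c : ℤ)| ≤ (ω : ℤ) then baseMatrix Γ ω ρ r c else 0) +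
        (if |(r : ℤ) - (c : ℤ)| ≤ (ω : ℤ) then
          (if m < c then baseMatrix Γ ω ρ r c else 0) else 0)) := by
    intro c hc
    have hw := hW c
    have hwe := mul_nonneg hw he
    by_cases hb : |(r : ℤ) - (c : ℤ)| ≤ (ω : ℤ)
    · by_cases hcm : m < c
      · simp only [hb, hcm, not_true_eq_false, if_true, if_false]
        nlinarith [hψ1 c]
      · simp only [hb, hcm, not_true_eq_false, if_true, if_false]
        nlinarith [hm c hc (by omega)]
    · simp only [hb, not_false_eq_true, if_true, if_false]
      nlinarith [hψ1 c]
  have hsum := Finset.sum_le_sum key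
  rw [Finset.sum_add_distrib, Finset.sum_add_distrib, ← Finset.sum_filter, ← Finset.sum_filter,
    ← Finset.sum_filter, ← Finset.sum_mul] at hsum
  have a1 := sum_baseMatrix_le_one h0 hr (ω := ω)
  have a2 := sum_baseMatrix_off_band h0 hr (ω := ω)
  have a3 := sum_baseMatrix_band (ρ := ρ) hr (ω := ω) (fun c => m < c)
  have hcard : ((band Γ ω r).filter (fun c => m < c)).card ≤ min (2 * ω + 1) j := by
    refine le_min ?_ ?_
    · rw [← hbc, bandCount_eq]; exact Finset.card_filter_le _ _
    · have : (band Γ ω r).filter (fun c => m < c) ⊆ Finset.Ioc m (r + ω) := by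
        intro c hc
        rw [Finset.mem_filter, mem_band] at hc
        exact Finset.mem_Ioc.2 ⟨hc.2, hc.1.2.1⟩
      refine (Finset.card_le_card this).trans ?_
      rw [Nat.card_Ioc]; omega
  have a4 : (1 - ρ) * ((band Γ ω r).filter (fun c => m < c)).card / bandCount Γ ω r ≤
      (1 - ρ) * (min (2 * ω + 1) j : ℕ) / (2 * ω + 1) := by
    rw [hbc]
    push_cast [-Nat.cast_min]
    have : 0 ≤ 1 - ρ := by linarith
    gcongr
  unfold band at a3 a4
  unfold seSigma
  calc _ ≤ 1 / (Γ : ℝ) * _ := mul_le_mul_of_nonneg_left hsum (by positivity)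
    _ = (1 / (Γ : ℝ) * ∑ c ∈ Finset.Icc 1 Γ, baseMatrix Γ ω ρ r c) * e + _ + _ := by
      rw [mul_add, mul_add, ← add_assoc, mul_assoc]
    _ ≤ _ := by
      rw [a3]
      have := mul_le_of_le_one_left he a1
      linarith

/-- The column average of `f_out(σ_r)`. -/
noncomputable def colAverage (P : MemorylessChannel) (Γ ω : ℕ) (ρ : ℝ) (ψ : ℕ → ℝ) (c : ℕ) : ℝ :=
  1 / (Γ : ℝ) * ∑ r ∈ Finset.Icc 1 Γ, baseMatrix Γ ω ρ r c * P.fOut (seSigma Γ ω ρ ψ r)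

lemma seTau_eq (P : MemorylessChannel) (R : ℝ) (M Γ ω : ℕ) (ρ : ℝ) (ψ : ℕ → ℝ) (c : ℕ) :
    seTau P R M Γ ω ρ ψ c = R / Real.log M * (colAverage P Γ ω ρ ψ c)⁻¹ := by
  simp only [seTau, sePhi, colAverage, div_inv_eq_mul]

/-- Since `τ` is `R / log M` divided by the column average, the hypothesis is exactly `τ ≤ 1/((2+δ)
log M)`. -/
lemma sectionError_le_of_colAverage (P : MemorylessChannel) {R δ : ℝ} (hR : 0 < R) (hδ : 0 < δ)
    (hδ' : δ < 1 / 2) {M : ℕ} (hM : 2 ≤ M)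
    (hMe : 2 * (M : ℝ) ^ (-(δ ^ 2 / 100)) ≤ errLevel (1 / 200) M δ) (Γ ω : ℕ) (ρ : ℝ)
    (ψ : ℕ → ℝ) (c : ℕ) (h : (2 + δ) * R ≤ colAverage P Γ ω ρ ψ c) :
    1 - sectionEps M (seTau P R M Γ ω ρ ψ c) ≤ errLevel (1 / 200) M δ := by
  have hM1 : (1 : ℝ) < M := by exact_mod_cast hM
  have hl : 0 < Real.log M := Real.log_pos hM1
  have hA : 0 < colAverage P Γ ω ρ ψ c := lt_of_lt_of_le (by positivity) h
  refine (one_sub_sectionEps_le_rpow hM ?_ hδ hδ' ?_).trans hMe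
  · rw [seTau_eq]; positivity
  · rw [seTau_eq, div_mul_eq_mul_div, ← div_eq_mul_inv,
      div_div, div_le_div_iff₀ (by positivity) (by positivity)]
    nlinarith [mul_le_mul_of_nonneg_right h hl.le]

/-- Only the rows in the band are kept. -/
lemma le_colAverage (P : MemorylessChannel) (hf0 : ∀ x ∈ Set.Ioc (0 : ℝ) 1, 0 ≤ P.fOut x)
    (hanti : AntitoneOn P.fOut (Set.Ioc 0 1)) {Γ ω : ℕ} {ρ : ℝ} (h0 : 0 < ρ) (h1 : ρ < 1)
    {ψ : ℕ → ℝ} {c : ℕ} (hc1 : 2 * ω + 1 ≤ c) (hc2 : c + 2 * ω ≤ Γ)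
    (hσ : ∀ r ∈ Finset.Icc 1 Γ, seSigma Γ ω ρ ψ r ∈ Set.Ioc 0 1) (x : ℕ → ℝ)
    (hx1 : ∀ i, x i ≤ 1)
    (hx : ∀ i < 2 * ω + 1, seSigma Γ ω ρ ψ (c + i - ω) ≤ x i) :
    ∑ i ∈ Finset.range (2 * ω + 1), (1 - ρ) / (2 * ω + 1) * P.fOut (x i) ≤
      colAverage P Γ ω ρ ψ c := by
  have hΓ : (0 : ℝ) < Γ := by exact_mod_cast (by omega : 0 < Γ)
  have hρ : 0 < 1 - ρ := by linarith
  have e1 : ∑ i ∈ Finset.range (2 * ω + 1), (1 - ρ) / (2 * ω + 1) * P.fOut (x i) ≤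
      ∑ i ∈ Finset.range (2 * ω + 1), 1 / (Γ : ℝ) * (baseMatrix Γ ω ρ (c + i - ω) c *
        P.fOut (seSigma Γ ω ρ ψ (c + i - ω))) := by
    refine Finset.sum_le_sum fun i hi => ?_
    have hi' := Finset.mem_range.1 hi
    have hmem := hσ (c + i - ω) (Finset.mem_Icc.2 (by omega))
    have hb : |((c + i - ω : ℕ) : ℤ) - (c : ℤ)| ≤ (ω : ℤ) := by rw [abs_le]; omega
    rw [baseMatrix, if_pos hb, bandCount_of_interior (by omega) (by omega)]
    have hle : P.fOut (x i) ≤ P.fOut (seSigma Γ ω ρ ψ (c + i - ω)) :=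
      hanti hmem ⟨hmem.1.trans_le (hx i hi'), hx1 i⟩ (hx i hi')
    calc _ ≤ (1 - ρ) / (2 * ω + 1) * P.fOut (seSigma Γ ω ρ ψ (c + i - ω)) := by gcongr
      _ = _ := by push_cast; field_simp
  refine e1.trans ?_
  rw [← Finset.mul_sum, colAverage]
  gcongr
  rw [← Finset.sum_image (s := Finset.range (2 * ω + 1)) (g := fun i => c + i - ω)
    (f := fun r => baseMatrix Γ ω ρ r c * P.fOut (seSigma Γ ω ρ ψ r))
    (fun i hi j hj h => by
      simp only at h
      omega)]
  refine Finset.sum_le_sum_of_subset_of_nonneg ?_ ?_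
  · intro r hr
    obtain ⟨i, hi, rfl⟩ := Finset.mem_image.1 hr
    have hi' := Finset.mem_range.1 hi
    exact Finset.mem_Icc.2 (by omega)
  · intro r hr _
    exact mul_nonneg (baseMatrix_nonneg Γ ω h0 h1 r c) (hf0 _ (hσ r hr))

end SCSPARC


namespace SCSPARC

/-! ### The decoding wave -/

lemma IntervalIntegrable.sub_zero_one {f : ℝ → ℝ} (hInt : IntervalIntegrable f volume 0 1)
    {a b : ℝ} (ha : a ∈ Set.Icc (0 : ℝ) 1) (hb : b ∈ Set.Icc (0 : ℝ) 1) :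
    IntervalIntegrable f volume a b :=
  hInt.mono_set (by
    rw [Set.uIcc_of_le zero_le_one]
    exact Set.uIcc_subset_Icc ha hb)

/-- The upper Riemann sum estimate behind the motion of the wave. -/
lemma integral_add_le_sum {f : ℝ → ℝ} (hf0 : ∀ x ∈ Set.Ioc (0 : ℝ) 1, 0 ≤ f x)
    (hanti : AntitoneOn f (Set.Ioc 0 1)) (hInt : IntervalIntegrable f volume 0 1) {ρ s : ℝ}
    (hρ : 0 < ρ) (hs : 0 ≤ s) {g n : ℕ} (hg : g ≤ n) (hn : 1 ≤ 2 * ρ + n * s) :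
    (∫ x in (min 1 (2 * ρ + g * s))..1, f x) + g * (s * f 1) ≤
      ∑ i ∈ Finset.range n, s * f (min 1 (2 * ρ + (min n (g + i) : ℕ) * s)) := by
  set y : ℕ → ℝ := fun j => min 1 (2 * ρ + j * s) with hy
  have hy0 : ∀ j, 0 < y j := fun j => lt_min one_pos (by positivity)
  have hy1 : ∀ j, y j ≤ 1 := fun j => min_le_left _ _
  have hym : ∀ j, y j ≤ y (j + 1) := fun j => by
    simp only [hy]; gcongr; omega
  have hyd : ∀ j, y (j + 1) - y j ≤ s := fun j => by
    simp only [hy]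
    push_cast
    have : min 1 (2 * ρ + ((j : ℝ) + 1) * s) ≤ min 1 (2 * ρ + j * s) + s := by
      rw [← min_add_add_right]
      exact min_le_min (by linarith) (le_of_eq (by ring))
    linarith
  have hii : ∀ j k, IntervalIntegrable f volume (y j) (y k) := fun j k =>
    IntervalIntegrable.sub_zero_one hInt ⟨(hy0 j).le, hy1 j⟩ ⟨(hy0 k).le, hy1 k⟩
  have step : ∀ j, ∫ x in (y j)..(y (j + 1)), f x ≤ s * f (y j) := fun j => by
    have h1 : ∫ x in (y j)..(y (j + 1)), f x ≤ ∫ _ in (y j)..(y (j + 1)), f (y j) := by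
      refine intervalIntegral.integral_mono_on (hym j) (hii _ _)
        intervalIntegrable_const fun x hx => ?_
      exact hanti ⟨hy0 j, hy1 j⟩ ⟨(hy0 j).trans_le hx.1, hx.2.trans (hy1 _)⟩ hx.1
    rw [intervalIntegral.integral_const, smul_eq_mul] at h1
    exact h1.trans (mul_le_mul_of_nonneg_right (hyd j) (hf0 _ ⟨hy0 j, hy1 j⟩))
  have hyn : y n = 1 := min_eq_left hn
  obtain ⟨a, rfl⟩ := Nat.exists_eq_add_of_le' hg
  -- Here `a = n - g`. The first `a` terms are values of `f` at the left ends of the cells of the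
  -- grid `y` from `y g` to `y n = 1`; the last `g` have their index cut off at `n` and equal `s * f
  -- 1`.
  rw [Finset.sum_range_add]
  refine add_le_add ?_ ?_
  · have h2 := intervalIntegral.sum_integral_adjacent_intervals (μ := volume) (f := f)
      (a := fun j => y (g + j)) (n := a) (fun k _ => hii _ _)
    simp only [add_zero] at h2
    rw [show g + a = a + g from add_comm _ _, hyn] at h2
    rw [← h2]
    refine Finset.sum_le_sum fun i hi => ?_
    have : min (a + g) (g + i) = g + i := by
      have := Finset.mem_range.1 hi; omega
    rw [this]
    exact step (g + i)
  · rw [← nsmul_eq_mul]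
    refine le_of_eq ?_
    rw [← Finset.card_range g, ← Finset.sum_const]
    refine Finset.sum_congr (by simp) fun i _ => ?_
    have : min (a + (Finset.range g).card) ((Finset.range g).card + (a + i)) = a + g := by
      rw [Finset.card_range]; omega
    rw [this]
    exact congrArg (fun z => s * f z) hyn.symm

/-- The supremum of the empty set in `ℕ` is `0`, so `1 ≤ g` forces the defining set to be nonempty.
It is bounded, hence the supremum is attained. -/
lemma waveSpeed_mem {P : MemorylessChannel} {R ρ : ℝ} {ω : ℕ} (h : 1 ≤ waveSpeed P R ρ ω) :
    waveSpeed P R ρ ω ≤ 2 * ω + 1 ∧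
    (∫ x in (0 : ℝ)..(min 1 (2 * ρ + (waveSpeed P R ρ ω : ℝ) * (1 - ρ) / (2 * (ω : ℝ) + 1))),
      P.fOut x) - (waveSpeed P R ρ ω : ℝ) / (2 * (ω : ℝ) + 1) * (1 - ρ) * P.fOut 1
        < 3 / 2 * (P.capacity - R) := by
  have := Nat.sSup_mem (s := {k : ℕ | k ≤ 2 * ω + 1 ∧
    (∫ x in (0 : ℝ)..(min 1 (2 * ρ + (k : ℝ) * (1 - ρ) / (2 * (ω : ℝ) + 1))), P.fOut x)
      - (k : ℝ) / (2 * (ω : ℝ) + 1) * (1 - ρ) * P.fOut 1 < 3 / 2 * (P.capacity - R)})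
    (by
      by_contra he
      rw [Set.not_nonempty_iff_eq_empty] at he
      rw [waveSpeed, he] at h
      simp at h)
    ⟨2 * ω + 1, fun k hk => hk.1⟩
  exact this

/-- Induction on `t`, with the seed as initial front. Beyond the front only `ψ ≤ 1` is used, so the
wave coming from the other end plays no role. -/
lemma sePsi_le_of_waveSpeed (P : MemorylessChannel)
    (hf0 : ∀ x ∈ Set.Ioc (0 : ℝ) 1, 0 ≤ P.fOut x)
    (hanti : AntitoneOn P.fOut (Set.Ioc 0 1)) (hInt : IntervalIntegrable P.fOut volume 0 1)
    {R δ ρ : ℝ} (hC : 2 * P.capacity ≤ ∫ x in (0 : ℝ)..1, P.fOut x) (hR : 0 < R)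
    (hδ : 0 < δ) (hδ' : δ < 1 / 2) (hδR : δ < (P.capacity - R) / (2 * R)) (h0 : 0 < ρ) (h1 : ρ < 1)
    {M : ℕ} (hM : 2 ≤ M) (hMe : 2 * (M : ℝ) ^ (-(δ ^ 2 / 100)) ≤ errLevel (1 / 200) M δ)
    (hMρ : errLevel (1 / 200) M δ ≤ ρ) (Γ ω : ℕ) (hg : 1 ≤ waveSpeed P R ρ ω) (t : ℕ) :
    ∀ c ∈ Finset.Icc 1 Γ, c ≤ 4 * ω + t * waveSpeed P R ρ ω →
      sePsi P R M Γ ω ρ t c ≤ errLevel (1 / 200) M δ := by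
  have he := errLevel_nonneg (1 / 200) M hδ
  induction t with
  | zero =>
    intro c _ hc'
    rw [sePsi_of_isSeed P R M ρ 0 (Or.inl (by simpa using hc'))]
    exact he
  | succ t ih =>
    intro c hc hc'
    by_cases hseed : IsSeed Γ ω c
    · rw [sePsi_of_isSeed P R M ρ _ hseed]; exact he
    · simp only [sePsi, if_neg hseed]
      obtain ⟨hg1, hg2⟩ := waveSpeed_mem hg
      set g := waveSpeed P R ρ ω
      set ψ := sePsi P R M Γ ω ρ t
      have hs : 4 * ω < c ∧ c + 4 * ω ≤ Γ := by
        unfold IsSeed at hseed; omega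
      rw [Nat.add_mul, one_mul] at hc'
      refine sectionError_le_of_colAverage P hR hδ hδ' hM hMe Γ ω ρ ψ c ?_
      have hσ : ∀ r ∈ Finset.Icc 1 Γ, seSigma Γ ω ρ ψ r ∈ Set.Ioc 0 1 := fun r hr =>
        seSigma_mem h0 h1 (sePsi_nonneg P R hM Γ ω ρ t) (sePsi_le_one P R M Γ ω ρ t) hc
          (sePsi_pos P R hM ρ t hseed) hr
      have hn0 : (0 : ℝ) < 2 * ω + 1 := by positivity
      -- Row `c + i - ω` reaches to column `c + i`, and `c` is at most `g` beyond the front, so at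
      -- most `g + i` of its band columns are undecoded. The constant `2ρ` collects the off-band
      -- weight and the error level, which is at most `ρ`.
      have key := le_colAverage P hf0 hanti h0 h1 (ψ := ψ) (c := c) (by omega) (by omega) hσ
        (fun i => min 1 (2 * ρ + (min (2 * ω + 1) (g + i) : ℕ) * ((1 - ρ) / (2 * ω + 1))))
        (fun i => min_le_left _ _)
        (fun i hi => by
          refine le_min (hσ _ (Finset.mem_Icc.2 (by omega))).2 ?_
          refine (seSigma_le h0 h1 (sePsi_le_one P R M Γ ω ρ t) he ih (r := c + i - ω)
            (j := g + i) (by omega) (by omega) (by omega)).trans ?_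
          have e : (1 - ρ) * ((min (2 * ω + 1) (g + i) : ℕ) : ℝ) / (2 * ω + 1) =
            (min (2 * ω + 1) (g + i) : ℕ) * ((1 - ρ) / (2 * ω + 1)) := by ring
          rw [e]
          linarith)
      refine le_trans ?_ key
      have hInt2 := integral_add_le_sum hf0 hanti hInt (ρ := ρ) (s := (1 - ρ) / (2 * ω + 1))
        (g := g) (n := 2 * ω + 1) h0 (div_nonneg (by linarith) hn0.le) hg1
        (by push_cast; rw [mul_div_cancel₀ _ hn0.ne']; linarith)
      refine le_trans ?_ hInt2
      have e2 : 2 * ρ + (g : ℝ) * ((1 - ρ) / (2 * ω + 1)) =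
        2 * ρ + (g : ℝ) * (1 - ρ) / (2 * ω + 1) := by ring
      rw [e2]
      have hm0 : (0 : ℝ) ≤ min 1 (2 * ρ + (g : ℝ) * (1 - ρ) / (2 * ω + 1)) :=
        le_min zero_le_one (by
          have : 0 ≤ 1 - ρ := by linarith
          positivity)
      have hadd := intervalIntegral.integral_add_adjacent_intervals (μ := volume) (f := P.fOut)
        (a := 0) (b := min 1 (2 * ρ + (g : ℝ) * (1 - ρ) / (2 * ω + 1))) (c := 1)
        (IntervalIntegrable.sub_zero_one hInt (by simp) ⟨hm0, min_le_left _ _⟩)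
        (IntervalIntegrable.sub_zero_one hInt ⟨hm0, min_le_left _ _⟩ (by simp))
      have e3 : (g : ℝ) * ((1 - ρ) / (2 * ω + 1) * P.fOut 1) =
        (g : ℝ) / (2 * (ω : ℝ) + 1) * (1 - ρ) * P.fOut 1 := by ring
      rw [e3]
      -- Final balance: the sum exceeds `2C - 3Δ/2 = 2R + Δ/2`, and `δ < Δ/(2R)` makes this larger
      -- than `(2+δ)R`.
      rw [lt_div_iff₀ (by positivity)] at hδR
      linarith

/-- For such small `R` no wave is needed: `σ_r ≤ 1` gives `f_out(σ_r) ≥ f_out(1)`, and the band rows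
alone already contribute `(1-ρ) f_out(1)`. -/
lemma sePsi_one_le (P : MemorylessChannel) (hf0 : ∀ x ∈ Set.Ioc (0 : ℝ) 1, 0 ≤ P.fOut x)
    (hanti : AntitoneOn P.fOut (Set.Ioc 0 1)) {R δ ρ : ℝ} (hR : 0 < R)
    (hδ : 0 < δ) (hδ' : δ < 1 / 2) (h0 : 0 < ρ) (h1 : ρ < 1)
    (hRf : R < (1 - ρ) / (2 + δ) * P.fOut 1)
    {M : ℕ} (hM : 2 ≤ M) (hMe : 2 * (M : ℝ) ^ (-(δ ^ 2 / 100)) ≤ errLevel (1 / 200) M δ)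
    (Γ ω c : ℕ) (hc : c ∈ Finset.Icc 1 Γ) :
    sePsi P R M Γ ω ρ 1 c ≤ errLevel (1 / 200) M δ := by
  by_cases hseed : IsSeed Γ ω c
  · rw [sePsi_of_isSeed P R M ρ _ hseed]; exact errLevel_nonneg (1 / 200) M hδ
  · simp only [sePsi, if_neg hseed]
    have hs : 4 * ω < c ∧ c + 4 * ω ≤ Γ := by
      unfold IsSeed at hseed; omega
    refine sectionError_le_of_colAverage P hR hδ hδ' hM hMe Γ ω ρ (sePsi P R M Γ ω ρ 0) c ?_
    have hσ : ∀ r ∈ Finset.Icc 1 Γ, seSigma Γ ω ρ (sePsi P R M Γ ω ρ 0) r ∈ Set.Ioc 0 1 :=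
      fun r hr => seSigma_mem h0 h1 (sePsi_nonneg P R hM Γ ω ρ 0) (sePsi_le_one P R M Γ ω ρ 0) hc
        (sePsi_pos P R hM ρ 0 hseed) hr
    have key := le_colAverage P hf0 hanti h0 h1 (c := c) (by omega) (by omega) hσ
      (fun _ => 1) (fun _ => le_rfl) (fun i hi => (hσ _ (Finset.mem_Icc.2 (by omega))).2)
    rw [Finset.sum_const, Finset.card_range, nsmul_eq_mul] at key
    push_cast at key
    have e : (2 * (ω : ℝ) + 1) * ((1 - ρ) / (2 * ω + 1) * P.fOut 1) = (1 - ρ) * P.fOut 1 := by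
      field_simp
    rw [e] at key
    rw [div_mul_eq_mul_div, lt_div_iff₀ (by positivity)] at hRf
    linarith

-- For `k = 1` the left side of the defining inequality tends to `∫₀^{2ρ} f_out` as `ω → ∞`. This is
-- strictly below `3Δ/2 = ∫₀^h f_out` because `2ρ < h` and `f_out(h) > 0`.
open Filter Topology in
lemma eventually_one_le_waveSpeed (P : MemorylessChannel)
    (hf0 : ∀ x ∈ Set.Ioc (0 : ℝ) 1, 0 ≤ P.fOut x)
    (hanti : AntitoneOn P.fOut (Set.Ioc 0 1)) (hInt : IntervalIntegrable P.fOut volume 0 1)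
    {R ρ h : ℝ} (hC : 2 * P.capacity ≤ ∫ x in (0 : ℝ)..1, P.fOut x) (hR : 0 < R)
    (hRC : R < P.capacity) (hh : h ≤ 1)
    (hhint : (∫ x in (0 : ℝ)..h, P.fOut x) = 3 / 2 * (P.capacity - R)) (h0 : 0 < ρ)
    (hρ : ρ < h / 2) : ∀ᶠ ω : ℕ in atTop, 1 ≤ waveSpeed P R ρ ω := by
  have hρ' : 2 * ρ ∈ Set.Icc (0 : ℝ) 1 := ⟨by linarith, by linarith⟩
  have hh' : h ∈ Set.Icc (0 : ℝ) 1 := ⟨by linarith, hh⟩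
  have z : (0 : ℝ) ∈ Set.Icc (0 : ℝ) 1 := by simp
  have o : (1 : ℝ) ∈ Set.Icc (0 : ℝ) 1 := by simp
  have hlt : (∫ x in (0 : ℝ)..(2 * ρ), P.fOut x) < 3 / 2 * (P.capacity - R) := by
    have hadd := intervalIntegral.integral_add_adjacent_intervals (μ := volume) (f := P.fOut)
      (IntervalIntegrable.sub_zero_one hInt z hρ')
      (IntervalIntegrable.sub_zero_one hInt hρ' hh')
    have hadd2 := intervalIntegral.integral_add_adjacent_intervals (μ := volume) (f := P.fOut)
      (IntervalIntegrable.sub_zero_one hInt z hh')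
      (IntervalIntegrable.sub_zero_one hInt hh' o)
    have hfh : 0 ≤ P.fOut h := hf0 h ⟨by linarith, hh⟩
    have hge : (h - 2 * ρ) * P.fOut h ≤ ∫ x in (2 * ρ)..h, P.fOut x := by
      rw [← smul_eq_mul, ← intervalIntegral.integral_const]
      refine intervalIntegral.integral_mono_on (by linarith) intervalIntegrable_const
        (IntervalIntegrable.sub_zero_one hInt hρ' hh') fun x hx => ?_
      exact hanti ⟨by linarith [hx.1], hx.2.trans hh⟩ ⟨by linarith, hh⟩ hx.2
    have hle : ∫ x in h..1, P.fOut x ≤ (1 - h) * P.fOut h := by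
      rw [← smul_eq_mul, ← intervalIntegral.integral_const]
      refine intervalIntegral.integral_mono_on hh
        (IntervalIntegrable.sub_zero_one hInt hh' o) intervalIntegrable_const fun x hx => ?_
      exact hanti ⟨by linarith, hh⟩ ⟨by linarith [hx.1], hx.2⟩ hx.1
    -- If `f_out(h) = 0`, then `f_out` contributes nothing beyond `h`, so `2C ≤ ∫₀^h f_out = 3Δ/2`,
    -- impossible since `Δ < C`.
    rcases hfh.eq_or_lt with h' | h'
    · rw [← h'] at hle
      exfalso
      nlinarith
    · have : 0 < (h - 2 * ρ) * P.fOut h := mul_pos (by linarith) h'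
      linarith
  have hlim : Tendsto (fun ω : ℕ => 1 / (2 * (ω : ℝ) + 1)) atTop (𝓝 0) := by
    simp only [one_div]
    refine tendsto_inv_atTop_zero.comp (tendsto_atTop_add_const_right _ _ ?_)
    exact tendsto_natCast_atTop_atTop.const_mul_atTop (by norm_num)
  have hlim1 : Tendsto (fun ω : ℕ => min 1 (2 * ρ + (1 : ℕ) * (1 - ρ) / (2 * (ω : ℝ) + 1)))
      atTop (𝓝[Set.Icc 0 1] (2 * ρ)) := by
    rw [tendsto_nhdsWithin_iff]
    constructor
    · have : Tendsto (fun ω : ℕ => min 1 (2 * ρ + (1 - ρ) * (1 / (2 * (ω : ℝ) + 1)))) atTop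
          (𝓝 (min 1 (2 * ρ + (1 - ρ) * 0))) :=
        tendsto_const_nhds.min (tendsto_const_nhds.add (hlim.const_mul _))
      rw [mul_zero, add_zero, min_eq_right hρ'.2] at this
      refine this.congr fun ω => ?_
      congr 2
      push_cast; ring
    · refine Eventually.of_forall fun ω => ⟨le_min zero_le_one ?_, min_le_left _ _⟩
      have : 0 ≤ 1 - ρ := by linarith
      positivity
  have hcont : ContinuousOn (fun b => ∫ x in (0 : ℝ)..b, P.fOut x) (Set.Icc 0 1) := by
    have := intervalIntegral.continuousOn_primitive_interval' (μ := volume) (f := P.fOut)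
      (a := 0) (b₁ := 0) (b₂ := 1) hInt (by simp)
    rwa [Set.uIcc_of_le zero_le_one] at this
  have hlim2 := ((hcont (2 * ρ) hρ').tendsto.comp hlim1).sub
    (((hlim.mul_const (1 - ρ)).mul_const (P.fOut 1)))
  rw [zero_mul, zero_mul, sub_zero] at hlim2
  filter_upwards [hlim2.eventually_lt_const hlt] with ω hω
  refine le_csSup ⟨2 * ω + 1, fun k hk => hk.1⟩ ⟨by omega, ?_⟩
  simpa using hω

/-- The decoding lemma, from the analytic properties of `f_out`. -/
theorem stateEvolution_of_fOut (P : MemorylessChannel)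
    (hf0 : ∀ x ∈ Set.Ioc (0 : ℝ) 1, 0 ≤ P.fOut x)
    (hanti : AntitoneOn P.fOut (Set.Ioc 0 1)) (hInt : IntervalIntegrable P.fOut volume 0 1)
    (hC : 2 * P.capacity ≤ ∫ x in (0 : ℝ)..1, P.fOut x) {R δ ρ h : ℝ}
    (hR : 0 < R) (hRC : R < P.capacity) (hδ : 0 < δ)
    (hδm : δ < min ((P.capacity - R) / (2 * R)) (1 / 2)) (hh : h ≤ 1)
    (hhint : (∫ x in (0 : ℝ)..h, P.fOut x) = 3 / 2 * (P.capacity - R)) (h0 : 0 < ρ)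
    (hρ : ρ < h / 2) :
    (R < (1 - ρ) / (2 + δ) * P.fOut 1 →
      ∃ M₀ : ℕ, ∀ M : ℕ, M₀ ≤ M → ∀ Γ ω c : ℕ, 1 ≤ c → c ≤ Γ →
        sePsi P R M Γ ω ρ 1 c ≤ errLevel (1 / 200) M δ) ∧
    ((1 - ρ) / (2 + δ) * P.fOut 1 ≤ R →
      (∃ ω₀ : ℕ, ∀ ω : ℕ, ω₀ ≤ ω → 1 ≤ waveSpeed P R ρ ω) ∧
      ∃ M₀ : ℕ, ∀ M : ℕ, M₀ ≤ M → ∀ Γ ω : ℕ, 1 ≤ waveSpeed P R ρ ω →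
        ∀ t c : ℕ, 1 ≤ t → 1 ≤ c →
          c ≤ min (4 * ω + t * waveSpeed P R ρ ω) ⌈(Γ : ℝ) / 2⌉₊ →
          sePsi P R M Γ ω ρ t c = sePsi P R M Γ ω ρ t (Γ - c + 1) ∧
          sePsi P R M Γ ω ρ t c ≤ errLevel (1 / 200) M δ) := by
  have h1 : ρ < 1 := by linarith
  obtain ⟨hδR, hδ'⟩ := lt_min_iff.1 hδm
  -- The threshold on `M` comes only from `δ` and `ρ`: the factor 2 must be absorbed, the error
  -- level must drop below `ρ`, and `M ≥ 2`.
  obtain ⟨M₀, hM₀⟩ := Filter.eventually_atTop.1 (((eventually_two_mul_rpow_le_errLevel hδ).and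
    ((tendsto_errLevel hδ).eventually_le_const h0)).and (Filter.eventually_ge_atTop 2))
  refine ⟨fun hRf => ⟨M₀, fun M hM Γ ω c hc hc' => ?_⟩, fun _ => ⟨?_, M₀, ?_⟩⟩
  · obtain ⟨⟨a, _⟩, b⟩ := hM₀ M hM
    exact sePsi_one_le P hf0 hanti hR hδ hδ' h0 h1 hRf b a Γ ω c (Finset.mem_Icc.2 ⟨hc, hc'⟩)
  · exact Filter.eventually_atTop.1
      (eventually_one_le_waveSpeed P hf0 hanti hInt hC hR hRC hh hhint h0 hρ)
  · intro M hM Γ ω hg t c _ hc hc'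
    obtain ⟨⟨a, a'⟩, b⟩ := hM₀ M hM
    have hcΓ : c ≤ Γ := by
      refine (hc'.trans (min_le_right _ _)).trans (Nat.ceil_le.2 ?_)
      have : (0 : ℝ) ≤ Γ := by positivity
      linarith
    have hmem : c ∈ Finset.Icc 1 Γ := Finset.mem_Icc.2 ⟨hc, hcΓ⟩
    refine ⟨?_, sePsi_le_of_waveSpeed P hf0 hanti hInt hC hR hδ hδ' hδR h0 h1 b a a' Γ ω hg t c
      hmem (hc'.trans (min_le_left _ _))⟩
    rw [← sePsi_reflect P R M ρ t c hmem]
    congr 1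
    omega

end SCSPARC


/-! ### Monotone transport on the line -/

section Transport

open Filter Topology Set

variable {f g : ℝ → ℝ}

lemma hasDerivAt_setIntegral_Iic (hc : Continuous f) (hi : Integrable f) (x : ℝ) :
    HasDerivAt (fun x => ∫ t in Iic x, f t) (f x) x := by
  have h : (fun x => ∫ t in Iic x, f t) = fun x => (∫ t in Iic 0, f t) + ∫ t in (0 : ℝ)..x, f t := by
    ext y
    rw [← intervalIntegral.integral_Iic_sub_Iic hi.integrableOn hi.integrableOn]
    ring
  rw [h]
  exact (intervalIntegral.integral_hasDerivAt_right (hc.intervalIntegrable _ _)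
    (hc.stronglyMeasurableAtFilter _ _) hc.continuousAt).const_add _

lemma strictMono_setIntegral_Iic (hc : Continuous f) (hi : Integrable f) (hpos : ∀ x, 0 < f x) :
    StrictMono fun x => ∫ t in Iic x, f t :=
  strictMono_of_deriv_pos fun x => by
    rw [(hasDerivAt_setIntegral_Iic hc hi x).deriv]; exact hpos x

lemma tendsto_setIntegral_Iic_atTop (hi : Integrable f) :
    Tendsto (fun x => ∫ t in Iic x, f t) atTop (𝓝 (∫ t, f t)) :=
  (aecover_Iic tendsto_id).integral_tendsto_of_countably_generated hi

lemma tendsto_setIntegral_Iic_atBot (hi : Integrable f) :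
    Tendsto (fun x => ∫ t in Iic x, f t) atBot (𝓝 0) := by
  have h1 : Tendsto (fun x => ∫ t in Ioi x, f t) atBot (𝓝 (∫ t, f t)) :=
    (aecover_Ioi tendsto_id).integral_tendsto_of_countably_generated hi
  have h2 := h1.const_sub (∫ t, f t)
  rw [sub_self] at h2
  refine h2.congr fun x => ?_
  rw [← intervalIntegral.integral_Iic_add_Ioi (b := x) hi.integrableOn hi.integrableOn]
  ring

lemma range_setIntegral_Iic (hc : Continuous f) (hi : Integrable f) (hpos : ∀ x, 0 < f x) :
    range (fun x => ∫ t in Iic x, f t) = Ioo 0 (∫ t, f t) := by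
  have hm := strictMono_setIntegral_Iic hc hi hpos
  have hcont : Continuous fun x => ∫ t in Iic x, f t :=
    continuous_iff_continuousAt.2 fun x => (hasDerivAt_setIntegral_Iic hc hi x).continuousAt
  apply Subset.antisymm
  · rintro _ ⟨x, rfl⟩
    constructor
    · exact lt_of_le_of_lt (hm.monotone.le_of_tendsto (tendsto_setIntegral_Iic_atBot hi) (x - 1))
        (hm (by linarith))
    · exact lt_of_lt_of_le (hm (by linarith))
        (hm.monotone.ge_of_tendsto (tendsto_setIntegral_Iic_atTop hi) (x + 1))
  · rintro y ⟨h0, h1⟩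
    obtain ⟨a, ha⟩ := ((tendsto_setIntegral_Iic_atBot hi).eventually_lt_const h0).exists
    obtain ⟨b, hb⟩ := ((tendsto_setIntegral_Iic_atTop hi).eventually_const_lt h1).exists
    exact mem_range_of_exists_le_of_exists_ge hcont ⟨a, ha.le⟩ ⟨b, hb.le⟩

/-- The monotone rearrangement between two positive densities of equal mass. -/
lemma exists_transport (hfc : Continuous f) (hfi : Integrable f) (hf : ∀ x, 0 < f x)
    (hgc : Continuous g) (hgi : Integrable g) (hg : ∀ x, 0 < g x)
    (h : ∫ x, f x = ∫ x, g x) :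
    ∃ T : ℝ → ℝ, (∀ x, HasDerivAt T (f x / g (T x)) x) ∧ Function.Bijective T := by
  set A : ℝ → ℝ := fun x => ∫ t in Iic x, f t with hA
  set B : ℝ → ℝ := fun x => ∫ t in Iic x, g t with hB
  have hAm := strictMono_setIntegral_Iic hfc hfi hf
  have hBm := strictMono_setIntegral_Iic hgc hgi hg
  have hAr := range_setIntegral_Iic hfc hfi hf
  have hBr := range_setIntegral_Iic hgc hgi hg
  rw [h, ← hBr] at hAr
  -- The transport is `B⁻¹ ∘ A` for the two distribution functions. `B` maps onto an open interval,
  -- so the local inverse derivative formula applies at every point of its range.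
  set S := Function.invFun B with hS
  have hBS : ∀ y ∈ range B, B (S y) = y := fun y hy => Function.invFun_eq hy
  have hSB : ∀ x, S (B x) = x := Function.leftInverse_invFun hBm.injective
  have hSm : StrictMonoOn S (range B) := fun a ha b hb hab => by
    rw [← hBm.lt_iff_lt]
    change B (S a) < B (S b)
    rwa [hBS a ha, hBS b hb]
  have hSimg : S '' range B = univ := eq_univ_of_forall fun x => ⟨B x, mem_range_self x, hSB x⟩
  have hnhds : ∀ y ∈ range B, range B ∈ 𝓝 y := fun y hy => by
    rw [hBr] at hy ⊢
    exact Ioo_mem_nhds hy.1 hy.2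
  have hSd : ∀ y ∈ range B, HasDerivAt S (g (S y))⁻¹ y := fun y hy => by
    refine HasDerivAt.of_local_left_inverse ?_ (hasDerivAt_setIntegral_Iic hgc hgi (S y))
      (hg _).ne' ?_
    · exact hSm.continuousAt_of_image_mem_nhds (hnhds y hy) (by rw [hSimg]; exact univ_mem)
    · filter_upwards [hnhds y hy] with z hz using hBS z hz
  have hAB : ∀ x, A x ∈ range B := fun x => by
    rw [← hAr]; exact mem_range_self x
  refine ⟨fun x => S (A x), fun x => ?_, ?_, ?_⟩
  · have := (hSd (A x) (hAB x)).comp x (hasDerivAt_setIntegral_Iic hfc hfi x)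
    rwa [inv_mul_eq_div] at this
  · intro a b hab
    have := congrArg B hab
    simp only [hBS _ (hAB _)] at this
    exact hAm.injective this
  · intro y
    have : B y ∈ range A := by rw [hAr]; exact mem_range_self y
    obtain ⟨x, hx⟩ := this
    exact ⟨x, by simp only [hx, hSB]⟩

/-- An integrable function cannot stay above `1/(n+1)` in absolute value on all of `[n, ∞)`. This
removes boundary terms in an integration by parts without any decay assumption. -/
lemma exists_seq_tendsto_zero_of_integrable (hi : Integrable f) :
    ∃ u : ℕ → ℝ, Tendsto u atTop atTop ∧ Tendsto (fun n => f (u n)) atTop (𝓝 0) := by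
  have key : ∀ n : ℕ, ∃ x : ℝ, (n : ℝ) ≤ x ∧ |f x| < 1 / ((n : ℝ) + 1) := by
    intro n
    by_contra! hcon
    have h1 : IntegrableOn (fun _ : ℝ => (1 : ℝ) / ((n : ℝ) + 1)) (Ici (n : ℝ)) := by
      refine Integrable.mono (hi.integrableOn (s := Ici (n : ℝ))) (by fun_prop) ?_
      rw [ae_restrict_iff' measurableSet_Ici]
      refine Eventually.of_forall fun x hx => ?_
      rw [Real.norm_of_nonneg (by positivity), Real.norm_eq_abs]
      exact hcon x hx
    rw [integrableOn_const_iff] at h1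
    rcases h1 with h1 | h1
    · have : (0 : ℝ) < 1 / ((n : ℝ) + 1) := by positivity
      exact this.ne' (by simpa using h1)
    · simp at h1
  choose u hu hu' using key
  refine ⟨u, tendsto_atTop_mono hu tendsto_natCast_atTop_atTop, ?_⟩
  exact squeeze_zero_norm (fun n => (hu' n).le) tendsto_one_div_add_atTop_nhds_zero_nat

lemma exists_seq_atBot_tendsto_zero_of_integrable (hi : Integrable f) :
    ∃ u : ℕ → ℝ, Tendsto u atTop atBot ∧ Tendsto (fun n => f (u n)) atTop (𝓝 0) := by
  obtain ⟨u, hu, hu'⟩ := exists_seq_tendsto_zero_of_integrable hi.comp_neg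
  exact ⟨fun n => -u n, tendsto_neg_atTop_atBot.comp hu, hu'⟩

end Transport


/-! ### The Gaussian logarithmic Sobolev inequality -/

section LogSobolev

open Filter Topology Set InformationTheory
open scoped NNReal

lemma lintegral_gaussianReal {p : ℝ} {v : ℝ≥0} (hv : v ≠ 0) (f : ℝ → ENNReal) :
    ∫⁻ x, f x ∂(gaussianReal p v) = ∫⁻ x, ENNReal.ofReal (gaussianPDFReal p v x) * f x := by
  rw [gaussianReal_of_var_ne_zero p hv]
  rw [lintegral_withDensity_eq_lintegral_mul_non_measurable _ (measurable_gaussianPDF p v)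
    (Eventually.of_forall fun x => gaussianPDF_lt_top)]
  rfl

lemma integrable_gaussianReal_iff {p : ℝ} {v : ℝ≥0} (hv : v ≠ 0) {f : ℝ → ℝ} :
    Integrable f (gaussianReal p v) ↔ Integrable fun x => gaussianPDFReal p v x * f x := by
  rw [gaussianReal_of_var_ne_zero p hv,
    integrable_withDensity_iff_integrable_smul' (measurable_gaussianPDF p v)
    (Eventually.of_forall fun x => gaussianPDF_lt_top)]
  simp only [toReal_gaussianPDF, smul_eq_mul]

lemma integral_gaussianReal_eq {p : ℝ} {v : ℝ≥0} (hv : v ≠ 0) (f : ℝ → ℝ) :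
    ∫ x, f x ∂(gaussianReal p v) = ∫ x, gaussianPDFReal p v x * f x := by
  rw [integral_gaussianReal_eq_integral_smul hv]
  simp only [smul_eq_mul]

lemma hasDerivAt_gaussianPDFReal (p : ℝ) (v : ℝ≥0) (x : ℝ) :
    HasDerivAt (gaussianPDFReal p v) (-((x - p) / v) * gaussianPDFReal p v x) x := by
  rw [gaussianPDFReal_def]
  have h1 : HasDerivAt (fun x : ℝ => -(x - p) ^ 2 / (2 * (v : ℝ))) (-((x - p) / v)) x := by
    have h := ((((hasDerivAt_id x).sub_const p).pow 2).neg).div_const (2 * (v : ℝ))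
    refine h.congr_deriv ?_
    simp only [id]
    rcases eq_or_ne (v : ℝ) 0 with h0 | h0
    · simp [h0]
    · field_simp; ring
  refine (h1.exp.const_mul (√(2 * Real.pi * v))⁻¹).congr_deriv ?_
  ring

lemma continuous_gaussianPDFReal (p : ℝ) (v : ℝ≥0) : Continuous (gaussianPDFReal p v) :=
  continuous_iff_continuousAt.2 fun x => (hasDerivAt_gaussianPDFReal p v x).continuousAt

lemma log_gaussianPDFReal_sub {p : ℝ} {v : ℝ≥0} (hv : v ≠ 0) (x y : ℝ) :
    Real.log (gaussianPDFReal p v x) - Real.log (gaussianPDFReal p v y) =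
      ((y - p) ^ 2 - (x - p) ^ 2) / (2 * v) := by
  have hv' : (0 : ℝ) < v := by positivity
  have hc : (√(2 * Real.pi * v))⁻¹ ≠ 0 := by positivity
  simp only [gaussianPDFReal_def]
  rw [Real.log_mul hc (Real.exp_pos _).ne', Real.log_mul hc (Real.exp_pos _).ne', Real.log_exp,
    Real.log_exp]
  ring

/-- The logarithmic Sobolev inequality for a one-dimensional Gaussian measure. -/
theorem lintegral_klFun_le_fisher {p : ℝ} {v : ℝ≥0} (hv : v ≠ 0) {F F' : ℝ → ℝ}
    (hF : ∀ x, HasDerivAt F (F' x) x) (hF'c : Continuous F') (hpos : ∀ x, 0 < F x)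
    (hInt : Integrable F (gaussianReal p v))
    (hmom : Integrable (fun x => x * F x) (gaussianReal p v)) :
    ∫⁻ x, ENNReal.ofReal (klFun (F x)) ∂(gaussianReal p v) ≤
      ENNReal.ofReal (klFun (∫ x, F x ∂(gaussianReal p v))) +
        ENNReal.ofReal (v / 2) * ∫⁻ x, ENNReal.ofReal (F' x ^ 2 / F x) ∂(gaussianReal p v) := by
  have hv' : (0 : ℝ) < v := by positivity
  set φ := gaussianPDFReal p v with hφ
  have hφpos : ∀ x, 0 < φ x := fun x => gaussianPDFReal_pos p v x hv
  have hφc : Continuous φ := continuous_gaussianPDFReal p v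
  have hφi : Integrable φ := integrable_gaussianPDFReal p v
  have hφ1 : ∫ x, φ x = 1 := integral_gaussianPDFReal_eq_one p hv
  have hFc : Continuous F := continuous_iff_continuousAt.2 fun x => (hF x).continuousAt
  rw [integrable_gaussianReal_iff hv] at hInt hmom
  rw [integral_gaussianReal_eq hv]
  set a := ∫ x, φ x * F x with ha
  have hfpos : ∀ x, 0 < φ x * F x := fun x => mul_pos (hφpos x) (hpos x)
  have hfc : Continuous fun x => φ x * F x := hφc.mul hFc
  have hapos : 0 < a := by
    rw [ha, integral_pos_iff_support_of_nonneg (fun x => (hfpos x).le) hInt]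
    have : (Function.support fun x => φ x * F x) = univ := by
      ext x; simpa using ⟨(hφpos x).ne', (hpos x).ne'⟩
    rw [this]; simp
  obtain ⟨T, hT, hTb⟩ := exists_transport (f := fun x => φ x * F x / a) (g := φ)
    (hfc.div_const a) (hInt.div_const a) (fun x => div_pos (hfpos x) hapos) hφc hφi hφpos
    (by rw [integral_div, ← ha, div_self hapos.ne', hφ1])
  have hTc : Continuous T := continuous_iff_continuousAt.2 fun x => (hT x).continuousAt
  set T' : ℝ → ℝ := fun x => φ x * F x / a / φ (T x) with hT'
  have hT'pos : ∀ x, 0 < T' x := fun x => div_pos (div_pos (hfpos x) hapos) (hφpos _)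
  have hT'c : Continuous T' := (hfc.div_const a).div (hφc.comp hTc) fun x => (hφpos _).ne'
  -- integrability of the displacement
  have hTint : Integrable fun x => φ x * F x * T x := by
    have h1 : IntegrableOn (fun t => t * φ t) (T '' univ) := by
      rw [image_univ, hTb.surjective.range_eq, integrableOn_univ]
      have := (integrable_gaussianReal_iff (p := p) hv (f := fun x => x)).1
        ((memLp_id_gaussianReal 1).integrable (by norm_num))
      simpa only [mul_comm] using this
    rw [integrableOn_image_iff_integrableOn_abs_deriv_smul MeasurableSet.univ
      (fun x _ => (hT x).hasDerivWithinAt) hTb.injective.injOn, integrableOn_univ] at h1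
    refine (h1.const_mul a).congr (Eventually.of_forall fun x => ?_)
    simp only [smul_eq_mul]
    rw [abs_of_pos (hT'pos x)]
    have := (hφpos (T x)).ne'
    simp only [hT']
    field_simp
  set q : ℝ → ℝ := fun x => φ x * F x * (T x - x) with hq
  have hqi : Integrable q := by
    refine (hTint.sub hmom).congr (Eventually.of_forall fun x => ?_)
    simp only [hq, Pi.sub_apply]; ring
  -- the primitive
  set Q : ℝ → ℝ := fun x => q x + (∫ t in Iic x, φ t) +
    (Real.log a - 1) * ∫ t in Iic x, φ t * F t with hQ
  set Q' : ℝ → ℝ := fun x => (-((x - p) / v) * φ x * F x + φ x * F' x) * (T x - x) +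
    φ x * F x * (T' x - 1) + φ x + (Real.log a - 1) * (φ x * F x) with hQ'
  have hQd : ∀ x, HasDerivAt Q (Q' x) x := fun x =>
    (((((hasDerivAt_gaussianPDFReal p v x).mul (hF x)).mul
      ((hT x).sub (hasDerivAt_id x))).add (hasDerivAt_setIntegral_Iic hφc hφi x)).add
      ((hasDerivAt_setIntegral_Iic hfc hInt x).const_mul _))
  have hQ'c : Continuous Q' := by fun_prop
  set j : ℝ → ℝ := fun x => φ x * (v / 2 * (F' x ^ 2 / F x)) with hj
  have hjc : Continuous j :=
    hφc.mul (continuous_const.mul ((hF'c.pow 2).div hFc fun x => (hpos x).ne'))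
  have hj0 : ∀ x, 0 ≤ j x := fun x => by
    have := hpos x; have := hφpos x; positivity
  set k : ℝ → ℝ := fun x => φ x * klFun (F x) with hk
  have hkc : Continuous k := hφc.mul (continuous_klFun.comp hFc)
  have hk0 : ∀ x, 0 ≤ k x := fun x => mul_nonneg (hφpos x).le (klFun_nonneg (hpos x).le)
  -- Taking logarithms in the transport equation `φ F / a = T' · φ(T)` expresses `log F` through
  -- `log T'` and a difference of squares. The bound `log T' ≤ T' - 1` and completion of the square
  -- in `F (T - x) + v F'` then leave an exact derivative plus the Fisher term.
  have hpt : ∀ x, k x ≤ Q' x + j x := by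
    intro x
    have hlog : Real.log (F x) = Real.log a + Real.log (T' x) +
        ((x - p) ^ 2 - (T x - p) ^ 2) / (2 * v) := by
      have h1 := log_gaussianPDFReal_sub (p := p) hv (T x) x
      simp only [hT']
      rw [Real.log_div (div_pos (hfpos x) hapos).ne' (hφpos _).ne',
        Real.log_div (hfpos x).ne' hapos.ne', Real.log_mul (hφpos x).ne' (hpos x).ne', ← h1]
      ring
    have hT1 := Real.log_le_sub_one_of_pos (hT'pos x)
    have hFx := hpos x
    have h2 : F x * Real.log (F x) ≤ F x * (Real.log a + (T' x - 1) +
        ((x - p) ^ 2 - (T x - p) ^ 2) / (2 * v)) := by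
      rw [hlog]; gcongr
    have h3 : 0 ≤ (F x * (T x - x) + v * F' x) ^ 2 / (2 * v * F x) := by positivity
    have h4 : Q' x + j x - k x = φ x * ((F x * (Real.log a + (T' x - 1) +
        ((x - p) ^ 2 - (T x - p) ^ 2) / (2 * v)) - F x * Real.log (F x)) +
        (F x * (T x - x) + v * F' x) ^ 2 / (2 * v * F x)) := by
      simp only [hQ', hj, hk, klFun]
      field_simp
      ring
    have h5 : 0 ≤ Q' x + j x - k x := by
      rw [h4]
      exact mul_nonneg (hφpos x).le (add_nonneg (by linarith) h3)
    linarith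
  -- The work is done on bounded intervals with extended nonnegative values, so neither side has to
  -- be known finite.
  have hcov : ∀ c d, c ≤ d → ∫⁻ x in Ioc c d, ENNReal.ofReal (k x) ≤
      ENNReal.ofReal (Q d - Q c) + ∫⁻ x, ENNReal.ofReal (j x) := by
    intro c d hcd
    have e1 : ∫⁻ x in Ioc c d, ENNReal.ofReal (k x) = ENNReal.ofReal (∫ x in c..d, k x) := by
      rw [intervalIntegral.integral_of_le hcd,
        ofReal_integral_eq_lintegral_ofReal (hkc.integrableOn_Ioc) (Eventually.of_forall hk0)]
    have e2 : ∫⁻ x in Ioc c d, ENNReal.ofReal (j x) = ENNReal.ofReal (∫ x in c..d, j x) := by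
      rw [intervalIntegral.integral_of_le hcd,
        ofReal_integral_eq_lintegral_ofReal (hjc.integrableOn_Ioc) (Eventually.of_forall hj0)]
    have e3 : ∫ x in c..d, Q' x = Q d - Q c :=
      intervalIntegral.integral_eq_sub_of_hasDerivAt (fun x _ => hQd x)
        (hQ'c.intervalIntegrable _ _)
    have e4 : ∫ x in c..d, k x ≤ (Q d - Q c) + ∫ x in c..d, j x := by
      rw [← e3, ← intervalIntegral.integral_add (hQ'c.intervalIntegrable _ _)
        (hjc.intervalIntegrable _ _)]
      exact intervalIntegral.integral_mono_on hcd (hkc.intervalIntegrable _ _)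
        ((hQ'c.add hjc).intervalIntegrable _ _) fun x _ => hpt x
    rw [e1]
    refine (ENNReal.ofReal_le_ofReal e4).trans (ENNReal.ofReal_add_le.trans ?_)
    rw [← e2]
    gcongr
    exact Measure.restrict_le_self
  -- The part `q` of the primitive is integrable but has no known limit. Along these sequences it
  -- vanishes, and the rest of `Q` increases by `1 + (log a - 1) a = klFun a` in total.
  obtain ⟨b, hb, hb'⟩ := exists_seq_tendsto_zero_of_integrable hqi
  obtain ⟨c, hc, hc'⟩ := exists_seq_atBot_tendsto_zero_of_integrable hqi
  have hQb : Tendsto (fun n => Q (b n)) atTop (𝓝 (0 + 1 + (Real.log a - 1) * a)) := by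
    refine (hb'.add ?_).add (Tendsto.const_mul _ ?_)
    · rw [← hφ1]; exact (tendsto_setIntegral_Iic_atTop hφi).comp hb
    · exact (tendsto_setIntegral_Iic_atTop hInt).comp hb
  have hQc : Tendsto (fun n => Q (c n)) atTop (𝓝 (0 + 0 + (Real.log a - 1) * 0)) := by
    refine (hc'.add ?_).add (Tendsto.const_mul _ ?_)
    · exact (tendsto_setIntegral_Iic_atBot hφi).comp hc
    · exact (tendsto_setIntegral_Iic_atBot hInt).comp hc
  have hQlim : Tendsto (fun n => Q (b n) - Q (c n)) atTop (𝓝 (klFun a)) := by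
    have := hQb.sub hQc
    convert this using 2
    rw [klFun]; ring
  have hlim := (aecover_Ioc (μ := volume) hc hb).lintegral_tendsto_of_countably_generated
    (f := fun x => ENNReal.ofReal (k x)) hkc.measurable.ennreal_ofReal.aemeasurable
  have hle : ∫⁻ x, ENNReal.ofReal (k x) ≤
      ENNReal.ofReal (klFun a) + ∫⁻ x, ENNReal.ofReal (j x) := by
    refine le_of_tendsto_of_tendsto hlim
      ((ENNReal.tendsto_ofReal hQlim).add_const _) ?_
    filter_upwards [hc.eventually_le_atBot 0, hb.eventually_ge_atTop 0] with n h1 h2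
    exact hcov _ _ (h1.trans h2)
  rw [lintegral_gaussianReal hv, lintegral_gaussianReal hv,
    ← lintegral_const_mul' _ _ ENNReal.ofReal_ne_top]
  refine le_of_eq_of_le (lintegral_congr fun x => ?_) (hle.trans_eq ?_)
  · rw [← ENNReal.ofReal_mul (hφpos x).le]
  · congr 1
    refine lintegral_congr fun x => ?_
    rw [mul_left_comm, ← ENNReal.ofReal_mul (by positivity), ← ENNReal.ofReal_mul (hφpos x).le]

end LogSobolev


/-! ### Gaussian smoothing of a likelihood -/

section Smoothing

open Filter Topology Set InformationTheory
open scoped NNReal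

/-- A nonnegative function all of whose exponential moments under `N(0,1)` are finite. -/
structure HasExpMoments (D : ℝ → ℝ) : Prop where
  measurable : Measurable D
  nonneg : ∀ z, 0 ≤ D z
  integrable : ∀ t : ℝ, Integrable (fun z => Real.exp (t * z) * D z) (gaussianReal 0 1)

/-- The moments `∫ zⁿ D(z) N(p, v)(dz)`. -/
noncomputable def gMom (D : ℝ → ℝ) (v : ℝ≥0) (n : ℕ) (p : ℝ) : ℝ :=
  ∫ z, z ^ n * D z ∂(gaussianReal p v)

lemma gMom_zero_eq (D : ℝ → ℝ) (v : ℝ≥0) :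
    gMom D v 0 = fun p => ∫ z, D z ∂(gaussianReal p v) := by
  ext p; simp [gMom]

/-- The derivative of `p ↦ ∫ D(z) N(p, v)(dz)`. -/
noncomputable def gScore (D : ℝ → ℝ) (v : ℝ≥0) (p : ℝ) : ℝ :=
  (gMom D v 1 p - p * gMom D v 0 p) / v

/-- The Fisher information of the smoothed likelihood, averaged over `p ∼ N(0, 1 - v)`. -/
noncomputable def fisher (D : ℝ → ℝ) (v : ℝ≥0) : ENNReal :=
  ∫⁻ p, ENNReal.ofReal (gScore D v p ^ 2 / gMom D v 0 p) ∂(gaussianReal 0 (1 - v))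

/-- The entropy of the smoothed likelihood under `N(0, 1 - v)`. -/
noncomputable def smoothEnt (D : ℝ → ℝ) (v : ℝ≥0) : ENNReal :=
  ∫⁻ p, ENNReal.ofReal (klFun (gMom D v 0 p)) ∂(gaussianReal 0 (1 - v))

variable {D : ℝ → ℝ} {v v₁ v₂ : ℝ≥0}

lemma gaussianPDFReal_eq_exp_mul (p : ℝ) (hv : v ≠ 0) (z : ℝ) :
    gaussianPDFReal p v z =
      (√(2 * Real.pi * v))⁻¹ * Real.exp (-p ^ 2 / (2 * v)) *
        (Real.exp (p / v * z) * Real.exp (-z ^ 2 / (2 * v))) := by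
  have : (v : ℝ) ≠ 0 := by exact_mod_cast hv
  rw [gaussianPDFReal_def]
  simp only
  have e : Real.exp (-(z - p) ^ 2 / (2 * v)) = Real.exp (-p ^ 2 / (2 * v)) *
      (Real.exp (p / v * z) * Real.exp (-z ^ 2 / (2 * v))) := by
    rw [← Real.exp_add, ← Real.exp_add]
    congr 1
    field_simp
    ring
  rw [e]
  ring

/-- The measure `D(z) exp(-z²/(2v)) dz`, whose exponential tilts are the posteriors. -/
noncomputable def tiltBase (D : ℝ → ℝ) (v : ℝ≥0) : Measure ℝ :=
  volume.withDensity fun z => ENNReal.ofReal (D z * Real.exp (-z ^ 2 / (2 * v)))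

namespace HasExpMoments

lemma measurable_weight (hD : HasExpMoments D) :
    Measurable fun z => D z * Real.exp (-z ^ 2 / (2 * v)) :=
  hD.measurable.mul (by fun_prop)

lemma integral_tiltBase (hD : HasExpMoments D) (f : ℝ → ℝ) :
    ∫ z, f z ∂(tiltBase D v) = ∫ z, f z * (D z * Real.exp (-z ^ 2 / (2 * v))) := by
  rw [tiltBase, integral_withDensity_eq_integral_toReal_smul
    (hD.measurable_weight (v := v)).ennreal_ofReal (Eventually.of_forall fun _ => by simp)]
  refine integral_congr_ae (Eventually.of_forall fun z => ?_)
  simp only [smul_eq_mul]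
  rw [ENNReal.toReal_ofReal (mul_nonneg (hD.nonneg z) (Real.exp_pos _).le), mul_comm]

lemma integrable_tiltBase_iff (hD : HasExpMoments D) {f : ℝ → ℝ} :
    Integrable f (tiltBase D v) ↔
      Integrable fun z => f z * (D z * Real.exp (-z ^ 2 / (2 * v))) := by
  rw [tiltBase, integrable_withDensity_iff (hD.measurable_weight (v := v)).ennreal_ofReal
    (Eventually.of_forall fun _ => by simp)]
  refine integrable_congr (Eventually.of_forall fun z => ?_)
  simp only
  rw [ENNReal.toReal_ofReal (mul_nonneg (hD.nonneg z) (Real.exp_pos _).le)]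

/-- As `v ≤ 1`, the weight `exp(-z²/(2v))` is dominated by `exp(-z²/2)`, so exponential moments
under `N(0,1)` suffice for all smaller variances. -/
lemma integrableExpSet_tiltBase (hD : HasExpMoments D) (hv : v ≠ 0) (hv1 : v ≤ 1) :
    integrableExpSet id (tiltBase D v) = univ := by
  refine eq_univ_of_forall fun t => ?_
  change Integrable _ _
  rw [hD.integrable_tiltBase_iff]
  have h := ((integrable_gaussianReal_iff one_ne_zero).1 (hD.integrable t)).const_mul
    (√(2 * Real.pi * (1 : ℝ≥0)))
  have hm := hD.measurable_weight (v := v)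
  refine h.mono' (by fun_prop) (Eventually.of_forall fun z => ?_)
  have h0 := hD.nonneg z
  have hv0 : (0 : ℝ) < v := by positivity
  have hv1' : (v : ℝ) ≤ 1 := by exact_mod_cast hv1
  rw [Real.norm_of_nonneg (by positivity), gaussianPDFReal_def]
  simp only [id, sub_zero]
  have e : √(2 * Real.pi * (1 : ℝ≥0)) * ((√(2 * Real.pi * (1 : ℝ≥0)))⁻¹ *
      Real.exp (-z ^ 2 / (2 * (1 : ℝ≥0))) * (Real.exp (t * z) * D z)) =
      Real.exp (t * z) * (D z * Real.exp (-z ^ 2 / (2 * (1 : ℝ≥0)))) := by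
    have : √(2 * Real.pi * (1 : ℝ≥0)) ≠ 0 := by simp [Real.pi_pos.le, Real.pi_ne_zero]
    field_simp
  rw [e]
  gcongr Real.exp (t * z) * (D z * Real.exp ?_)
  rw [neg_div, neg_div, neg_le_neg_iff]
  exact div_le_div_of_nonneg_left (sq_nonneg z) (by positivity) (by simp; linarith)

lemma integrable_pow_mul_exp (hD : HasExpMoments D) (hv : v ≠ 0) (hv1 : v ≤ 1) (n : ℕ) (t : ℝ) :
    Integrable (fun z => z ^ n * Real.exp (t * z)) (tiltBase D v) :=
  integrable_pow_mul_exp_of_mem_interior_integrableExpSet (X := id)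
    (by rw [hD.integrableExpSet_tiltBase hv hv1]; simp) n

lemma integrable_pow_mul (hD : HasExpMoments D) (hv : v ≠ 0) (hv1 : v ≤ 1) (n : ℕ) (p : ℝ) :
    Integrable (fun z => z ^ n * D z) (gaussianReal p v) := by
  rw [integrable_gaussianReal_iff hv]
  have h := (hD.integrable_tiltBase_iff.1 (hD.integrable_pow_mul_exp hv hv1 n (p / v))).const_mul
    ((√(2 * Real.pi * v))⁻¹ * Real.exp (-p ^ 2 / (2 * v)))
  refine h.congr (Eventually.of_forall fun z => ?_)
  simp only
  rw [gaussianPDFReal_eq_exp_mul p hv]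
  ring

lemma gMom_eq (hD : HasExpMoments D) (hv : v ≠ 0) (n : ℕ) (p : ℝ) :
    gMom D v n p = (√(2 * Real.pi * v))⁻¹ * Real.exp (-p ^ 2 / (2 * v)) *
      ∫ z, z ^ n * Real.exp (p / v * z) ∂(tiltBase D v) := by
  rw [gMom, integral_gaussianReal_eq hv, hD.integral_tiltBase, ← integral_const_mul]
  refine integral_congr_ae (Eventually.of_forall fun z => ?_)
  simp only
  rw [gaussianPDFReal_eq_exp_mul p hv]
  ring

/-- Up to an explicit Gaussian factor in `p`, the moments are derivatives of the moment generating
function of the fixed measure `tiltBase D v`, taken at `p / v`. That function is smooth because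
every exponential moment is finite. -/
lemma hasDerivAt_gMom (hD : HasExpMoments D) (hv : v ≠ 0) (hv1 : v ≤ 1) (n : ℕ) (p : ℝ) :
    HasDerivAt (gMom D v n) ((gMom D v (n + 1) p - p * gMom D v n p) / v) p := by
  have hv0 : (v : ℝ) ≠ 0 := by exact_mod_cast hv
  have h0 : gMom D v n = fun p => (√(2 * Real.pi * v))⁻¹ * Real.exp (-p ^ 2 / (2 * v)) *
      ∫ z, z ^ n * Real.exp (p / v * z) ∂(tiltBase D v) := funext (hD.gMom_eq hv n)
  have h1 := hasDerivAt_integral_pow_mul_exp_real (X := id) (μ := tiltBase D v) (t := p / v)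
    (by rw [hD.integrableExpSet_tiltBase hv hv1]; simp) n
  have h2 := h1.comp p ((hasDerivAt_id p).div_const (v : ℝ))
  have h3 : HasDerivAt (fun x : ℝ => -x ^ 2 / (2 * (v : ℝ))) (-(p / v)) p := by
    have h := (((hasDerivAt_id p).pow 2).neg).div_const (2 * (v : ℝ))
    refine h.congr_deriv ?_
    simp only [id]
    field_simp; ring
  have h4 := (h3.exp.const_mul (√(2 * Real.pi * v))⁻¹).mul h2
  rw [hD.gMom_eq hv (n + 1) p, hD.gMom_eq hv n p, h0]
  refine h4.congr_deriv ?_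
  simp only [Function.comp, id]
  field_simp
  ring

lemma hasDerivAt_gMom_zero (hD : HasExpMoments D) (hv : v ≠ 0) (hv1 : v ≤ 1) (p : ℝ) :
    HasDerivAt (gMom D v 0) (gScore D v p) p := hD.hasDerivAt_gMom hv hv1 0 p

lemma continuous_gMom (hD : HasExpMoments D) (hv : v ≠ 0) (hv1 : v ≤ 1) (n : ℕ) :
    Continuous (gMom D v n) :=
  continuous_iff_continuousAt.2 fun p => (hD.hasDerivAt_gMom hv hv1 n p).continuousAt

lemma continuous_gScore (hD : HasExpMoments D) (hv : v ≠ 0) (hv1 : v ≤ 1) :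
    Continuous (gScore D v) :=
  ((hD.continuous_gMom hv hv1 1).sub (continuous_id.mul (hD.continuous_gMom hv hv1 0))).div_const _

lemma gMom_zero_nonneg (hD : HasExpMoments D) (p : ℝ) : 0 ≤ gMom D v 0 p :=
  integral_nonneg fun z => by simpa using hD.nonneg z

/-- A Gaussian and Lebesgue measure have the same null sets. Hence a smoothed likelihood is either
positive everywhere or comes from an almost everywhere vanishing one. -/
lemma ae_eq_zero_of_gMom_zero (hD : HasExpMoments D) (hv : v ≠ 0) (hv1 : v ≤ 1) {p : ℝ}
    (h : gMom D v 0 p = 0) : D =ᵐ[volume] 0 := by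
  have h1 := (integral_eq_zero_iff_of_nonneg (fun z => by simpa using hD.nonneg z)
    (hD.integrable_pow_mul hv hv1 0 p)).1 h
  filter_upwards [(gaussianReal_absolutelyContinuous' p hv).ae_le h1] with z hz
  simpa using hz

lemma gMom_eq_zero (h : D =ᵐ[volume] 0) (hv : v ≠ 0) (n : ℕ) (p : ℝ) : gMom D v n p = 0 := by
  refine integral_eq_zero_of_ae ?_
  filter_upwards [(gaussianReal_absolutelyContinuous p hv).ae_le h] with z hz
  simp [hz]

lemma gScore_eq_zero (hD : HasExpMoments D) (hv : v ≠ 0) (hv1 : v ≤ 1) {p : ℝ}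
    (h : gMom D v 0 p = 0) : gScore D v p = 0 := by
  have := hD.ae_eq_zero_of_gMom_zero hv hv1 h
  simp [gScore, gMom_eq_zero this hv]

lemma gMom_zero_pos (hD : HasExpMoments D) (h : ¬ D =ᵐ[volume] 0) (hv : v ≠ 0) (hv1 : v ≤ 1)
    (p : ℝ) : 0 < gMom D v 0 p :=
  lt_of_le_of_ne (hD.gMom_zero_nonneg p)
    fun h' => h (hD.ae_eq_zero_of_gMom_zero hv hv1 h'.symm)

end HasExpMoments

/-! ### The Gaussian bridge -/

/-- Disintegration of a two-step Gaussian walk with respect to its endpoint. -/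
lemma gaussianPDFReal_mul_bridge (h₁ : v₁ ≠ 0) (h₂ : v₂ ≠ 0) (p q z : ℝ) :
    gaussianPDFReal p v₁ q * gaussianPDFReal q v₂ z =
      gaussianPDFReal p (v₁ + v₂) z *
        gaussianPDFReal (p + v₁ / (v₁ + v₂) * (z - p)) (v₁ * v₂ / (v₁ + v₂)) q := by
  have a₁ : (0 : ℝ) < v₁ := by positivity
  have a₂ : (0 : ℝ) < v₂ := by positivity
  simp only [gaussianPDFReal_def]
  push_cast
  have hc : (√(2 * Real.pi * v₁))⁻¹ * (√(2 * Real.pi * v₂))⁻¹ =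
      (√(2 * Real.pi * (v₁ + v₂)))⁻¹ * (√(2 * Real.pi * (v₁ * v₂ / (v₁ + v₂))))⁻¹ := by
    rw [← mul_inv, ← mul_inv, ← Real.sqrt_mul (by positivity), ← Real.sqrt_mul (by positivity)]
    congr 2
    field_simp
  have he : Real.exp (-(q - p) ^ 2 / (2 * v₁)) * Real.exp (-(z - q) ^ 2 / (2 * v₂)) =
      Real.exp (-(z - p) ^ 2 / (2 * (v₁ + v₂))) * Real.exp
        (-(q - (p + v₁ / (v₁ + v₂) * (z - p))) ^ 2 / (2 * (v₁ * v₂ / (v₁ + v₂)))) := by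
    rw [← Real.exp_add, ← Real.exp_add]
    congr 1
    field_simp
    ring
  calc _ = ((√(2 * Real.pi * v₁))⁻¹ * (√(2 * Real.pi * v₂))⁻¹) *
        (Real.exp (-(q - p) ^ 2 / (2 * v₁)) * Real.exp (-(z - q) ^ 2 / (2 * v₂))) := by ring
    _ = _ := by rw [hc, he]; ring

lemma integral_sq_gaussianReal (p : ℝ) (v : ℝ≥0) :
    ∫ x, x ^ 2 ∂(gaussianReal p v) = v + p ^ 2 := by
  have h := variance_eq_sub (μ := gaussianReal p v) (X := id) (memLp_id_gaussianReal 2)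
  rw [variance_id_gaussianReal] at h
  simp only [id, Pi.pow_apply, integral_id_gaussianReal] at h
  linarith

lemma integrable_pow_gaussianReal (p : ℝ) (v : ℝ≥0) (n : ℕ) :
    Integrable (fun x => x ^ n) (gaussianReal p v) := by
  have := (memLp_id_gaussianReal (μ := p) (v := v) n).integrable_norm_pow'
  refine this.mono (by fun_prop) (Eventually.of_forall fun x => ?_)
  simp

namespace HasExpMoments

lemma measurable_bridge (hD : HasExpMoments D) (p : ℝ) :
    Measurable fun x : ℝ × ℝ =>
      gaussianPDFReal p v₁ x.1 * gaussianPDFReal x.1 v₂ x.2 * D x.2 := by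
  have h2 : Measurable fun x : ℝ × ℝ => gaussianPDFReal x.1 v₂ x.2 := by
    have := measurable_uncurry_gaussianPDFReal.comp
      (measurable_fst.prodMk ((measurable_const (a := v₂)).prodMk measurable_snd) :
        Measurable fun x : ℝ × ℝ => (x.1, v₂, x.2))
    exact this
  exact (((measurable_gaussianPDFReal p v₁).comp measurable_fst).mul h2).mul
    (hD.measurable.comp measurable_snd)

lemma integrable_bridge (hD : HasExpMoments D) (h₁ : v₁ ≠ 0) (h₂ : v₂ ≠ 0) (h : v₁ + v₂ ≤ 1)
    (p : ℝ) : Integrable fun x : ℝ × ℝ =>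
      gaussianPDFReal p v₁ x.1 * gaussianPDFReal x.1 v₂ x.2 * D x.2 * (1 + x.1 ^ 2 + x.2 ^ 2) := by
  have hv : v₁ + v₂ ≠ 0 := by positivity
  have hw : v₁ * v₂ / (v₁ + v₂) ≠ 0 := by positivity
  have hm := hD.measurable_bridge (v₁ := v₁) (v₂ := v₂) p
  -- Conditioning on the endpoint `z` first, the inner integral is an explicit quadratic polynomial
  -- in `z`, so only the first three moments of `D` enter.
  have e : ∀ q z : ℝ, gaussianPDFReal p v₁ q * gaussianPDFReal q v₂ z * D z * (1 + q ^ 2 + z ^ 2)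
      = gaussianPDFReal p (v₁ + v₂) z * D z *
        (gaussianPDFReal (p + v₁ / (v₁ + v₂) * (z - p)) (v₁ * v₂ / (v₁ + v₂)) q *
          (1 + q ^ 2 + z ^ 2)) := fun q z => by
    rw [gaussianPDFReal_mul_bridge h₁ h₂]; ring
  have hq : ∀ b z : ℝ, Integrable (fun q : ℝ => 1 + q ^ 2 + z ^ 2)
      (gaussianReal b (v₁ * v₂ / (v₁ + v₂))) := fun b z =>
    ((integrable_const _).add (integrable_pow_gaussianReal _ _ 2)).add (integrable_const _)
  rw [Measure.volume_eq_prod, integrable_prod_iff' (by fun_prop)]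
  constructor
  · refine Eventually.of_forall fun z => ?_
    simp only [e]
    exact ((integrable_gaussianReal_iff hw).1 (hq _ z)).const_mul _
  · have e2 : ∀ z, ∫ q, ‖gaussianPDFReal p v₁ q * gaussianPDFReal q v₂ z * D z *
        (1 + q ^ 2 + z ^ 2)‖ = gaussianPDFReal p (v₁ + v₂) z * (D z * (1 +
          ((v₁ * v₂ / (v₁ + v₂) : ℝ≥0) + (p + v₁ / (v₁ + v₂) * (z - p)) ^ 2) + z ^ 2)) := by
      intro z
      have : ∀ q, ‖gaussianPDFReal p v₁ q * gaussianPDFReal q v₂ z * D z *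
        (1 + q ^ 2 + z ^ 2)‖ = gaussianPDFReal p v₁ q * gaussianPDFReal q v₂ z * D z *
        (1 + q ^ 2 + z ^ 2) := fun q => by
        have := hD.nonneg z
        have := gaussianPDFReal_nonneg p v₁ q
        have := gaussianPDFReal_nonneg q v₂ z
        rw [Real.norm_of_nonneg (by positivity)]
      simp only [this]
      simp only [e]
      have hb : Integrable (fun q : ℝ => 1 + q ^ 2)
          (gaussianReal (p + v₁ / (v₁ + v₂) * (z - p)) (v₁ * v₂ / (v₁ + v₂))) :=
        (integrable_const _).add (integrable_pow_gaussianReal _ _ 2)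
      rw [integral_const_mul, ← integral_gaussianReal_eq hw,
        integral_add hb (integrable_const _), integral_add (integrable_const _)
          (integrable_pow_gaussianReal _ _ 2), integral_sq_gaussianReal]
      simp
      ring
    simp only [e2]
    rw [← integrable_gaussianReal_iff hv]
    have i0 := hD.integrable_pow_mul hv h 0 p
    have i1 := hD.integrable_pow_mul hv h 1 p
    have i2 := hD.integrable_pow_mul hv h 2 p
    set lam : ℝ := v₁ / (v₁ + v₂) with hlam
    set w : ℝ≥0 := v₁ * v₂ / (v₁ + v₂) with hw'
    refine (((i0.const_mul (1 + (w : ℝ) + (p - lam * p) ^ 2)).add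
      (i1.const_mul (2 * (p - lam * p) * lam))).add (i2.const_mul (lam ^ 2 + 1))).congr
      (Eventually.of_forall fun z => ?_)
    simp only [Pi.add_apply]
    ring

lemma integrable_bridge_mul (hD : HasExpMoments D) (h₁ : v₁ ≠ 0) (h₂ : v₂ ≠ 0)
    (h : v₁ + v₂ ≤ 1) (p : ℝ) {k : ℝ × ℝ → ℝ} (hk : Measurable k)
    (hk' : ∀ x, |k x| ≤ 1 + x.1 ^ 2 + x.2 ^ 2) : Integrable fun x : ℝ × ℝ =>
      gaussianPDFReal p v₁ x.1 * gaussianPDFReal x.1 v₂ x.2 * D x.2 * k x := by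
  refine (hD.integrable_bridge h₁ h₂ h p).mono
    ((hD.measurable_bridge p).mul hk).aestronglyMeasurable (Eventually.of_forall fun x => ?_)
  have h3 : 0 ≤ 1 + x.1 ^ 2 + x.2 ^ 2 := by positivity
  rw [norm_mul, norm_mul _ (1 + _ + _), Real.norm_of_nonneg h3]
  gcongr
  exact hk' x

/-- Fubini along the bridge: first averaging over the endpoint. -/
lemma integral_bridge (hD : HasExpMoments D) (h₁ : v₁ ≠ 0) (h₂ : v₂ ≠ 0)
    (h : v₁ + v₂ ≤ 1) (p : ℝ) {k : ℝ × ℝ → ℝ} (hk : Measurable k)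
    (hk' : ∀ x, |k x| ≤ 1 + x.1 ^ 2 + x.2 ^ 2) :
    Integrable (fun q => ∫ z, k (q, z) * D z ∂(gaussianReal q v₂)) (gaussianReal p v₁) ∧
    ∫ q, (∫ z, k (q, z) * D z ∂(gaussianReal q v₂)) ∂(gaussianReal p v₁) =
      ∫ z, (∫ q, k (q, z)
        ∂(gaussianReal (p + v₁ / (v₁ + v₂) * (z - p)) (v₁ * v₂ / (v₁ + v₂)))) * D z
        ∂(gaussianReal p (v₁ + v₂)) := by
  have hv : v₁ + v₂ ≠ 0 := by positivity
  have hw : v₁ * v₂ / (v₁ + v₂) ≠ 0 := by positivity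
  have hi := hD.integrable_bridge_mul h₁ h₂ h p hk hk'
  rw [Measure.volume_eq_prod] at hi
  have e1 : ∀ q, gaussianPDFReal p v₁ q * ∫ z, k (q, z) * D z ∂(gaussianReal q v₂) =
      ∫ z, gaussianPDFReal p v₁ q * gaussianPDFReal q v₂ z * D z * k (q, z) := fun q => by
    rw [integral_gaussianReal_eq h₂, ← integral_const_mul]
    refine integral_congr_ae (Eventually.of_forall fun z => ?_)
    simp only; ring
  have e2 : ∀ z, gaussianPDFReal p (v₁ + v₂) z * ((∫ q, k (q, z)
        ∂(gaussianReal (p + v₁ / (v₁ + v₂) * (z - p)) (v₁ * v₂ / (v₁ + v₂)))) * D z) =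
      ∫ q, gaussianPDFReal p v₁ q * gaussianPDFReal q v₂ z * D z * k (q, z) := fun z => by
    rw [integral_gaussianReal_eq hw, mul_comm _ (D z), ← mul_assoc, ← integral_const_mul]
    refine integral_congr_ae (Eventually.of_forall fun q => ?_)
    simp only
    rw [gaussianPDFReal_mul_bridge h₁ h₂]; ring
  constructor
  · rw [integrable_gaussianReal_iff h₁]
    simp only [e1]
    exact hi.integral_prod_left
  · rw [integral_gaussianReal_eq h₁, integral_gaussianReal_eq hv]
    simp only [e1, e2]
    exact integral_integral_swap hi

lemma gMom_zero_semigroup (hD : HasExpMoments D) (h₁ : v₁ ≠ 0) (h₂ : v₂ ≠ 0) (h : v₁ + v₂ ≤ 1)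
    (p : ℝ) : Integrable (gMom D v₂ 0) (gaussianReal p v₁) ∧
      ∫ q, gMom D v₂ 0 q ∂(gaussianReal p v₁) = gMom D (v₁ + v₂) 0 p := by
  have := hD.integral_bridge h₁ h₂ h p (k := fun _ => 1) measurable_const
    (fun x => by rw [abs_one]; nlinarith [sq_nonneg x.1, sq_nonneg x.2])
  simpa [gMom_zero_eq] using this

lemma integrable_id_mul_gMom_zero (hD : HasExpMoments D) (h₁ : v₁ ≠ 0) (h₂ : v₂ ≠ 0)
    (h : v₁ + v₂ ≤ 1) (p : ℝ) :
    Integrable (fun q => q * gMom D v₂ 0 q) (gaussianReal p v₁) := by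
  have := (hD.integral_bridge h₁ h₂ h p (k := fun x => x.1) measurable_fst
    (fun x => by
      rw [abs_le]
      constructor <;> nlinarith [sq_nonneg (x.1 + 1), sq_nonneg (x.1 - 1), sq_nonneg x.2])).1
  simpa [gMom, integral_const_mul] using this

lemma gScore_eq_integral (hD : HasExpMoments D) (hv : v ≠ 0) (hv1 : v ≤ 1) (p : ℝ) :
    gScore D v p = (∫ z, (z - p) * D z ∂(gaussianReal p v)) / v := by
  have i0 := hD.integrable_pow_mul hv hv1 0 p
  have i1 := hD.integrable_pow_mul hv hv1 1 p
  rw [gScore, gMom, gMom, ← integral_const_mul, ← integral_sub i1 (i0.const_mul p)]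
  congr 1
  refine integral_congr_ae (Eventually.of_forall fun z => ?_)
  simp only; ring

/-- The score is an average of `z - q` against `D`. The bridge from `p` to `z` gives `z - q` the
mean `v₂/(v₁+v₂) · (z - p)`, and the prefactor turns `1/v₂` into `1/(v₁+v₂)`. No derivative has to
be exchanged with an integral. -/
lemma gScore_semigroup (hD : HasExpMoments D) (h₁ : v₁ ≠ 0) (h₂ : v₂ ≠ 0) (h : v₁ + v₂ ≤ 1)
    (p : ℝ) : Integrable (gScore D v₂) (gaussianReal p v₁) ∧
      ∫ q, gScore D v₂ q ∂(gaussianReal p v₁) = gScore D (v₁ + v₂) p := by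
  have hv : v₁ + v₂ ≠ 0 := by positivity
  have h₂' : v₂ ≤ 1 := le_trans (le_add_of_nonneg_left (zero_le)) h
  have a₁ : (0 : ℝ) < v₁ := by positivity
  have a₂ : (0 : ℝ) < v₂ := by positivity
  obtain ⟨ha, hb⟩ := hD.integral_bridge h₁ h₂ h p (k := fun x => x.2 - x.1)
    (measurable_snd.sub measurable_fst)
    (fun x => by
      rw [abs_le]
      constructor <;> nlinarith [sq_nonneg (x.1 + 1), sq_nonneg (x.1 - 1), sq_nonneg (x.2 + 1),
        sq_nonneg (x.2 - 1)])
  have e : gScore D v₂ = fun q => (∫ z, (z - q) * D z ∂(gaussianReal q v₂)) / v₂ :=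
    funext fun q => hD.gScore_eq_integral h₂ h₂' q
  rw [e]
  refine ⟨ha.div_const _, ?_⟩
  rw [integral_div, hb, hD.gScore_eq_integral hv h]
  have e2 : ∀ z, ∫ q, (z - q)
      ∂(gaussianReal (p + v₁ / (v₁ + v₂) * (z - p)) (v₁ * v₂ / (v₁ + v₂))) =
      v₂ / (v₁ + v₂) * (z - p) := fun z => by
    rw [integral_sub (integrable_const _)
      (by simpa using integrable_pow_gaussianReal _ (v₁ * v₂ / (v₁ + v₂)) 1),
      integral_id_gaussianReal]
    simp
    field_simp
    ring
  simp only [e2]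
  have e3 : ∀ z, (v₂ : ℝ) / (v₁ + v₂) * (z - p) * D z = v₂ / (v₁ + v₂) * ((z - p) * D z) :=
    fun z => by ring
  simp only [e3]
  rw [integral_const_mul]
  push_cast
  field_simp

end HasExpMoments

/-! ### Fisher information and entropy under further smoothing -/

lemma lintegral_gaussianReal_add (p : ℝ) (v₁ v₂ : ℝ≥0) {f : ℝ → ENNReal} (hf : Measurable f) :
    ∫⁻ x, f x ∂(gaussianReal p (v₁ + v₂)) =
      ∫⁻ q, ∫⁻ x, f x ∂(gaussianReal q v₂) ∂(gaussianReal p v₁) := by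
  have h := gaussianReal_conv_gaussianReal (m₁ := p) (m₂ := 0) (v₁ := v₁) (v₂ := v₂)
  rw [add_zero] at h
  rw [← h, Measure.lintegral_conv hf]
  refine lintegral_congr fun q => ?_
  have h2 := gaussianReal_map_const_add (μ := 0) (v := v₂) q
  rw [zero_add] at h2
  rw [← h2, lintegral_map hf (measurable_const_add q)]

lemma ofReal_integral_le_lintegral {α : Type*} [MeasurableSpace α] {μ : Measure α} {f : α → ℝ}
    (hf : Integrable f μ) : ENNReal.ofReal (∫ x, f x ∂μ) ≤ ∫⁻ x, ENNReal.ofReal (f x) ∂μ := by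
  calc ENNReal.ofReal (∫ x, f x ∂μ) ≤ ENNReal.ofReal (∫ x, max (f x) 0 ∂μ) :=
        ENNReal.ofReal_le_ofReal (integral_mono hf hf.pos_part fun x => le_max_left _ _)
    _ = ∫⁻ x, ENNReal.ofReal (max (f x) 0) ∂μ :=
        ofReal_integral_eq_lintegral_ofReal hf.pos_part
          (Eventually.of_forall fun x => le_max_right _ _)
    _ = _ := lintegral_congr fun x => by
        rcases le_total (f x) 0 with h | h
        · simp [h]
        · simp [h]

namespace HasExpMoments

lemma measurable_fisher_integrand (hD : HasExpMoments D) (hv : v ≠ 0) (hv1 : v ≤ 1) :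
    Measurable fun p => ENNReal.ofReal (gScore D v p ^ 2 / gMom D v 0 p) :=
  (((hD.continuous_gScore hv hv1).measurable.pow_const 2).div
    (hD.continuous_gMom hv hv1 0).measurable).ennreal_ofReal

/-- Cauchy-Schwarz for the Fisher information under one more smoothing step. -/
lemma fisher_integrand_le (hD : HasExpMoments D) (h₁ : v₁ ≠ 0) (h₂ : v₂ ≠ 0) (h : v₁ + v₂ ≤ 1)
    (p : ℝ) : ENNReal.ofReal (gScore D (v₁ + v₂) p ^ 2 / gMom D (v₁ + v₂) 0 p) ≤
      ∫⁻ q, ENNReal.ofReal (gScore D v₂ q ^ 2 / gMom D v₂ 0 q) ∂(gaussianReal p v₁) := by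
  have h₂' : v₂ ≤ 1 := le_trans (le_add_of_nonneg_left (zero_le)) h
  obtain ⟨i0, e0⟩ := hD.gMom_zero_semigroup h₁ h₂ h p
  obtain ⟨i1, e1⟩ := hD.gScore_semigroup h₁ h₂ h p
  set F := gMom D (v₁ + v₂) 0 p
  set s := gScore D (v₁ + v₂) p
  -- The convex function `s²/F` is the supremum over `c` of `2cs - c²F`. The optimal `c = s/F` is
  -- fixed at level `v₁ + v₂`, and linearity carries it to level `v₂`. If `F = 0`, both sides are
  -- `0` by the convention for division.
  have h3 : s ^ 2 / F = ∫ q, (2 * (s / F) * gScore D v₂ q - (s / F) ^ 2 * gMom D v₂ 0 q)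
      ∂(gaussianReal p v₁) := by
    rw [integral_sub (i1.const_mul _) (i0.const_mul _), integral_const_mul, integral_const_mul,
      e0, e1]
    rcases eq_or_ne F 0 with hF | hF
    · simp [hF]
    · field_simp; ring
  rw [h3]
  refine (ofReal_integral_le_lintegral ((i1.const_mul _).sub (i0.const_mul _))).trans ?_
  refine lintegral_mono fun q => ENNReal.ofReal_le_ofReal ?_
  simp only [Pi.sub_apply]
  rcases eq_or_ne (gMom D v₂ 0 q) 0 with hq | hq
  · simp [hq, hD.gScore_eq_zero h₂ h₂' hq]
  · have hq0 : 0 < gMom D v₂ 0 q := lt_of_le_of_ne (hD.gMom_zero_nonneg q) hq.symm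
    rw [le_div_iff₀ hq0]
    nlinarith [sq_nonneg (gScore D v₂ q - s / F * gMom D v₂ 0 q)]

/-- Since `1 - v₂ = (1 - (v₁+v₂)) + v₁`, averaging over `N(0, 1 - v₂)` is a two-step walk, and the
inequality holds already conditionally on the first step. -/
lemma fisher_antitone (hD : HasExpMoments D) (h₂ : v₂ ≠ 0) (h : v₁ + v₂ ≤ 1) :
    fisher D (v₁ + v₂) ≤ fisher D v₂ := by
  rcases eq_or_ne v₁ 0 with h0 | h₁
  · rw [h0, zero_add]
  have h₂' : v₂ ≤ 1 := le_trans (le_add_of_nonneg_left (zero_le)) h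
  have e : 1 - v₂ = (1 - (v₁ + v₂)) + v₁ := by
    rw [← tsub_tsub, tsub_right_comm]
    exact (tsub_add_cancel_of_le (le_tsub_of_add_le_right h)).symm
  rw [fisher, fisher, e, lintegral_gaussianReal_add _ _ _ (hD.measurable_fisher_integrand h₂ h₂')]
  exact lintegral_mono fun p => hD.fisher_integrand_le h₁ h₂ h p

/-- One step of the entropy production: the logarithmic Sobolev inequality at scale `v₁`. -/
lemma smoothEnt_le (hD : HasExpMoments D) (hD0 : ¬ D =ᵐ[volume] 0) (h₂ : v₂ ≠ 0)
    (h : v₁ + v₂ ≤ 1) :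
    smoothEnt D v₂ ≤ smoothEnt D (v₁ + v₂) + ENNReal.ofReal (v₁ / 2) * fisher D v₂ := by
  rcases eq_or_ne v₁ 0 with h0 | h₁
  · rw [h0, zero_add]; exact le_self_add
  have hv : v₁ + v₂ ≠ 0 := by positivity
  have h₂' : v₂ ≤ 1 := le_trans (le_add_of_nonneg_left (zero_le)) h
  have e : 1 - v₂ = (1 - (v₁ + v₂)) + v₁ := by
    rw [← tsub_tsub, tsub_right_comm]
    exact (tsub_add_cancel_of_le (le_tsub_of_add_le_right h)).symm
  have hm : Measurable fun p => ENNReal.ofReal (klFun (gMom D v₂ 0 p)) :=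
    (measurable_klFun.comp (hD.continuous_gMom h₂ h₂' 0).measurable).ennreal_ofReal
  have hm2 : Measurable fun p => ENNReal.ofReal (klFun (gMom D (v₁ + v₂) 0 p)) :=
    (measurable_klFun.comp (hD.continuous_gMom hv h 0).measurable).ennreal_ofReal
  rw [fisher, smoothEnt, smoothEnt, e,
    lintegral_gaussianReal_add _ _ _ (hD.measurable_fisher_integrand h₂ h₂'),
    lintegral_gaussianReal_add _ _ _ hm, ← lintegral_const_mul' _ _ ENNReal.ofReal_ne_top,
    ← lintegral_add_left hm2]
  refine lintegral_mono fun p => ?_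
  -- The logarithmic Sobolev inequality is applied under `N(p, v₁)` to the likelihood smoothed at
  -- level `v₂`. Its mean there is the likelihood smoothed at level `v₁ + v₂`.
  have h5 := lintegral_klFun_le_fisher (p := p) h₁ (fun x => hD.hasDerivAt_gMom_zero h₂ h₂' x)
    (hD.continuous_gScore h₂ h₂') (fun x => hD.gMom_zero_pos hD0 h₂ h₂' x)
    (hD.gMom_zero_semigroup h₁ h₂ h p).1 (hD.integrable_id_mul_gMom_zero h₁ h₂ h p)
  rwa [(hD.gMom_zero_semigroup h₁ h₂ h p).2] at h5

end HasExpMoments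

end Smoothing


/-! ### `f_out` as an averaged Fisher information -/

lemma gaussianReal_eq_map (p : ℝ) (v : NNReal) :
    gaussianReal p v = (gaussianReal 0 1).map fun w => p + √(v : ℝ) * w := by
  have h1 := gaussianReal_map_const_mul (μ := 0) (v := 1) (√(v : ℝ))
  have h2 := gaussianReal_map_const_add (μ := 0) (v := v) p
  have e : (NNReal.mk (√(v : ℝ) ^ 2) (sq_nonneg _)) * 1 = v := by
    ext; simp [Real.sq_sqrt]
  rw [mul_zero, e] at h1
  rw [zero_add, ← h1, Measure.map_map (measurable_const_add p) (measurable_const_mul _)] at h2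
  exact h2.symm

open Filter in
lemma HasExpMoments.integral_sq_sub_mul {D : ℝ → ℝ} (hD : HasExpMoments D) {v : NNReal}
    (hv : v ≠ 0) (hv1 : v ≤ 1) (p l : ℝ) :
    ∫ z, (z - l) ^ 2 * D z ∂(gaussianReal p v) =
      gMom D v 2 p - 2 * l * gMom D v 1 p + l ^ 2 * gMom D v 0 p := by
  have i0 := (hD.integrable_pow_mul hv hv1 0 p).const_mul (l ^ 2)
  have i1 := (hD.integrable_pow_mul hv hv1 1 p).const_mul (2 * l)
  have i2 := hD.integrable_pow_mul hv hv1 2 p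
  have i3 : Integrable (fun z => z ^ 2 * D z - 2 * l * (z ^ 1 * D z)) (gaussianReal p v) :=
    i2.sub i1
  rw [gMom, gMom, gMom, ← integral_const_mul, ← integral_const_mul,
    ← integral_sub i2 i1, ← integral_add i3 i0]
  refine integral_congr_ae (Eventually.of_forall fun z => ?_)
  simp only
  ring

namespace MemorylessChannel

open Filter Topology Set
open scoped NNReal

variable (P : MemorylessChannel)

/-- The likelihood of the input, given the output `y`. -/
def lik (y : ℝ) : ℝ → ℝ := fun z => P.dens z y

lemma measurable_lik (y : ℝ) : Measurable (P.lik y) :=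
  P.measurable_dens.comp (measurable_id.prodMk measurable_const)

lemma measurable_dens_right (z : ℝ) : Measurable (P.dens z) :=
  P.measurable_dens.comp (measurable_const.prodMk measurable_id)

lemma integrable_dens (z : ℝ) : Integrable (P.dens z) P.ref := by
  refine ⟨(P.measurable_dens_right z).aestronglyMeasurable, ?_⟩
  rw [hasFiniteIntegral_iff_ofReal (Eventually.of_forall (P.dens_nonneg z)), P.lintegral_dens]
  exact ENNReal.one_lt_top

lemma integral_dens (z : ℝ) : ∫ y, P.dens z y ∂P.ref = 1 := by
  rw [integral_eq_lintegral_of_nonneg_ae (Eventually.of_forall (P.dens_nonneg z))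
    (P.measurable_dens_right z).aestronglyMeasurable, P.lintegral_dens]
  rfl

lemma integrable_mul_dens {μ : Measure ℝ} [SFinite μ] {f : ℝ → ℝ} (hf : Integrable f μ) :
    Integrable (fun x : ℝ × ℝ => f x.1 * P.dens x.1 x.2) (μ.prod P.ref) := by
  have hm : AEStronglyMeasurable (fun x : ℝ × ℝ => f x.1 * P.dens x.1 x.2) (μ.prod P.ref) :=
    hf.1.comp_fst.mul P.measurable_dens.aestronglyMeasurable
  rw [integrable_prod_iff hm]
  refine ⟨Eventually.of_forall fun z => (P.integrable_dens z).const_mul (f z), ?_⟩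
  refine hf.norm.congr (Eventually.of_forall fun z => ?_)
  simp only [norm_mul]
  rw [integral_const_mul]
  simp only [Real.norm_of_nonneg (P.dens_nonneg _ _), P.integral_dens, mul_one]

lemma integral_integral_mul_dens {μ : Measure ℝ} [SFinite μ] {f : ℝ → ℝ} (hf : Integrable f μ) :
    ∫ y, ∫ z, f z * P.dens z y ∂μ ∂P.ref = ∫ z, f z ∂μ := by
  have h := integral_integral_swap (f := fun z y => f z * P.dens z y) (P.integrable_mul_dens hf)
  rw [← h]
  refine integral_congr_ae (Eventually.of_forall fun z => ?_)
  simp only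
  rw [integral_const_mul, P.integral_dens, mul_one]

/-- Averaging `exp(nz) P_out(y|z)` over `y` gives `exp(nz)`, so Fubini handles the countably many
integer exponents. A real exponent lies between its floor and its ceiling. -/
lemma ae_hasExpMoments : ∀ᵐ y ∂P.ref, HasExpMoments (P.lik y) := by
  have h : ∀ n : ℤ, ∀ᵐ y ∂P.ref,
      Integrable (fun z => Real.exp (n * z) * P.dens z y) (gaussianReal 0 1) := fun n =>
    (P.integrable_mul_dens (integrable_exp_mul_gaussianReal (μ := 0) (v := 1) n)).prod_left_ae
  filter_upwards [ae_all_iff.2 h] with y hy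
  refine ⟨P.measurable_lik y, fun z => P.dens_nonneg z y, fun t => ?_⟩
  have hm := P.measurable_lik y
  refine ((hy ⌈t⌉).add (hy ⌊t⌋)).mono' (by fun_prop) (Eventually.of_forall fun z => ?_)
  have h0 := P.dens_nonneg z y
  change ‖Real.exp (t * z) * P.dens z y‖ ≤ _
  rw [Real.norm_of_nonneg (mul_nonneg (Real.exp_pos _).le h0), Pi.add_apply, ← add_mul]
  refine mul_le_mul_of_nonneg_right ?_ h0
  rcases le_total 0 z with hz | hz
  · have : Real.exp (t * z) ≤ Real.exp (⌈t⌉ * z) :=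
      Real.exp_le_exp.2 (mul_le_mul_of_nonneg_right (Int.le_ceil t) hz)
    linarith [Real.exp_pos (⌊t⌋ * z)]
  · have : Real.exp (t * z) ≤ Real.exp (⌊t⌋ * z) :=
      Real.exp_le_exp.2 (mul_le_mul_of_nonpos_right (Int.floor_le t) hz)
    linarith [Real.exp_pos (⌈t⌉ * z)]

lemma measurable_integral_gaussianReal {f : ℝ × ℝ → ℝ → ℝ}
    (hf : Measurable fun x : (ℝ × ℝ) × ℝ => f x.1 x.2) (v : ℝ≥0) :
    Measurable fun x : ℝ × ℝ => ∫ z, f x z ∂(gaussianReal x.1 v) := by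
  have h : (fun x : ℝ × ℝ => ∫ z, f x z ∂(gaussianReal x.1 v)) = fun x : ℝ × ℝ =>
      ∫ w, f x (x.1 + √(v : ℝ) * w) ∂(gaussianReal 0 1) := by
    ext x
    have hx : Measurable (f x) := hf.comp (measurable_const.prodMk measurable_id)
    rw [gaussianReal_eq_map x.1 v, integral_map (by fun_prop) hx.aestronglyMeasurable]
  rw [h]
  have h3 : Measurable fun q : (ℝ × ℝ) × ℝ => q.1.1 + √(v : ℝ) * q.2 := by fun_prop
  have h2 : Measurable fun q : (ℝ × ℝ) × ℝ => f q.1 (q.1.1 + √(v : ℝ) * q.2) :=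
    hf.comp (measurable_fst.prodMk h3)
  exact (h2.stronglyMeasurable.integral_prod_right').measurable

lemma measurable_gMom_lik (v : ℝ≥0) (n : ℕ) :
    Measurable fun x : ℝ × ℝ => gMom (P.lik x.2) v n x.1 := by
  refine measurable_integral_gaussianReal (f := fun x z => z ^ n * P.dens z x.2) ?_ v
  exact (measurable_snd.pow_const n).mul
    (P.measurable_dens.comp (measurable_snd.prodMk (measurable_snd.comp measurable_fst)))

lemma measurable_gScore_lik (v : ℝ≥0) :
    Measurable fun x : ℝ × ℝ => gScore (P.lik x.2) v x.1 :=
  ((P.measurable_gMom_lik v 1).sub (measurable_fst.mul (P.measurable_gMom_lik v 0))).div_const _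

/-- The centred second moment of the likelihood. -/
noncomputable def cMom (v : ℝ≥0) (p y : ℝ) : ℝ :=
  ∫ z, (z - p) ^ 2 * P.dens z y ∂(gaussianReal p v)

lemma measurable_cMom (v : ℝ≥0) : Measurable fun x : ℝ × ℝ => P.cMom v x.1 x.2 := by
  refine measurable_integral_gaussianReal (f := fun x z => (z - x.1) ^ 2 * P.dens z x.2) ?_ v
  exact (by fun_prop : Measurable fun x : (ℝ × ℝ) × ℝ => (x.2 - x.1.1) ^ 2).mul
    (P.measurable_dens.comp (measurable_snd.prodMk (measurable_snd.comp measurable_fst)))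

/-- The negative derivative of `g_out`, through the posterior variance. -/
noncomputable def outCurv (v : ℝ≥0) (p y : ℝ) : ℝ :=
  1 / v - (P.cMom v p y / gMom (P.lik y) v 0 p -
    v ^ 2 * (gScore (P.lik y) v p / gMom (P.lik y) v 0 p) ^ 2) / v ^ 2

lemma measurable_outCurv (v : ℝ≥0) : Measurable (Function.uncurry (P.outCurv v)) := by
  have := P.measurable_cMom v
  have := P.measurable_gScore_lik v
  have := P.measurable_gMom_lik v 0
  unfold outCurv Function.uncurry
  fun_prop

variable {P} {v : ℝ≥0} {y : ℝ}

lemma cMom_eq (hy : HasExpMoments (P.lik y)) (hv : v ≠ 0) (hv1 : v ≤ 1) (p : ℝ) :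
    P.cMom v p y = gMom (P.lik y) v 2 p - 2 * p * gMom (P.lik y) v 1 p +
      p ^ 2 * gMom (P.lik y) v 0 p := by
  exact hy.integral_sq_sub_mul hv hv1 p p

lemma gMom_one_eq (hv : v ≠ 0) (p : ℝ) : gMom (P.lik y) v 1 p =
    v * gScore (P.lik y) v p + p * gMom (P.lik y) v 0 p := by
  have : (v : ℝ) ≠ 0 := by exact_mod_cast hv
  rw [gScore]
  field_simp
  ring

lemma cMom_nonneg (p : ℝ) : 0 ≤ P.cMom v p y :=
  integral_nonneg fun z => mul_nonneg (sq_nonneg _) (P.dens_nonneg z y)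

lemma cMom_eq_zero (hy : HasExpMoments (P.lik y)) (hv : v ≠ 0) (hv1 : v ≤ 1) {p : ℝ}
    (h : gMom (P.lik y) v 0 p = 0) : P.cMom v p y = 0 := by
  have h0 := hy.ae_eq_zero_of_gMom_zero hv hv1 h
  rw [cMom_eq hy hv hv1]
  simp [HasExpMoments.gMom_eq_zero h0 hv]

/-- Nonnegativity of the posterior variance. -/
lemma sq_gScore_le (hy : HasExpMoments (P.lik y)) (hv : v ≠ 0) (hv1 : v ≤ 1) (p : ℝ) :
    gScore (P.lik y) v p ^ 2 / gMom (P.lik y) v 0 p ≤ P.cMom v p y / v ^ 2 := by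
  have hv0 : (0 : ℝ) < v := by positivity
  rcases eq_or_ne (gMom (P.lik y) v 0 p) 0 with h | h
  · rw [h, div_zero]
    exact div_nonneg (cMom_nonneg p) (by positivity)
  have h0 : 0 < gMom (P.lik y) v 0 p := lt_of_le_of_ne (hy.gMom_zero_nonneg p) h.symm
  set m := gMom (P.lik y) v 0 p
  set s := gScore (P.lik y) v p
  set l := p + v * s / m with hl
  have h1 : 0 ≤ ∫ z, (z - l) ^ 2 * P.lik y z ∂(gaussianReal p v) :=
    integral_nonneg fun z => mul_nonneg (sq_nonneg _) (hy.nonneg z)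
  have h2 : ∫ z, (z - l) ^ 2 * P.lik y z ∂(gaussianReal p v) =
      gMom (P.lik y) v 2 p - 2 * l * gMom (P.lik y) v 1 p + l ^ 2 * m :=
    hy.integral_sq_sub_mul hv hv1 p l
  have h3 : gMom (P.lik y) v 2 p - 2 * l * gMom (P.lik y) v 1 p + l ^ 2 * m =
      P.cMom v p y - v ^ 2 * (s ^ 2 / m) := by
    rw [cMom_eq hy hv hv1, gMom_one_eq hv]
    change _ - 2 * l * (v * s + p * m) + _ = _ - 2 * p * (v * s + p * m) + p ^ 2 * m - _
    rw [hl]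
    field_simp
    ring
  rw [h2, h3] at h1
  rw [le_div_iff₀ (by positivity)]
  linarith

/-- This isolates the Fisher term: the other two integrate over `y` to `1/v` and `v/v²`, which
cancel. -/
lemma gMom_mul_outCurv (hy : HasExpMoments (P.lik y)) (hv : v ≠ 0) (hv1 : v ≤ 1) (p : ℝ) :
    gMom (P.lik y) v 0 p * P.outCurv v p y = gMom (P.lik y) v 0 p / v - P.cMom v p y / v ^ 2 +
      gScore (P.lik y) v p ^ 2 / gMom (P.lik y) v 0 p := by
  have hv0 : (v : ℝ) ≠ 0 := by exact_mod_cast hv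
  rcases eq_or_ne (gMom (P.lik y) v 0 p) 0 with h | h
  · simp [h, cMom_eq_zero hy hv hv1 h]
  · rw [outCurv]
    field_simp
    ring

lemma gMom_mul_abs_outCurv_le (hy : HasExpMoments (P.lik y)) (hv : v ≠ 0) (hv1 : v ≤ 1) (p : ℝ) :
    gMom (P.lik y) v 0 p * |P.outCurv v p y| ≤
      gMom (P.lik y) v 0 p / v + P.cMom v p y / v ^ 2 := by
  have hv0 : (0 : ℝ) < v := by positivity
  have h0 := hy.gMom_zero_nonneg (v := v) p
  rw [← abs_of_nonneg h0, ← abs_mul, abs_of_nonneg h0, gMom_mul_outCurv hy hv hv1, abs_le]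
  have h1 := sq_gScore_le hy hv hv1 p
  have h2 : 0 ≤ gScore (P.lik y) v p ^ 2 / gMom (P.lik y) v 0 p := by positivity
  have h3 : 0 ≤ gMom (P.lik y) v 0 p / v := by positivity
  have h4 : 0 ≤ P.cMom v p y / v ^ 2 := div_nonneg (cMom_nonneg p) (by positivity)
  constructor <;> linarith

lemma posteriorMean_eq (hv : v ≠ 0) (p : ℝ) :
    P.posteriorMean p y v = gMom (P.lik y) v 1 p / gMom (P.lik y) v 0 p := by
  have hv0 : (0 : ℝ) < v := by positivity
  have hc : (√(2 * Real.pi * v))⁻¹ ≠ 0 := by positivity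
  rw [gMom, gMom, integral_gaussianReal_eq hv, integral_gaussianReal_eq hv, posteriorMean,
    ← mul_div_mul_left _ _ hc, ← integral_const_mul, ← integral_const_mul]
  congr 1
  all_goals
    refine integral_congr_ae (Eventually.of_forall fun z => ?_)
    simp only [lik, gaussianPDFReal_def]
    ring

lemma deriv_gOut (hy : HasExpMoments (P.lik y)) (hv : v ≠ 0) (hv1 : v ≤ 1) (p : ℝ) :
    deriv (fun p => P.gOut p y v) p = -P.outCurv v p y := by
  have hv0 : (0 : ℝ) < v := by positivity
  have e : (fun p => P.gOut p y v) = fun p =>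
      (gMom (P.lik y) v 1 p / gMom (P.lik y) v 0 p - p) / v := by
    ext p; rw [gOut, posteriorMean_eq hv]
  rw [e]
  -- For a vanishing likelihood the posterior mean is `0` by the convention for division, so `g_out
  -- = -p/v` and the curvature is `1/v`, as the formula for `outCurv` predicts.
  by_cases h : P.lik y =ᵐ[volume] 0
  · have h0 : ∀ n q, gMom (P.lik y) v n q = 0 := fun n q => HasExpMoments.gMom_eq_zero h hv n q
    have h1 : HasDerivAt (fun p : ℝ => (gMom (P.lik y) v 1 p / gMom (P.lik y) v 0 p - p) / v)
        ((0 - 1) / v) p := by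
      simp only [h0, div_zero]
      exact ((hasDerivAt_const p (0 : ℝ)).sub (hasDerivAt_id p)).div_const _
    rw [h1.deriv, outCurv, h0]
    simp [neg_div]
  · have hm := hy.gMom_zero_pos h hv hv1 p
    have h1 := ((((hy.hasDerivAt_gMom hv hv1 1 p).div (hy.hasDerivAt_gMom hv hv1 0 p)
      hm.ne').sub (hasDerivAt_id p)).div_const (v : ℝ)).deriv
    refine Eq.trans h1 ?_
    rw [outCurv, cMom_eq hy hv hv1, gMom_one_eq hv]
    simp only [Nat.reduceAdd]
    field_simp
    ring

variable (P)

/-- The Fisher information at `p`. -/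
noncomputable def outFisher (v : ℝ≥0) (p : ℝ) : ℝ :=
  ∫ y, gScore (P.lik y) v p ^ 2 / gMom (P.lik y) v 0 p ∂P.ref

lemma integrable_cMom (v : ℝ≥0) (p : ℝ) : Integrable (P.cMom v p) P.ref :=
  (P.integrable_mul_dens (μ := gaussianReal p v) (f := fun z => (z - p) ^ 2)
    (((memLp_id_gaussianReal 2).sub (memLp_const p)).integrable_sq)).integral_prod_right

lemma integral_cMom (v : ℝ≥0) (p : ℝ) : ∫ y, P.cMom v p y ∂P.ref = v := by
  have h := P.integral_integral_mul_dens (μ := gaussianReal p v) (f := fun z => (z - p) ^ 2)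
    (((memLp_id_gaussianReal 2).sub (memLp_const p)).integrable_sq)
  refine h.trans ?_
  have h2 := variance_fun_id_gaussianReal (μ := p) (v := v)
  rw [variance_eq_integral (by fun_prop)] at h2
  simpa [integral_id_gaussianReal] using h2

lemma gMom_zero_lik (v : ℝ≥0) (p y : ℝ) :
    gMom (P.lik y) v 0 p = ∫ z, 1 * P.dens z y ∂(gaussianReal p v) := by
  simp [gMom, lik]

lemma integrable_gMom (v : ℝ≥0) (p : ℝ) : Integrable (fun y => gMom (P.lik y) v 0 p) P.ref := by
  simp only [gMom_zero_lik]
  exact (P.integrable_mul_dens (μ := gaussianReal p v) (f := fun _ => 1)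
    (integrable_const _)).integral_prod_right

lemma integral_gMom (v : ℝ≥0) (p : ℝ) : ∫ y, gMom (P.lik y) v 0 p ∂P.ref = 1 := by
  simp only [gMom_zero_lik]
  rw [P.integral_integral_mul_dens (integrable_const _)]
  simp

variable {P}

lemma outFisher_integrand_nonneg (v : ℝ≥0) (p y : ℝ) :
    0 ≤ gScore (P.lik y) v p ^ 2 / gMom (P.lik y) v 0 p :=
  div_nonneg (sq_nonneg _) (by
    rw [gMom_zero_lik]
    exact integral_nonneg fun z => by simpa using P.dens_nonneg z y)

lemma integrable_outFisher_integrand (hv : v ≠ 0) (hv1 : v ≤ 1) (p : ℝ) :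
    Integrable (fun y => gScore (P.lik y) v p ^ 2 / gMom (P.lik y) v 0 p) P.ref := by
  refine ((P.integrable_cMom v p).div_const (v ^ 2)).mono' ?_ ?_
  · exact ((((P.measurable_gScore_lik v).pow_const 2).div (P.measurable_gMom_lik v 0)).comp
      (measurable_const.prodMk measurable_id :
        Measurable fun y : ℝ => (p, y))).aestronglyMeasurable
  · filter_upwards [P.ae_hasExpMoments] with y hy
    rw [Real.norm_of_nonneg (outFisher_integrand_nonneg v p y)]
    exact sq_gScore_le hy hv hv1 p

lemma outFisher_nonneg (p : ℝ) : 0 ≤ P.outFisher v p :=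
  integral_nonneg fun y => outFisher_integrand_nonneg v p y

lemma outFisher_le (hv : v ≠ 0) (hv1 : v ≤ 1) (p : ℝ) : P.outFisher v p ≤ 1 / v := by
  have hv0 : (0 : ℝ) < v := by positivity
  have h : P.outFisher v p ≤ ∫ y, P.cMom v p y / v ^ 2 ∂P.ref := by
    refine integral_mono_ae (integrable_outFisher_integrand hv hv1 p)
      ((P.integrable_cMom v p).div_const _) ?_
    filter_upwards [P.ae_hasExpMoments] with y hy using sq_gScore_le hy hv hv1 p
  rw [integral_div, P.integral_cMom] at h
  refine h.trans (le_of_eq ?_)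
  field_simp

lemma measurable_outFisher : Measurable (P.outFisher v) :=
  ((((P.measurable_gScore_lik v).pow_const 2).div
    (P.measurable_gMom_lik v 0)).stronglyMeasurable.integral_prod_right').measurable

lemma integrable_dens_mul_outCurv (hv : v ≠ 0) (hv1 : v ≤ 1) (p : ℝ) :
    Integrable (fun x : ℝ × ℝ => P.dens x.1 x.2 * P.outCurv v p x.2)
      ((gaussianReal p v).prod P.ref) := by
  have hc : Measurable (P.outCurv v p) := Measurable.of_uncurry_left (P.measurable_outCurv v)
  have hm : Measurable fun x : ℝ × ℝ => P.dens x.1 x.2 * P.outCurv v p x.2 :=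
    P.measurable_dens.mul (hc.comp measurable_snd)
  rw [integrable_prod_iff' hm.aestronglyMeasurable]
  constructor
  · filter_upwards [P.ae_hasExpMoments] with y hy
    exact (by simpa [lik] using hy.integrable_pow_mul hv hv1 0 p :
      Integrable (fun z => P.dens z y) (gaussianReal p v)).mul_const _
  · refine (((P.integrable_gMom v p).div_const (v : ℝ)).add
      ((P.integrable_cMom v p).div_const (v ^ 2))).mono' ?_ ?_
    · exact (hm.norm.stronglyMeasurable.integral_prod_left').aestronglyMeasurable
    · filter_upwards [P.ae_hasExpMoments] with y hy
      have e : ∫ z, ‖P.dens z y * P.outCurv v p y‖ ∂(gaussianReal p v) =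
          gMom (P.lik y) v 0 p * |P.outCurv v p y| := by
        simp only [norm_mul, Real.norm_of_nonneg (P.dens_nonneg _ _), Real.norm_eq_abs]
        rw [integral_mul_const, gMom_zero_lik]
        simp
      rw [e, Real.norm_of_nonneg (mul_nonneg (hy.gMom_zero_nonneg p) (abs_nonneg _))]
      exact gMom_mul_abs_outCurv_le hy hv hv1 p

lemma integral_norm_dens_mul_outCurv_le (hv : v ≠ 0) (hv1 : v ≤ 1) (p : ℝ) :
    ∫ z, (∫ y, ‖P.dens z y * P.outCurv v p y‖ ∂P.ref) ∂(gaussianReal p v) ≤ 2 / v := by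
  have hv0 : (0 : ℝ) < v := by positivity
  have hi := (integrable_dens_mul_outCurv (P := P) hv hv1 p).norm
  rw [integral_integral_swap (f := fun z y => ‖P.dens z y * P.outCurv v p y‖) hi]
  have h : ∫ y, ∫ z, ‖P.dens z y * P.outCurv v p y‖ ∂(gaussianReal p v) ∂P.ref ≤
      ∫ y, (gMom (P.lik y) v 0 p / v + P.cMom v p y / v ^ 2) ∂P.ref := by
    refine integral_mono_ae hi.integral_prod_right (((P.integrable_gMom v p).div_const (v : ℝ)).add
      ((P.integrable_cMom v p).div_const (v ^ 2))) ?_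
    filter_upwards [P.ae_hasExpMoments] with y hy
    simp only [norm_mul, Real.norm_of_nonneg (P.dens_nonneg _ _), Real.norm_eq_abs]
    rw [integral_mul_const]
    have := gMom_mul_abs_outCurv_le hy hv hv1 p
    refine le_trans (le_of_eq ?_) this
    rw [gMom_zero_lik]
    simp only [one_mul]
  rw [integral_add ((P.integrable_gMom v p).div_const (v : ℝ))
      ((P.integrable_cMom v p).div_const (v ^ 2)), integral_div, integral_div, P.integral_gMom,
      P.integral_cMom] at h
  refine h.trans (le_of_eq ?_)
  field_simp
  norm_num

/-- Exchanging the integrals weights the curvature by the smoothed likelihood. The mass of the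
output density is 1 and the centred second moment is `v`, so only the Fisher term survives. -/
lemma integral_dens_mul_outCurv (hv : v ≠ 0) (hv1 : v ≤ 1) (p : ℝ) :
    ∫ z, (∫ y, P.dens z y * P.outCurv v p y ∂P.ref) ∂(gaussianReal p v) = P.outFisher v p := by
  have hv0 : (0 : ℝ) < v := by positivity
  have hi := integrable_dens_mul_outCurv (P := P) hv hv1 p
  rw [integral_integral_swap (f := fun z y => P.dens z y * P.outCurv v p y) hi]
  have h : ∫ y, ∫ z, P.dens z y * P.outCurv v p y ∂(gaussianReal p v) ∂P.ref =
      ∫ y, (gMom (P.lik y) v 0 p / v - P.cMom v p y / v ^ 2 +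
      gScore (P.lik y) v p ^ 2 / gMom (P.lik y) v 0 p) ∂P.ref := by
    refine integral_congr_ae ?_
    filter_upwards [P.ae_hasExpMoments] with y hy
    rw [integral_mul_const, ← gMom_mul_outCurv hy hv hv1, gMom_zero_lik]
    simp
  have i1 : Integrable (fun y => gMom (P.lik y) v 0 p / v - P.cMom v p y / v ^ 2) P.ref :=
    ((P.integrable_gMom v p).div_const (v : ℝ)).sub ((P.integrable_cMom v p).div_const (v ^ 2))
  rw [h, integral_add i1 (integrable_outFisher_integrand hv hv1 p),
    integral_sub ((P.integrable_gMom v p).div_const (v : ℝ))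
      ((P.integrable_cMom v p).div_const (v ^ 2)), integral_div, integral_div, P.integral_gMom,
      P.integral_cMom, ← outFisher]
  field_simp
  ring

lemma integral_kernel (u : ℝ) (f : ℝ → ℝ) :
    ∫ y, f y ∂(P.kernel u) = ∫ y, P.dens u y * f y ∂P.ref := by
  have hm : Measurable (Function.uncurry fun u y => ENNReal.ofReal (P.dens u y)) :=
    P.measurable_dens.ennreal_ofReal
  rw [kernel, Kernel.withDensity_apply _ hm, Kernel.const_apply,
    integral_withDensity_eq_integral_toReal_smul (P.measurable_dens_right u).ennreal_ofReal
    (Eventually.of_forall fun _ => by simp)]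
  simp only [ENNReal.toReal_ofReal (P.dens_nonneg _ _), smul_eq_mul]

variable (P) in
/-- The conditional mean of the curvature, given `p` and the channel input `z`. -/
noncomputable def condCurv (v : ℝ≥0) (p z : ℝ) : ℝ :=
  ∫ y, P.dens z y * P.outCurv v p y ∂P.ref

lemma measurable_condCurv : Measurable (Function.uncurry (P.condCurv v)) := by
  have hm : Measurable fun x : (ℝ × ℝ) × ℝ => P.dens x.1.2 x.2 * P.outCurv v x.1.1 x.2 := by
    refine Measurable.mul ?_ ?_
    · exact P.measurable_dens.comp
        ((measurable_snd.comp measurable_fst).prodMk measurable_snd)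
    · exact (P.measurable_outCurv v).comp
        ((measurable_fst.comp measurable_fst).prodMk measurable_snd)
  exact (hm.stronglyMeasurable.integral_prod_right').measurable

lemma integrable_condCurv (hv : v ≠ 0) (hv1 : v ≤ 1) (p : ℝ) :
    Integrable (P.condCurv v p) (gaussianReal p v) :=
  (integrable_dens_mul_outCurv hv hv1 p).integral_prod_left

lemma integral_norm_condCurv_le (hv : v ≠ 0) (hv1 : v ≤ 1) (p : ℝ) :
    ∫ z, ‖P.condCurv v p z‖ ∂(gaussianReal p v) ≤ 2 / v :=
  (integral_mono (integrable_condCurv hv hv1 p).norm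
    (integrable_dens_mul_outCurv hv hv1 p).norm.integral_prod_left
    fun _ => norm_integral_le_integral_norm _).trans
    (integral_norm_dens_mul_outCurv_le hv hv1 p)

lemma integral_condCurv (hv : v ≠ 0) (hv1 : v ≤ 1) (p : ℝ) :
    ∫ z, P.condCurv v p z ∂(gaussianReal p v) = P.outFisher v p :=
  integral_dens_mul_outCurv hv hv1 p

lemma fOut_eq_integral_condCurv (hv : v ≠ 0) (hv1 : v ≤ 1) :
    P.fOut v = ∫ w : ℝ × ℝ, P.condCurv v (√(1 - (v : ℝ)) * w.1)
      (√(1 - (v : ℝ)) * w.1 + √(v : ℝ) * w.2)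
      ∂((gaussianReal 0 1).prod (gaussianReal 0 1)) := by
  rw [fOut, ← integral_neg]
  refine integral_congr_ae (Eventually.of_forall fun w => ?_)
  simp only
  rw [integral_kernel, ← integral_neg, condCurv]
  refine integral_congr_ae ?_
  filter_upwards [P.ae_hasExpMoments] with y hy
  rw [deriv_gOut hy hv hv1]
  ring

/-- Integration over a correlated Gaussian pair, conditionally on the first coordinate. -/
lemma integral_gaussian_pair {K : ℝ → ℝ → ℝ} (hK : Measurable (Function.uncurry K)) {C : ℝ}
    (hi : ∀ p, Integrable (K p) (gaussianReal p v))
    (hC : ∀ p, ∫ z, ‖K p z‖ ∂(gaussianReal p v) ≤ C) (u : ℝ≥0) :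
    ∫ w : ℝ × ℝ, K (√(u : ℝ) * w.1) (√(u : ℝ) * w.1 + √(v : ℝ) * w.2)
      ∂((gaussianReal 0 1).prod (gaussianReal 0 1)) =
    ∫ p, (∫ z, K p z ∂(gaussianReal p v)) ∂(gaussianReal 0 u) := by
  have hKp : ∀ p, Measurable (K p) := fun p => Measurable.of_uncurry_left hK
  have hm : Measurable fun w : ℝ × ℝ =>
      K (√(u : ℝ) * w.1) (√(u : ℝ) * w.1 + √(v : ℝ) * w.2) :=
    hK.comp ((by fun_prop : Measurable fun w : ℝ × ℝ => √(u : ℝ) * w.1).prodMk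
      (by fun_prop : Measurable fun w : ℝ × ℝ => √(u : ℝ) * w.1 + √(v : ℝ) * w.2))
  have hi' : ∀ p, Integrable (fun w => K p (p + √(v : ℝ) * w)) (gaussianReal 0 1) := fun p => by
    have h1 := hi p
    rw [gaussianReal_eq_map p v,
      integrable_map_measure (hKp p).aestronglyMeasurable (by fun_prop)] at h1
    exact h1
  have htr : ∀ p, ∫ w, K p (p + √(v : ℝ) * w) ∂(gaussianReal 0 1) =
      ∫ z, K p z ∂(gaussianReal p v) := fun p => by
    rw [gaussianReal_eq_map p v,
      integral_map (by fun_prop) (hKp p).aestronglyMeasurable]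
  have htr' : ∀ p, ∫ w, ‖K p (p + √(v : ℝ) * w)‖ ∂(gaussianReal 0 1) =
      ∫ z, ‖K p z‖ ∂(gaussianReal p v) := fun p => by
    rw [gaussianReal_eq_map p v,
      integral_map (by fun_prop) (hKp p).norm.aestronglyMeasurable]
  have hInt : Integrable (fun w : ℝ × ℝ =>
      K (√(u : ℝ) * w.1) (√(u : ℝ) * w.1 + √(v : ℝ) * w.2))
      ((gaussianReal 0 1).prod (gaussianReal 0 1)) := by
    rw [integrable_prod_iff hm.aestronglyMeasurable]
    refine ⟨Eventually.of_forall fun x => hi' (√(u : ℝ) * x), ?_⟩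
    refine Integrable.of_bound
      (hm.norm.stronglyMeasurable.integral_prod_right').aestronglyMeasurable C
      (Eventually.of_forall fun x => ?_)
    rw [Real.norm_of_nonneg (integral_nonneg fun _ => norm_nonneg _)]
    exact (htr' (√(u : ℝ) * x)).trans_le (hC _)
  have hm2 : Measurable fun p => ∫ z, K p z ∂(gaussianReal p v) := by
    simp only [← htr]
    have : Measurable fun x : ℝ × ℝ => K x.1 (x.1 + √(v : ℝ) * x.2) :=
      hK.comp (measurable_fst.prodMk
        (by fun_prop : Measurable fun x : ℝ × ℝ => x.1 + √(v : ℝ) * x.2))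
    exact (this.stronglyMeasurable.integral_prod_right').measurable
  rw [integral_prod _ hInt, gaussianReal_eq_map 0 u,
    integral_map (by fun_prop) hm2.aestronglyMeasurable]
  refine integral_congr_ae (Eventually.of_forall fun x => ?_)
  simp only [zero_add]
  exact htr _

/-- `f_out` is an average of Fisher informations. -/
theorem fOut_eq (hv : v ≠ 0) (hv1 : v ≤ 1) :
    P.fOut v = ∫ p, P.outFisher v p ∂(gaussianReal 0 (1 - v)) := by
  have h := integral_gaussian_pair (K := P.condCurv v) (v := v) measurable_condCurv
    (integrable_condCurv hv hv1) (integral_norm_condCurv_le hv hv1) (1 - v)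
  rw [NNReal.coe_sub hv1, NNReal.coe_one, ← fOut_eq_integral_condCurv hv hv1] at h
  simpa only [integral_condCurv hv hv1] using h

/-! ### Monotonicity of `f_out` -/

variable (P)

/-- The Fisher information of the channel at noise level `v`. -/
noncomputable def channelFisher (v : ℝ≥0) : ENNReal := ∫⁻ y, fisher (P.lik y) v ∂P.ref

variable {P}

lemma integrable_outFisher (hv : v ≠ 0) (hv1 : v ≤ 1) (μ : Measure ℝ) [IsFiniteMeasure μ] :
    Integrable (P.outFisher v) μ :=
  Integrable.of_bound measurable_outFisher.aestronglyMeasurable (1 / v)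
    (Eventually.of_forall fun p => by
      rw [Real.norm_of_nonneg (outFisher_nonneg p)]; exact outFisher_le hv hv1 p)

/-- Tonelli moves the average over `y` outside, so Fisher informations can be compared output by
output. -/
theorem ofReal_fOut (hv : v ≠ 0) (hv1 : v ≤ 1) :
    ENNReal.ofReal (P.fOut v) = P.channelFisher v := by
  have hm : Measurable fun x : ℝ × ℝ =>
      ENNReal.ofReal (gScore (P.lik x.2) v x.1 ^ 2 / gMom (P.lik x.2) v 0 x.1) :=
    (((P.measurable_gScore_lik v).pow_const 2).div (P.measurable_gMom_lik v 0)).ennreal_ofReal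
  rw [fOut_eq hv hv1, ofReal_integral_eq_lintegral_ofReal (integrable_outFisher hv hv1 _)
    (Eventually.of_forall fun p => outFisher_nonneg p), channelFisher]
  simp only [fisher]
  rw [← lintegral_lintegral_swap hm.aemeasurable]
  refine lintegral_congr fun p => ?_
  rw [outFisher, ofReal_integral_eq_lintegral_ofReal (integrable_outFisher_integrand hv hv1 p)
    (Eventually.of_forall fun y => outFisher_integrand_nonneg v p y)]

lemma fOut_nonneg (hv : v ≠ 0) (hv1 : v ≤ 1) : 0 ≤ P.fOut v := by
  rw [fOut_eq hv hv1]
  exact integral_nonneg fun p => outFisher_nonneg p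

lemma fOut_antitone {v₁ v₂ : ℝ≥0} (h₂ : v₂ ≠ 0) (h : v₁ + v₂ ≤ 1) :
    P.fOut ((v₁ + v₂ : ℝ≥0) : ℝ) ≤ P.fOut v₂ := by
  have h₂' : v₂ ≤ 1 := le_trans (le_add_of_nonneg_left zero_le) h
  rw [← ENNReal.ofReal_le_ofReal_iff (fOut_nonneg h₂ h₂'), ofReal_fOut (by positivity) h,
    ofReal_fOut h₂ h₂']
  refine lintegral_mono_ae ?_
  filter_upwards [P.ae_hasExpMoments] with y hy using hy.fisher_antitone h₂ h

lemma antitoneOn_fOut : AntitoneOn P.fOut (Ioc 0 1) := by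
  intro x hx y hy hxy
  obtain ⟨a, ha⟩ : ∃ a : ℝ≥0, (a : ℝ) = x := ⟨⟨x, hx.1.le⟩, rfl⟩
  obtain ⟨b, hb⟩ : ∃ b : ℝ≥0, (b : ℝ) = y - x := ⟨⟨y - x, by linarith⟩, rfl⟩
  have hab : ((b + a : ℝ≥0) : ℝ) = y := by push_cast; linarith
  have h := fOut_antitone (P := P) (v₁ := b) (v₂ := a)
    (fun h => hx.1.ne' (by rw [← ha, h]; rfl))
    (by rw [← NNReal.coe_le_coe, hab]; simpa using hy.2)
  rwa [hab, ha] at h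

end MemorylessChannel


/-! ### Convergence of Gaussian averages as the noise vanishes -/

section GaussianAverage

open Filter Topology Set
open scoped NNReal

/-- The map `((x, y), w) ↦ (√(1-v) x + √v w, y)`. -/
noncomputable def mixMap (v : ℝ≥0) (x : (ℝ × ℝ) × ℝ) : ℝ × ℝ :=
  (√(1 - (v : ℝ)) * x.1.1 + √(v : ℝ) * x.2, x.1.2)

lemma continuous_mixMap (v : ℝ≥0) : Continuous (mixMap v) := by
  unfold mixMap; fun_prop

/-- Stationarity of `N(0,1)` under the Ornstein-Uhlenbeck step; the output coordinate is a
spectator. -/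
lemma measurePreserving_mixMap {v : ℝ≥0} (hv : v ≤ 1) (κ : Measure ℝ) [SFinite κ] :
    MeasurePreserving (mixMap v) (((gaussianReal 0 1).prod κ).prod (gaussianReal 0 1))
      ((gaussianReal 0 1).prod κ) := by
  have hm : Measurable (mixMap v) := (continuous_mixMap v).measurable
  refine ⟨hm, Measure.ext_of_lintegral _ fun f hf => ?_⟩
  have hsub : ((1 - v : ℝ≥0) : ℝ) = 1 - v := by
    rw [NNReal.coe_sub hv]; simp
  have hfm : Measurable fun x => f (mixMap v x) := hf.comp hm
  rw [lintegral_map hf hm, lintegral_prod _ hfm.aemeasurable,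
    lintegral_prod_symm _ hfm.lintegral_prod_right'.aemeasurable,
    lintegral_prod_symm _ hf.aemeasurable]
  refine lintegral_congr fun y => ?_
  have hfy : Measurable fun z => f (z, y) := hf.comp (measurable_id.prodMk measurable_const)
  have h := lintegral_gaussianReal_add 0 (1 - v) v hfy
  rw [tsub_add_cancel_of_le hv] at h
  rw [h]
  have h2 : ∀ q, ∫⁻ x, f (x, y) ∂(gaussianReal q v) =
      ∫⁻ w, f (q + √(v : ℝ) * w, y) ∂(gaussianReal 0 1) := fun q => by
    rw [gaussianReal_eq_map q v, lintegral_map hfy (by fun_prop)]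
  simp only [h2]
  have h3 : Measurable fun q => ∫⁻ w, f (q + √(v : ℝ) * w, y) ∂(gaussianReal 0 1) := by
    have : Measurable fun x : ℝ × ℝ => f (x.1 + √(v : ℝ) * x.2, y) :=
      hfy.comp (by fun_prop : Measurable fun x : ℝ × ℝ => x.1 + √(v : ℝ) * x.2)
    exact this.lintegral_prod_right'
  rw [gaussianReal_eq_map 0 (1 - v), lintegral_map h3 (by fun_prop), hsub]
  simp only [zero_add]
  rfl

/-- For bounded continuous `g` this is dominated convergence. Such functions are dense in `L¹`, and
`mixMap` preserves the measure, so the approximation error does not grow. -/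
lemma tendsto_lintegral_mixMap_sub {κ : Measure ℝ} [IsFiniteMeasure κ] {g : ℝ × ℝ → ℝ}
    (hgm : Measurable g) (hg : Integrable g ((gaussianReal 0 1).prod κ)) {v : ℕ → ℝ≥0}
    (hv1 : ∀ n, v n ≤ 1) (hv : Tendsto v atTop (𝓝 0)) :
    Tendsto (fun n => ∫⁻ x, ‖g (mixMap (v n) x) - g x.1‖ₑ
      ∂(((gaussianReal 0 1).prod κ).prod (gaussianReal 0 1))) atTop (𝓝 0) := by
  set μ := ((gaussianReal 0 1).prod κ).prod (gaussianReal 0 1) with hμ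
  rw [ENNReal.tendsto_nhds_zero]
  intro ε hε
  obtain ⟨b, hb, _⟩ := hg.exists_boundedContinuous_lintegral_sub_le (ε := ε / 3)
    (ENNReal.div_pos hε.ne' (by norm_num)).ne'
  have hbm : Measurable b := b.continuous.measurable
  have hdm : Measurable fun x => ‖g x - b x‖ₑ := (hgm.sub hbm).enorm
  have hlim : Tendsto (fun n => ∫⁻ x, ‖b (mixMap (v n) x) - b x.1‖ₑ ∂μ) atTop
      (𝓝 (∫⁻ _, 0 ∂μ)) := by
    refine tendsto_lintegral_of_dominated_convergence (fun _ => ENNReal.ofReal (2 * ‖b‖))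
      (fun n => ((hbm.comp (continuous_mixMap _).measurable).sub
        (hbm.comp measurable_fst)).enorm) (fun n => Eventually.of_forall fun x => ?_) ?_
      (Eventually.of_forall fun x => ?_)
    · simp only
      rw [← ofReal_norm]
      refine ENNReal.ofReal_le_ofReal ((norm_sub_le _ _).trans ?_)
      linarith [b.norm_coe_le_norm (mixMap (v n) x), b.norm_coe_le_norm x.1]
    · simp [lintegral_const, ENNReal.mul_eq_top, measure_ne_top]
    · have h1 : Tendsto (fun n => mixMap (v n) x) atTop (𝓝 x.1) := by
        have h2 : Continuous fun u : ℝ≥0 => mixMap u x := by unfold mixMap; fun_prop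
        have h3 := (h2.tendsto 0).comp hv
        have h4 : mixMap 0 x = x.1 := by simp [mixMap]
        rwa [h4] at h3
      have h5 := ((b.continuous.tendsto x.1).comp h1).sub_const (b x.1)
      rw [sub_self] at h5
      simpa using h5.enorm
  rw [lintegral_zero] at hlim
  have h3 := (ENNReal.tendsto_nhds_zero.1 hlim) (ε / 3) (ENNReal.div_pos hε.ne' (by norm_num))
  filter_upwards [h3] with n hn
  have hA := (measurePreserving_mixMap (hv1 n) κ).lintegral_comp hdm
  have hB := (measurePreserving_fst (μ := (gaussianReal 0 1).prod κ)
    (ν := gaussianReal 0 1)).lintegral_comp hdm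
  calc ∫⁻ x, ‖g (mixMap (v n) x) - g x.1‖ₑ ∂μ
      ≤ ∫⁻ x, (‖g (mixMap (v n) x) - b (mixMap (v n) x)‖ₑ +
          (‖b (mixMap (v n) x) - b x.1‖ₑ + ‖g x.1 - b x.1‖ₑ)) ∂μ := by
        refine lintegral_mono fun x => ?_
        have e : g (mixMap (v n) x) - g x.1 = (g (mixMap (v n) x) - b (mixMap (v n) x)) +
          ((b (mixMap (v n) x) - b x.1) - (g x.1 - b x.1)) := by ring
        rw [e]
        exact (enorm_add_le _ _).trans (by gcongr; exact enorm_sub_le)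
    _ = ∫⁻ x, ‖g x - b x‖ₑ ∂((gaussianReal 0 1).prod κ) +
        (∫⁻ x, ‖b (mixMap (v n) x) - b x.1‖ₑ ∂μ +
          ∫⁻ x, ‖g x - b x‖ₑ ∂((gaussianReal 0 1).prod κ)) := by
        have m1 : Measurable fun x : (ℝ × ℝ) × ℝ => ‖g (mixMap (v n) x) - b (mixMap (v n) x)‖ₑ :=
          hdm.comp (continuous_mixMap _).measurable
        have m2 : Measurable fun x : (ℝ × ℝ) × ℝ => ‖g x.1 - b x.1‖ₑ := hdm.comp measurable_fst
        rw [lintegral_add_left m1, lintegral_add_right _ m2, hA, hB]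
    _ ≤ ε / 3 + (ε / 3 + ε / 3) := by gcongr
    _ = ε := by rw [← add_assoc, ENNReal.add_thirds]

end GaussianAverage


/-! ### The area theorem: capacity is at most half the integral of `f_out` -/

namespace MemorylessChannel

open Filter Topology Set InformationTheory
open scoped NNReal

variable (P : MemorylessChannel)

/-- The density of the output `Y` with respect to the reference measure. -/
noncomputable def evidence (y : ℝ) : ℝ := gMom (P.lik y) 1 0 0

/-- The law of the output `Y`. -/
noncomputable def outLaw : Measure ℝ :=
  P.ref.withDensity fun y => ENNReal.ofReal (P.evidence y)

/-- The likelihood ratio `P_out(y | z) / P_Y(y)`. -/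
noncomputable def likRatio (y z : ℝ) : ℝ := P.lik y z / P.evidence y

lemma measurable_evidence : Measurable P.evidence := by
  have h : Measurable fun y : ℝ => ((0 : ℝ), y) := measurable_prodMk_left
  have h2 := (P.measurable_gMom_lik 1 0).comp h
  rw [Function.comp_def] at h2
  exact h2

lemma evidence_nonneg (y : ℝ) : 0 ≤ P.evidence y := by
  rw [evidence, gMom_zero_lik]
  exact integral_nonneg fun z => by simpa using P.dens_nonneg z y

instance isProbabilityMeasure_outLaw : IsProbabilityMeasure P.outLaw := by
  constructor
  have hi : Integrable P.evidence P.ref := P.integrable_gMom 1 0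
  have h1 : ∫ y, P.evidence y ∂P.ref = 1 := P.integral_gMom 1 0
  rw [outLaw, withDensity_apply _ MeasurableSet.univ, setLIntegral_univ,
    ← ofReal_integral_eq_lintegral_ofReal hi (Eventually.of_forall P.evidence_nonneg), h1,
    ENNReal.ofReal_one]

lemma ae_outLaw : ∀ᵐ y ∂P.outLaw, HasExpMoments (P.lik y) ∧ 0 < P.evidence y := by
  rw [outLaw, ae_withDensity_iff P.measurable_evidence.ennreal_ofReal]
  filter_upwards [P.ae_hasExpMoments] with y hy h
  exact ⟨hy, by simpa using h⟩

lemma lintegral_outLaw (f : ℝ → ENNReal) :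
    ∫⁻ y, f y ∂P.outLaw = ∫⁻ y, ENNReal.ofReal (P.evidence y) * f y ∂P.ref :=
  lintegral_withDensity_eq_lintegral_mul_non_measurable _ P.measurable_evidence.ennreal_ofReal
    (Eventually.of_forall fun _ => by simp) f

lemma measurable_likRatio : Measurable fun x : ℝ × ℝ => P.likRatio x.2 x.1 :=
  P.measurable_dens.div (P.measurable_evidence.comp measurable_snd)

lemma likRatio_nonneg (y z : ℝ) : 0 ≤ P.likRatio y z :=
  div_nonneg (P.dens_nonneg z y) (P.evidence_nonneg y)

lemma gMom_likRatio (v : ℝ≥0) (n : ℕ) (p y : ℝ) :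
    gMom (P.likRatio y) v n p = gMom (P.lik y) v n p / P.evidence y := by
  simp only [gMom, likRatio]
  rw [← integral_div]
  simp only [mul_div_assoc]

lemma gScore_likRatio (v : ℝ≥0) (p y : ℝ) :
    gScore (P.likRatio y) v p = gScore (P.lik y) v p / P.evidence y := by
  simp only [gScore, gMom_likRatio]
  ring

lemma measurable_gMom_likRatio (v : ℝ≥0) :
    Measurable fun x : ℝ × ℝ => gMom (P.likRatio x.2) v 0 x.1 := by
  simp only [gMom_likRatio]
  exact (P.measurable_gMom_lik v 0).div (P.measurable_evidence.comp measurable_snd)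

variable {P}

lemma hasExpMoments_likRatio {y : ℝ} (hy : HasExpMoments (P.lik y)) :
    HasExpMoments (P.likRatio y) where
  measurable := hy.measurable.div_const _
  nonneg := P.likRatio_nonneg y
  integrable t := by
    refine ((hy.integrable t).div_const (P.evidence y)).congr (Eventually.of_forall fun z => ?_)
    simp only [likRatio]
    ring

lemma gMom_likRatio_one {y : ℝ} (hy : 0 < P.evidence y) : gMom (P.likRatio y) 1 0 0 = 1 := by
  rw [gMom_likRatio]
  exact div_self hy.ne'

lemma likRatio_ne_zero {y : ℝ} (hy : 0 < P.evidence y) : ¬ P.likRatio y =ᵐ[volume] 0 := fun h => by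
  have := HasExpMoments.gMom_eq_zero h (one_ne_zero (α := ℝ≥0)) 0 0
  rw [gMom_likRatio_one hy] at this
  exact one_ne_zero this

/-- The Fisher information is homogeneous of degree one in the likelihood. Where the evidence
vanishes the left side is `0`, so only an inequality is asserted. -/
lemma ofReal_evidence_mul_fisher_le (v : ℝ≥0) (y : ℝ) :
    ENNReal.ofReal (P.evidence y) * fisher (P.likRatio y) v ≤ fisher (P.lik y) v := by
  rw [fisher, fisher, ← lintegral_const_mul' _ _ ENNReal.ofReal_ne_top]
  refine lintegral_mono fun p => ?_
  simp only
  rw [← ENNReal.ofReal_mul (P.evidence_nonneg y), gScore_likRatio, gMom_likRatio]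
  refine ENNReal.ofReal_le_ofReal ?_
  rcases (P.evidence_nonneg y).eq_or_lt with h | h
  · rw [← h, zero_mul]
    exact outFisher_integrand_nonneg v p y
  · refine le_of_eq ?_
    rcases eq_or_ne (gMom (P.lik y) v 0 p) 0 with h0 | h0
    · simp [h0]
    · field_simp

variable (P)

/-- The mutual information between the output and the input smoothed at noise level `v`. -/
noncomputable def smoothInfo (v : ℝ≥0) : ENNReal := ∫⁻ y, smoothEnt (P.likRatio y) v ∂P.outLaw

lemma measurable_klFun_gMom (v : ℝ≥0) :
    Measurable fun x : ℝ × ℝ => ENNReal.ofReal (klFun (gMom (P.likRatio x.2) v 0 x.1)) :=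
  (measurable_klFun.comp (P.measurable_gMom_likRatio v)).ennreal_ofReal

lemma measurable_smoothEnt (v : ℝ≥0) : Measurable fun y => smoothEnt (P.likRatio y) v :=
  (P.measurable_klFun_gMom v).lintegral_prod_left'

/-- At `v = 1` the point `p` is deterministic, and the likelihood ratio averages to 1. -/
lemma smoothInfo_one : P.smoothInfo 1 = 0 := by
  refine (lintegral_congr_ae ?_).trans lintegral_zero
  filter_upwards [P.ae_outLaw] with y hy
  rw [smoothEnt, tsub_self, gaussianReal_zero_var, lintegral_dirac, gMom_likRatio_one hy.2,
    klFun_one, ENNReal.ofReal_zero]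

variable {P}

lemma smoothInfo_le_add {v₁ v₂ : ℝ≥0} (h₂ : v₂ ≠ 0) (h : v₁ + v₂ ≤ 1) :
    P.smoothInfo v₂ ≤ P.smoothInfo (v₁ + v₂) + ENNReal.ofReal (v₁ / 2 * P.fOut v₂) := by
  have h₂' : v₂ ≤ 1 := le_trans (le_add_of_nonneg_left zero_le) h
  calc P.smoothInfo v₂ ≤ ∫⁻ y, (smoothEnt (P.likRatio y) (v₁ + v₂) +
        ENNReal.ofReal (v₁ / 2) * fisher (P.likRatio y) v₂) ∂P.outLaw := by
        refine lintegral_mono_ae ?_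
        filter_upwards [P.ae_outLaw] with y hy
        exact (hasExpMoments_likRatio hy.1).smoothEnt_le (likRatio_ne_zero hy.2) h₂ h
    _ = P.smoothInfo (v₁ + v₂) +
        ENNReal.ofReal (v₁ / 2) * ∫⁻ y, fisher (P.likRatio y) v₂ ∂P.outLaw := by
        rw [lintegral_add_left (P.measurable_smoothEnt _),
          lintegral_const_mul' _ _ ENNReal.ofReal_ne_top, smoothInfo]
    _ ≤ _ := by
        rw [ENNReal.ofReal_mul (by positivity), ofReal_fOut h₂ h₂', channelFisher,
          lintegral_outLaw]
        gcongr with y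
        exact ofReal_evidence_mul_fisher_le v₂ y

/-- Upper Riemann sums of `f_out` dominate the smoothed information. -/
lemma smoothInfo_le_sum {v s : ℝ≥0} (hv : v ≠ 0) (N : ℕ) (h : v + N * s ≤ 1) :
    P.smoothInfo v ≤ P.smoothInfo (v + N * s) +
      ENNReal.ofReal (∑ i ∈ Finset.range N, s / 2 * P.fOut ((v + i * s : ℝ≥0) : ℝ)) := by
  induction N with
  | zero => simp
  | succ N ih =>
    have e : v + ((N + 1 : ℕ) : ℝ≥0) * s = s + (v + N * s) := by push_cast; ring
    rw [e] at h ⊢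
    have hN : v + N * s ≤ 1 := le_trans (le_add_of_nonneg_left zero_le) h
    have hne : v + N * s ≠ 0 := by positivity
    have h0 : ∀ i ∈ Finset.range N, 0 ≤ (s : ℝ) / 2 * P.fOut ((v + i * s : ℝ≥0) : ℝ) := by
      intro i hi
      have hi' : i ≤ N := (Finset.mem_range.1 hi).le
      refine mul_nonneg (by positivity) (fOut_nonneg (by positivity) (le_trans ?_ hN))
      gcongr
    refine (ih hN).trans ?_
    rw [Finset.sum_range_succ, ENNReal.ofReal_add (Finset.sum_nonneg h0)
      (mul_nonneg (by positivity) (fOut_nonneg hne hN)), add_comm (ENNReal.ofReal _), ← add_assoc]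
    gcongr
    exact smoothInfo_le_add hne h

lemma smoothInfo_le_integral {v : ℝ≥0} (hv : v ≠ 0) (hv1 : v ≤ 1) :
    P.smoothInfo v ≤ ENNReal.ofReal (1 / 2 * ∫ x in (v : ℝ)..1, P.fOut x) := by
  have hv0 : (0 : ℝ) < v := by positivity
  have hvr : (v : ℝ) ≤ 1 := by exact_mod_cast hv1
  -- By monotonicity of `f_out` the left-endpoint sum exceeds the integral by at most one mesh width
  -- times `f_out(v)`, an error that vanishes as `N → ∞`.
  have key : ∀ N : ℕ, P.smoothInfo v ≤ ENNReal.ofReal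
      (1 / 2 * (∫ x in (v : ℝ)..1, P.fOut x) + (1 - v) * P.fOut v / 2 * (1 / ((N : ℝ) + 1))) := by
    intro N
    set s : ℝ≥0 := (1 - v) / (N + 1) with hs
    have hN0 : ((N : ℝ≥0) + 1) ≠ 0 := by positivity
    have hsum : v + ((N + 1 : ℕ) : ℝ≥0) * s = 1 := by
      push_cast
      rw [hs, mul_div_cancel₀ _ hN0, add_tsub_cancel_of_le hv1]
    have hsr : (s : ℝ) = (1 - v) / (N + 1) := by
      rw [hs]; push_cast [NNReal.coe_sub hv1]; rfl
    have h1 := smoothInfo_le_sum (P := P) (s := s) hv (N + 1) hsum.le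
    rw [hsum, P.smoothInfo_one, zero_add] at h1
    refine h1.trans (ENNReal.ofReal_le_ofReal ?_)
    set x : ℕ → ℝ := fun i => v + i * s with hx
    have hxc : ∀ i : ℕ, ((v + i * s : ℝ≥0) : ℝ) = x i := fun i => by push_cast; rfl
    simp only [hxc]
    have hxl : x (N + 1) = 1 := by rw [← hxc, hsum]; rfl
    have hx0 : x 0 = v := by simp [hx]
    have hxm : Monotone x := fun i j hij => by simp only [hx]; gcongr
    have hxpos : ∀ i, 0 < x i := fun i => by simp only [hx]; positivity
    have hanti : ∀ i ≤ N, AntitoneOn P.fOut (uIcc (x i) (x (i + 1))) := fun i hi => by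
      rw [uIcc_of_le (hxm (Nat.le_succ i))]
      refine antitoneOn_fOut.mono fun z hz => ⟨(hxpos i).trans_le hz.1, hz.2.trans ?_⟩
      rw [← hxl]; exact hxm (by omega)
    have hstep : ∀ i ≤ N, s * P.fOut (x (i + 1)) ≤ ∫ z in (x i)..(x (i + 1)), P.fOut z := by
      intro i hi
      have hle := hxm (Nat.le_succ i)
      have h2 : ∫ _ in (x i)..(x (i + 1)), P.fOut (x (i + 1)) ≤
          ∫ z in (x i)..(x (i + 1)), P.fOut z := by
        refine intervalIntegral.integral_mono_on hle intervalIntegrable_const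
          (hanti i hi).intervalIntegrable fun z hz => ?_
        exact hanti i hi (by rw [uIcc_of_le hle]; exact hz) right_mem_uIcc hz.2
      rw [intervalIntegral.integral_const, smul_eq_mul] at h2
      convert h2 using 2
      simp only [hx]; push_cast; ring
    have hadd := intervalIntegral.sum_integral_adjacent_intervals (μ := volume) (f := P.fOut)
      (a := x) (n := N + 1) (fun i hi => (hanti i (by omega)).intervalIntegrable)
    rw [hxl, hx0] at hadd
    have hsum2 : ∑ i ∈ Finset.range (N + 1), (s : ℝ) * P.fOut (x i) ≤
        s * P.fOut v + ∫ z in (v : ℝ)..1, P.fOut z := by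
      have h3 : ∑ i ∈ Finset.range (N + 1), (s : ℝ) * P.fOut (x (i + 1)) ≤
          ∫ z in (v : ℝ)..1, P.fOut z := by
        rw [← hadd]
        exact Finset.sum_le_sum fun i hi => hstep i (by have := Finset.mem_range.1 hi; omega)
      have h4 := Finset.sum_range_succ' (fun i => (s : ℝ) * P.fOut (x i)) (N + 1)
      have h5 := Finset.sum_range_succ (fun i => (s : ℝ) * P.fOut (x i)) (N + 1)
      have h6 : 0 ≤ (s : ℝ) * P.fOut (x (N + 1)) := by
        rw [hxl]
        exact mul_nonneg s.2 (fOut_nonneg (v := 1) one_ne_zero le_rfl)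
      rw [hx0] at h4
      linarith
    have e : ∑ i ∈ Finset.range (N + 1), (s : ℝ) / 2 * P.fOut (x i) =
        1 / 2 * ∑ i ∈ Finset.range (N + 1), (s : ℝ) * P.fOut (x i) := by
      rw [Finset.mul_sum]
      exact Finset.sum_congr rfl fun i _ => by ring
    have e2 : (1 - (v : ℝ)) * P.fOut v / 2 * (1 / ((N : ℝ) + 1)) = 1 / 2 * (s * P.fOut v) := by
      rw [hsr]; ring
    rw [e, e2]
    linarith
  have h := (tendsto_one_div_add_atTop_nhds_zero_nat (𝕜 := ℝ)).const_mul
    ((1 - (v : ℝ)) * P.fOut v / 2)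
  have h2 := h.const_add (1 / 2 * ∫ x in (v : ℝ)..1, P.fOut x)
  rw [mul_zero, add_zero] at h2
  exact ge_of_tendsto' (ENNReal.tendsto_ofReal h2) key

/-! ### Identification of the mutual information -/

instance isMarkovKernel_kernel : IsMarkovKernel P.kernel := ⟨fun u => ⟨by
  have hm : Measurable (Function.uncurry fun u y => ENNReal.ofReal (P.dens u y)) :=
    P.measurable_dens.ennreal_ofReal
  rw [kernel, Kernel.withDensity_apply _ hm, Kernel.const_apply,
    withDensity_apply _ MeasurableSet.univ, setLIntegral_univ, P.lintegral_dens]⟩⟩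

variable (P)

lemma jointLaw_eq : P.jointLaw = ((gaussianReal 0 1).prod P.ref).withDensity
    fun x => ENNReal.ofReal (P.dens x.1 x.2) := by
  have hm : Measurable (Function.uncurry fun u y => ENNReal.ofReal (P.dens u y)) :=
    P.measurable_dens.ennreal_ofReal
  have : IsSFiniteKernel ((Kernel.const ℝ P.ref).withDensity
      fun u y => ENNReal.ofReal (P.dens u y)) :=
    inferInstanceAs (IsSFiniteKernel P.kernel)
  rw [jointLaw, kernel, Measure.compProd_withDensity hm, Measure.compProd_const]

lemma fst_jointLaw : P.jointLaw.fst = gaussianReal 0 1 := Measure.fst_compProd _ _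

lemma ofReal_evidence {y : ℝ} (hy : HasExpMoments (P.lik y)) :
    ENNReal.ofReal (P.evidence y) = ∫⁻ z, ENNReal.ofReal (P.dens z y) ∂(gaussianReal 0 1) := by
  have hi : Integrable (P.lik y) (gaussianReal 0 1) := by simpa using hy.integrable 0
  rw [evidence, gMom_zero_eq]
  exact ofReal_integral_eq_lintegral_ofReal hi (Eventually.of_forall hy.nonneg)

lemma snd_jointLaw : P.jointLaw.snd = P.outLaw := by
  refine Measure.ext_of_lintegral _ fun f hf => ?_
  have hm : Measurable fun x : ℝ × ℝ => ENNReal.ofReal (P.dens x.1 x.2) :=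
    P.measurable_dens.ennreal_ofReal
  have hm2 : Measurable fun x : ℝ × ℝ => ENNReal.ofReal (P.dens x.1 x.2) * f x.2 :=
    hm.mul (hf.comp measurable_snd)
  have hf2 : Measurable fun x : ℝ × ℝ => f x.2 := hf.comp measurable_snd
  rw [Measure.snd, lintegral_map hf measurable_snd, jointLaw_eq,
    lintegral_withDensity_eq_lintegral_mul _ hm hf2, lintegral_outLaw]
  refine (lintegral_prod_symm _ hm2.aemeasurable).trans (lintegral_congr_ae ?_)
  filter_upwards [P.ae_hasExpMoments] with y hy
  have hmy : Measurable fun z => ENNReal.ofReal (P.dens z y) := (P.measurable_lik y).ennreal_ofReal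
  rw [lintegral_mul_const _ hmy, P.ofReal_evidence hy]

lemma jointLaw_eq_withDensity : P.jointLaw = ((gaussianReal 0 1).prod P.outLaw).withDensity
    fun x => ENNReal.ofReal (P.likRatio x.2 x.1) := by
  have hme : Measurable fun x : ℝ × ℝ => ENNReal.ofReal (P.evidence x.2) :=
    (P.measurable_evidence.comp measurable_snd).ennreal_ofReal
  have hset : MeasurableSet {x : ℝ × ℝ | P.dens x.1 x.2 = 0 ∨ P.evidence x.2 ≠ 0} :=
    (measurableSet_eq_fun P.measurable_dens measurable_const).union
      (measurableSet_eq_fun (P.measurable_evidence.comp measurable_snd) measurable_const).compl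
  -- An output with zero evidence has zero density for almost every input. Dividing by the evidence
  -- therefore loses no mass, and the joint law is absolutely continuous with respect to the product
  -- of its marginals.
  have hae : ∀ᵐ x : ℝ × ℝ ∂((gaussianReal 0 1).prod P.ref),
      P.dens x.1 x.2 = 0 ∨ P.evidence x.2 ≠ 0 := by
    rw [Measure.ae_prod_iff_ae_ae hset,
      Measure.ae_ae_comm (p := fun z y => P.dens z y = 0 ∨ P.evidence y ≠ 0) hset]
    filter_upwards [P.ae_hasExpMoments] with y hy
    by_cases h : P.evidence y = 0
    · have h1 := hy.ae_eq_zero_of_gMom_zero one_ne_zero le_rfl h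
      filter_upwards [(gaussianReal_absolutelyContinuous 0 one_ne_zero).ae_le h1] with z hz
      exact Or.inl hz
    · exact Eventually.of_forall fun z => Or.inr h
  rw [jointLaw_eq, outLaw, prod_withDensity_right P.measurable_evidence.ennreal_ofReal,
    ← withDensity_mul _ hme P.measurable_likRatio.ennreal_ofReal]
  refine withDensity_congr_ae ?_
  filter_upwards [hae] with x hx
  simp only [Pi.mul_apply]
  rw [← ENNReal.ofReal_mul (P.evidence_nonneg _)]
  congr 1
  simp only [likRatio, lik]
  rcases hx with hx | hx
  · simp [hx]
  · rw [mul_div_cancel₀ _ hx]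

lemma mutualInfo_eq : P.mutualInfo =
    ∫⁻ x, ENNReal.ofReal (klFun (P.likRatio x.2 x.1)) ∂((gaussianReal 0 1).prod P.outLaw) := by
  have : IsFiniteMeasure P.jointLaw := by unfold jointLaw; infer_instance
  rw [mutualInfo, fst_jointLaw, snd_jointLaw, klDiv_eq_lintegral_klFun,
    if_pos (by rw [jointLaw_eq_withDensity]; exact withDensity_absolutelyContinuous _ _)]
  refine lintegral_congr_ae ?_
  have h := Measure.rnDeriv_withDensity ((gaussianReal 0 1).prod P.outLaw)
    P.measurable_likRatio.ennreal_ofReal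
  rw [← jointLaw_eq_withDensity] at h
  filter_upwards [h] with x hx
  rw [hx, ENNReal.toReal_ofReal (P.likRatio_nonneg _ _)]

lemma integrable_likRatio :
    Integrable (fun x : ℝ × ℝ => P.likRatio x.2 x.1) ((gaussianReal 0 1).prod P.outLaw) := by
  refine ⟨P.measurable_likRatio.aestronglyMeasurable, ?_⟩
  rw [hasFiniteIntegral_iff_ofReal (Eventually.of_forall fun x => P.likRatio_nonneg _ _),
    ← setLIntegral_univ, ← withDensity_apply _ MeasurableSet.univ, ← jointLaw_eq_withDensity]
  have : IsFiniteMeasure P.jointLaw := by unfold jointLaw; infer_instance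
  exact measure_lt_top _ _

variable {P}

/-- The likelihood ratio after smoothing the input with the Ornstein-Uhlenbeck semigroup. -/
noncomputable def smoothRatio (P : MemorylessChannel) (v : ℝ≥0) (x : ℝ × ℝ) : ℝ :=
  gMom (P.likRatio x.2) v 0 (√(1 - (v : ℝ)) * x.1)

lemma measurable_smoothRatio (v : ℝ≥0) : Measurable (P.smoothRatio v) := by
  have h : Measurable fun x : ℝ × ℝ => (√(1 - (v : ℝ)) * x.1, x.2) := by fun_prop
  have h2 := (P.measurable_gMom_likRatio v).comp h
  rw [Function.comp_def] at h2
  exact h2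

lemma measurable_klFun_smoothRatio (v : ℝ≥0) :
    Measurable fun x => ENNReal.ofReal (klFun (P.smoothRatio v x)) :=
  (measurable_klFun.comp (measurable_smoothRatio v)).ennreal_ofReal

lemma smoothInfo_eq {v : ℝ≥0} (hv1 : v ≤ 1) : P.smoothInfo v =
    ∫⁻ x : ℝ × ℝ, ENNReal.ofReal (klFun (P.smoothRatio v x))
      ∂((gaussianReal 0 1).prod P.outLaw) := by
  rw [lintegral_prod_symm _ (measurable_klFun_smoothRatio v).aemeasurable, smoothInfo]
  refine lintegral_congr fun y => ?_
  have hmy : Measurable fun p => ENNReal.ofReal (klFun (gMom (P.likRatio y) v 0 p)) := by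
    have h : Measurable fun p : ℝ => (p, y) := measurable_prodMk_right
    have h2 := (P.measurable_klFun_gMom v).comp h
    rw [Function.comp_def] at h2
    exact h2
  rw [smoothEnt, gaussianReal_eq_map 0 (1 - v), lintegral_map hmy (by fun_prop),
    NNReal.coe_sub hv1]
  simp [smoothRatio]

/-- The smoothed ratio is the conditional mean of the ratio at the mixed point, so the norm can be
taken inside the integral. -/
lemma lintegral_smoothRatio_sub_le {v : ℝ≥0} (hv : v ≠ 0) (hv1 : v ≤ 1) :
    ∫⁻ x : ℝ × ℝ, ‖P.smoothRatio v x - P.likRatio x.2 x.1‖ₑ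
      ∂((gaussianReal 0 1).prod P.outLaw) ≤
    ∫⁻ x : (ℝ × ℝ) × ℝ, ‖P.likRatio (mixMap v x).2 (mixMap v x).1 - P.likRatio x.1.2 x.1.1‖ₑ
      ∂(((gaussianReal 0 1).prod P.outLaw).prod (gaussianReal 0 1)) := by
  have hm : Measurable fun x : (ℝ × ℝ) × ℝ =>
      ‖P.likRatio (mixMap v x).2 (mixMap v x).1 - P.likRatio x.1.2 x.1.1‖ₑ :=
    ((P.measurable_likRatio.comp (continuous_mixMap v).measurable).sub
      (P.measurable_likRatio.comp measurable_fst)).enorm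
  rw [lintegral_prod _ hm.aemeasurable]
  refine lintegral_mono_ae ?_
  have hgood : ∀ᵐ x : ℝ × ℝ ∂((gaussianReal 0 1).prod P.outLaw), HasExpMoments (P.lik x.2) :=
    Measure.quasiMeasurePreserving_snd.ae (P.ae_outLaw.mono fun y hy => hy.1)
  filter_upwards [hgood] with x hx
  have hD := hasExpMoments_likRatio hx
  rw [smoothRatio]
  set p := √(1 - (v : ℝ)) * x.1 with hp
  have hi : Integrable (P.likRatio x.2) (gaussianReal p v) := by
    simpa using hD.integrable_pow_mul hv hv1 0 p
  have e : gMom (P.likRatio x.2) v 0 p =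
      ∫ w, P.likRatio x.2 (p + √(v : ℝ) * w) ∂(gaussianReal 0 1) := by
    rw [gMom_zero_eq]
    simp only
    rw [gaussianReal_eq_map p v,
      integral_map (by fun_prop) hD.measurable.aestronglyMeasurable]
  have hi' : Integrable (fun w => P.likRatio x.2 (p + √(v : ℝ) * w)) (gaussianReal 0 1) := by
    rw [gaussianReal_eq_map p v,
      integrable_map_measure hD.measurable.aestronglyMeasurable (by fun_prop)] at hi
    exact hi
  have e2 : gMom (P.likRatio x.2) v 0 p - P.likRatio x.2 x.1 =
      ∫ w, (P.likRatio x.2 (p + √(v : ℝ) * w) - P.likRatio x.2 x.1) ∂(gaussianReal 0 1) := by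
    rw [integral_sub hi' (integrable_const _), e]
    simp
  rw [e2]
  exact enorm_integral_le_lintegral_enorm _

lemma tendsto_eLpNorm_smoothRatio {v : ℕ → ℝ≥0} (hv0 : ∀ n, v n ≠ 0) (hv1 : ∀ n, v n ≤ 1)
    (hvlim : Tendsto v atTop (𝓝 0)) :
    Tendsto (fun n => eLpNorm (P.smoothRatio (v n) - fun x : ℝ × ℝ => P.likRatio x.2 x.1) 1
      ((gaussianReal 0 1).prod P.outLaw)) atTop (𝓝 0) := by
  simp only [eLpNorm_one_eq_lintegral_enorm]
  exact tendsto_of_tendsto_of_tendsto_of_le_of_le tendsto_const_nhds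
    (tendsto_lintegral_mixMap_sub P.measurable_likRatio P.integrable_likRatio hv1 hvlim)
    (fun n => zero_le) (fun n => lintegral_smoothRatio_sub_le (hv0 n) (hv1 n))

/-- Fatou's lemma for the smoothed relative entropies. -/
lemma mutualInfo_le_liminf {v : ℕ → ℝ≥0}
    (hlim : ∀ᵐ x ∂((gaussianReal 0 1).prod P.outLaw),
      Tendsto (fun n => P.smoothRatio (v n) x) atTop (𝓝 (P.likRatio x.2 x.1)))
    (hv1 : ∀ n, v n ≤ 1) :
    P.mutualInfo ≤ liminf (fun n => P.smoothInfo (v n)) atTop := by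
  simp only [smoothInfo_eq (hv1 _)]
  rw [mutualInfo_eq]
  refine le_trans (le_of_eq (lintegral_congr_ae ?_))
    (lintegral_liminf_le fun n => measurable_klFun_smoothRatio (P := P) (v n))
  filter_upwards [hlim] with x hx
  exact (ENNReal.tendsto_ofReal ((continuous_klFun.tendsto _).comp hx)).liminf_eq.symm

/-- Lower semicontinuity of the mutual information as the smoothing vanishes. -/
lemma mutualInfo_le_of_smoothInfo_le {B : ENNReal}
    (hB : ∀ v : ℝ≥0, v ≠ 0 → v ≤ 1 → P.smoothInfo v ≤ B) : P.mutualInfo ≤ B := by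
  obtain ⟨v, -, hv, hvlim⟩ := exists_seq_strictAnti_tendsto' (zero_lt_one (α := ℝ≥0))
  have hv0 : ∀ n, v n ≠ 0 := fun n => (hv n).1.ne'
  have hv1 : ∀ n, v n ≤ 1 := fun n => (hv n).2.le
  -- Convergence in `L¹` gives convergence in measure and hence almost everywhere along a
  -- subsequence, which is all that Fatou's lemma requires.
  obtain ⟨ns, -, hns⟩ := (tendstoInMeasure_of_tendsto_eLpNorm one_ne_zero
    (fun n => (measurable_smoothRatio (P := P) (v n)).aestronglyMeasurable)
    P.measurable_likRatio.aestronglyMeasurable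
    (tendsto_eLpNorm_smoothRatio hv0 hv1 hvlim)).exists_seq_tendsto_ae
  refine (mutualInfo_le_liminf (v := fun n => v (ns n)) hns fun n => hv1 _).trans ?_
  refine (liminf_le_liminf (Eventually.of_forall fun n => hB _ (hv0 (ns n)) (hv1 _))).trans ?_
  exact (liminf_const B).le

lemma fOut_nonneg_of_mem {x : ℝ} (hx : x ∈ Ioc (0 : ℝ) 1) : 0 ≤ P.fOut x := by
  have h := fOut_nonneg (P := P) (v := ⟨x, hx.1.le⟩)
    (fun h => hx.1.ne' (congrArg NNReal.toReal h)) (NNReal.coe_le_coe.1 hx.2)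
  exact h

theorem two_mul_capacity_le (hInt : IntervalIntegrable P.fOut volume 0 1) :
    2 * P.capacity ≤ ∫ x in (0 : ℝ)..1, P.fOut x := by
  have h0 : 0 ≤ ∫ x in (0 : ℝ)..1, P.fOut x := by
    rw [intervalIntegral.integral_of_le zero_le_one]
    exact setIntegral_nonneg measurableSet_Ioc fun x hx => fOut_nonneg_of_mem hx
  have h : P.mutualInfo ≤ ENNReal.ofReal (1 / 2 * ∫ x in (0 : ℝ)..1, P.fOut x) := by
    refine mutualInfo_le_of_smoothInfo_le fun v hv hv1 =>
      (smoothInfo_le_integral hv hv1).trans (ENNReal.ofReal_le_ofReal ?_)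
    have hvr : (v : ℝ) ≤ 1 := by exact_mod_cast hv1
    have hle : ∫ x in (v : ℝ)..1, P.fOut x ≤ ∫ x in (0 : ℝ)..1, P.fOut x := by
      refine intervalIntegral.integral_mono_interval v.2 hvr le_rfl ?_ hInt
      exact (ae_restrict_iff' measurableSet_Ioc).2
        (Eventually.of_forall fun x hx => fOut_nonneg_of_mem hx)
    linarith
  have h2 := ENNReal.toReal_mono ENNReal.ofReal_ne_top h
  rw [ENNReal.toReal_ofReal (by linarith)] at h2
  change P.capacity ≤ _ at h2
  linarith

/-- Integrability near `0` is the only issue, since away from `0` the function is monotone on a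
compact interval. A nonintegrable function has integral `0` by convention, so the nonzero value in
the definition of `h` already entails integrability. -/
lemma intervalIntegrable_fOut {h : ℝ} (h0 : 0 < h) (h1 : h ≤ 1)
    (hne : (∫ x in (0 : ℝ)..h, P.fOut x) ≠ 0) : IntervalIntegrable P.fOut volume 0 1 := by
  have ha : IntervalIntegrable P.fOut volume 0 h := by
    by_contra hcon
    exact hne (intervalIntegral.integral_undef hcon)
  refine ha.trans (AntitoneOn.intervalIntegrable ?_)
  rw [uIcc_of_le h1]
  exact antitoneOn_fOut.mono fun x hx => ⟨h0.trans_le hx.1, hx.2⟩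

end MemorylessChannel

theorem lemma1 :
    ∃ k : ℝ, 0 < k ∧
      ∀ (P : MemorylessChannel) (R δ ρ h : ℝ),
        0 < R → R < P.capacity →
        0 < δ → δ < min ((P.capacity - R) / (2 * R)) (1 / 2) →
        0 < h → h ≤ 1 →
        (∫ x in (0 : ℝ)..h, P.fOut x) = 3 / 2 * (P.capacity - R) →
        0 < ρ → ρ < h / 2 →
        (R < (1 - ρ) / (2 + δ) * P.fOut 1 →
          ∃ M₀ : ℕ, ∀ M : ℕ, M₀ ≤ M → ∀ Γ ω c : ℕ, 1 ≤ c → c ≤ Γ →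
            SCSPARC.sePsi P R M Γ ω ρ 1 c ≤ SCSPARC.errLevel k M δ) ∧
        ((1 - ρ) / (2 + δ) * P.fOut 1 ≤ R →
          (∃ ω₀ : ℕ, ∀ ω : ℕ, ω₀ ≤ ω → 1 ≤ SCSPARC.waveSpeed P R ρ ω) ∧
          ∃ M₀ : ℕ, ∀ M : ℕ, M₀ ≤ M → ∀ Γ ω : ℕ, 1 ≤ SCSPARC.waveSpeed P R ρ ω →
            ∀ t c : ℕ, 1 ≤ t → 1 ≤ c →
              c ≤ min (4 * ω + t * SCSPARC.waveSpeed P R ρ ω) ⌈(Γ : ℝ) / 2⌉₊ →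
              SCSPARC.sePsi P R M Γ ω ρ t c = SCSPARC.sePsi P R M Γ ω ρ t (Γ - c + 1) ∧
              SCSPARC.sePsi P R M Γ ω ρ t c ≤ SCSPARC.errLevel k M δ) := by
  refine ⟨1 / 200, by norm_num, ?_⟩
  intro P R δ ρ h hR hRC hδ hδm h0 h1 hInt hρ hρh
  have hi := MemorylessChannel.intervalIntegrable_fOut (P := P) h0 h1
    (by rw [hInt]; exact (by linarith : (0 : ℝ) < _).ne')
  exact SCSPARC.stateEvolution_of_fOut P (fun x hx => MemorylessChannel.fOut_nonneg_of_mem hx)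
    MemorylessChannel.antitoneOn_fOut hi (MemorylessChannel.two_mul_capacity_le hi) hR hRC hδ hδm
    h1 hInt hρ hρh
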